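/- **Setting.** Let $k\ge 1$ be an integer and let $f:\mathbb R\to\mathbb R$ be a normalized stationary centered Gaussian process of class $\mathcal C^k$. That is: $(f(x))_{x\in\mathbb R}$ is a centered Gaussian process, for every $t\in\mathbb R$ the process $x\mapsto f(x+t)$ has the same distribution as $f$, the trajectories of $f$ are almost surely of class $\mathcal C^k$, and the correlation function $\kappa(x)=\mathbb E[f(0)f(x)]$ satisfies $\kappa(0)=1=-\kappa''(0)$. A Gaussian vector is called non-degenerate if the determinant of its variance matrix is non-zero. Let $\Delta_k=\{x\in\mathbb R^k : x_i=x_j \text{ for some } i\ne j\}$ be the large diagonal, let $Z=f^{-1}(0)$, and for $x\in\mathbb R^k\setminus\Delta_k$ let the $k$-point function of $Z$ at $x$ be $$\rho_k(x)=\lim_{\varepsilon\to0^+}\frac1{(2\varepsilon)^k}\,\mathbb E\Big[\prod_{i=1}^k\operatorname{card}\big(Z\cap[x_i-\varepsilon,x_i+\varepsilon]\big)\Big],$$ which is well-defined at $x$ if this limit exists in $[0,+\infty)$. Let $y=(y_i)_{1\le i\le k}\in\mathbb R^k$ and let $\mathcal I$ be the partition of $\{1,\dots,k\}$ such that $y_i=y_j$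 if and only if $i$ and $j$ belong to the same block of $\mathcal I$. For $I\in\mathcal I$ let $|I|$ be the cardinality of $I$ and let $y_I$ be the common value of the $y_i$, $i\in I$. **Theorem 1.9 (Vanishing order of the $k$-point function).** Assume that the Gaussian vector $\big(f^{(i)}(y_I)\big)_{I\in\mathcal I,\,0\le i<|I|}$ is non-degenerate, and set $$\ell(y)=\Bigg(\prod_{I\in\mathcal I}\prod_{i=0}^{|I|-1}\frac{i!}{|I|!}\Bigg)\, \frac{\mathbb E\Big[\prod_{I\in\mathcal I}\big|f^{(|I|)}(y_I)\big|^{|I|}\ \Big|\ \forall I\in\mathcal I,\ \forall i\in\{0,\dots,|I|-1\},\ f^{(i)}(y_I)=0\Big]}{(2\pi)^{k/2}\,\det\Big(\operatorname{Var}\big((f^{(i)}(y_I))_{I\in\mathcal I,\,0\le i<|I|}\big)\Big)^{1/2}},$$ where the conditional expectation is the usual one for Gaussian vectors: for a centered Gaussian vector $(U,V)$ with $U$ non-degenerate, the law of $V$ given $U=0$ is the law of $V-\operatorname{Cov}(V,U)\operatorname{Var}(U)^{-1}U$. Then there exists a neighborhood $\mathcal U$ of $y$ in $\mathbb R^k$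 such that $\rho_k$ is well-defined on $\mathcal U\setminus\Delta_k$ and, as $x\to y$ with $x\in \mathcal U\setminus\Delta_k$, $$\Bigg(\prod_{I\in\mathcal I}\ \prod_{\{(i,j)\in I^2\,:\,i<j\}}\frac1{|x_i-x_j|}\Bigg)\rho_k(x)\longrightarrow \ell(y).$$ Moreover, if $\big(f^{(i)}(y_I)\big)_{I\in\mathcal I,\,0\le i\le|I|}$ is non-degenerate, then $\ell(y)>0$. -/

import Mathlib

open MeasureTheory ProbabilityTheory Filter Topology
open scoped ENNReal Nat

noncomputable section

/-! ### Gaussian vectors: variance matrix, non-degeneracy, conditioning -/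

/-- The covariance matrix `(Cov(X_a, Y_b))_{a, b}` of two finite families of real random variables. -/
def covMatrix {Ω α β : Type*} [MeasurableSpace Ω] (μ : Measure Ω)
    (X : α → Ω → ℝ) (Y : β → Ω → ℝ) : Matrix α β ℝ :=
  Matrix.of fun a b => cov[X a, Y b; μ]

/-- The variance matrix of a random vector. -/
def varMatrix {Ω α : Type*} [MeasurableSpace Ω] (μ : Measure Ω) (X : α → Ω → ℝ) : Matrix α α ℝ :=
  covMatrix μ X X

/-- A (Gaussian) random vector is non-degenerate if its variance matrix is invertible. -/
def IsNondegenerateVector {Ω α : Type*} [MeasurableSpace Ω] [Fintype α] [DecidableEq α]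
    (μ : Measure Ω) (X : α → Ω → ℝ) : Prop :=
  (varMatrix μ X).det ≠ 0

/-- The matrix `Cov(V, U) Var(U)⁻¹` of the linear regression of `V` on `U`. -/
def regressionMatrix {Ω α β : Type*} [MeasurableSpace Ω] [Fintype α] [DecidableEq α]
    (μ : Measure Ω) (U : α → Ω → ℝ) (V : β → Ω → ℝ) : Matrix β α ℝ :=
  covMatrix μ V U * (varMatrix μ U)⁻¹

/-- The conditional law of `V` given that `U = u`, for a jointly Gaussian vector `(U, V)` with
`U` non-degenerate: the law of `V + Cov(V, U) Var(U)⁻¹ (u - U)`. As `{U = u}` is a null event, a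
version of the conditional law has to be chosen; this is the weakly continuous one
(see `condDistrib_ae_eq_gaussianCondLaw` and `continuous_integral_gaussianCondLaw`). -/
def gaussianCondLaw {Ω α β : Type*} [MeasurableSpace Ω] [Fintype α] [DecidableEq α]
    (μ : Measure Ω) (U : α → Ω → ℝ) (V : β → Ω → ℝ) (u : α → ℝ) : Measure (β → ℝ) :=
  μ.map fun ω => (fun b => V b ω) + (regressionMatrix μ U V).mulVec (u - fun a => U a ω)

/-- The conditional expectation of `g(V)` given that `U = 0`, for a jointly Gaussian vector
`(U, V)` with `U` non-degenerate. -/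
def gaussianCondExpZero {Ω α β : Type*} [MeasurableSpace Ω] [Fintype α] [DecidableEq α]
    (μ : Measure Ω) (U : α → Ω → ℝ) (V : β → Ω → ℝ) (g : (β → ℝ) → ℝ) : ℝ :=
  ∫ v, g v ∂(gaussianCondLaw μ U V 0)

/-- `gaussianCondLaw` is a version of the regular conditional distribution of `V` given `U`. -/
theorem condDistrib_ae_eq_gaussianCondLaw {Ω α β : Type*} [MeasurableSpace Ω] [Fintype α]
    [DecidableEq α] [Fintype β] (μ : Measure Ω) [IsProbabilityMeasure μ]
    (U : α → Ω → ℝ) (V : β → Ω → ℝ)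
    (hUV : HasGaussianLaw (fun ω => ((fun a => U a ω), (fun b => V b ω))) μ)
    (hU : IsNondegenerateVector μ U) :
    ∀ᵐ u ∂(μ.map fun ω a => U a ω),
      condDistrib (fun ω b => V b ω) (fun ω a => U a ω) μ u = gaussianCondLaw μ U V u := by
  set R := regressionMatrix μ U V with hR
  let L : (α → ℝ) →L[ℝ] (β → ℝ) := LinearMap.toContinuousLinearMap (Matrix.mulVecLin R)
  have hL : ∀ u, L u = R.mulVec u := fun u => rfl
  let W : β → Ω → ℝ := fun b ω => V b ω - R.mulVec (fun a => U a ω) b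
  have hWdef : ∀ ω, (fun b => W b ω) = (fun b => V b ω) - L (fun a => U a ω) := fun ω => rfl
  have hUm : AEMeasurable (fun ω a => U a ω) μ := hUV.fst.aemeasurable
  have hVm : AEMeasurable (fun ω b => V b ω) μ := hUV.snd.aemeasurable
  have hWm : AEMeasurable (fun ω b => W b ω) μ := by
    exact hVm.sub (L.continuous.measurable.comp_aemeasurable hUm)
  have hU2 : ∀ a, MemLp (U a) 2 μ := fun a => (hUV.fst.eval a).memLp_two
  have hV2 : ∀ b, MemLp (V b) 2 μ := fun b => (hUV.snd.eval b).memLp_two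
  have hG : HasGaussianLaw (fun ω => ((fun a => U a ω), (fun b => W b ω))) μ := by
    have := hUV.map_fun ((ContinuousLinearMap.fst ℝ (α → ℝ) (β → ℝ)).prod
      (ContinuousLinearMap.snd ℝ (α → ℝ) (β → ℝ) - L ∘L ContinuousLinearMap.fst ℝ _ _))
    exact this
  have hRmul : R * varMatrix μ U = covMatrix μ V U := by
    rw [hR, regressionMatrix, Matrix.mul_assoc, Matrix.nonsing_inv_mul, Matrix.mul_one]
    exact isUnit_iff_ne_zero.mpr hU
  have hcov : ∀ a b, cov[U a, W b; μ] = 0 := by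
    intro a b
    have h1 : W b = fun ω => V b ω - ∑ c, R b c * U c ω := rfl
    have hs : ∀ c, MemLp (fun ω => R b c * U c ω) 2 μ := fun c => (hU2 c).const_mul _
    rw [h1, covariance_fun_sub_right (hU2 a) (hV2 b) (memLp_finsetSum _ fun c _ => hs c),
      covariance_fun_sum_right hs (hU2 a)]
    simp only [covariance_const_mul_right]
    have h2 := congrFun (congrFun hRmul b) a
    simp only [Matrix.mul_apply, varMatrix, covMatrix, Matrix.of_apply] at h2
    rw [covariance_comm (U a) (V b), ← h2, sub_eq_zero]
    exact Finset.sum_congr rfl fun c _ => by rw [covariance_comm]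
  have hind := HasGaussianLaw.indepFun_of_covariance_eval hG hcov
  have hprod := (indepFun_iff_map_prod_eq_prod_map_map hUm hWm).mp hind
  let T : (α → ℝ) × (β → ℝ) → (β → ℝ) := fun p => p.2 + L p.1
  have hT : Measurable T := by
    exact (continuous_snd.add (L.continuous.comp continuous_fst)).measurable
  let K : Kernel (α → ℝ) (β → ℝ) :=
    (Kernel.id ×ₖ Kernel.const _ (μ.map fun ω b => W b ω)).map T
  have hPW : IsProbabilityMeasure (μ.map fun ω b => W b ω) := Measure.isProbabilityMeasure_map hWm
  have hPU : IsProbabilityMeasure (μ.map fun ω a => U a ω) := Measure.isProbabilityMeasure_map hUm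
  have hK : ∀ u, K u = gaussianCondLaw μ U V u := by
    intro u
    rw [Kernel.map_apply _ hT, Kernel.prod_apply, Kernel.id_apply, Kernel.const_apply,
      Measure.dirac_prod, Measure.map_map hT (by fun_prop),
      AEMeasurable.map_map_of_aemeasurable (by fun_prop) hWm, gaussianCondLaw]
    congr 1
    funext ω
    simp only [T, Function.comp_apply, hWdef, ← hR, ← hL, map_sub]
    abel
  have : IsMarkovKernel K := Kernel.IsMarkovKernel.map _ hT
  have hmain : μ.map (fun ω => ((fun a => U a ω), (fun b => V b ω)))
      = (μ.map fun ω a => U a ω) ⊗ₘ K := by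
    have e1 : (fun ω => ((fun a => U a ω), (fun b => V b ω)))
        = (fun p : (α → ℝ) × (β → ℝ) => (p.1, T p)) ∘
          (fun ω => ((fun a => U a ω), (fun b => W b ω))) := by
      funext ω
      simp only [T, Function.comp_apply, hWdef]
      simp
    have hT' : Measurable (fun p : (α → ℝ) × (β → ℝ) => (p.1, T p)) := by fun_prop
    rw [e1, ← AEMeasurable.map_map_of_aemeasurable hT'.aemeasurable (hUm.prodMk hWm), hprod]
    refine Measure.ext_of_lintegral _ fun F hF => ?_
    rw [Measure.lintegral_compProd hF, lintegral_map hF hT',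
      lintegral_prod _ (by fun_prop)]
    refine lintegral_congr fun u => ?_
    rw [Kernel.map_apply _ hT, Kernel.prod_apply, Kernel.id_apply, Kernel.const_apply,
      Measure.dirac_prod, lintegral_map (by fun_prop) hT]
    have key : ∀ ν : Measure (β → ℝ),
        ∫⁻ w, F (u, T (u, w)) ∂ν = ∫⁻ p, F (u, T p) ∂(ν.map (Prod.mk u)) := fun ν => by
      rw [lintegral_map (by fun_prop) (by fun_prop)]
    exact key _
  filter_upwards [condDistrib_ae_eq_of_measure_eq_compProd (μ := μ) _ hVm hmain] with u hu
  rw [hu, hK]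

/-- `gaussianCondLaw` depends continuously on the value `u` of the conditioning vector. -/
theorem continuous_integral_gaussianCondLaw {Ω α β : Type*} [MeasurableSpace Ω] [Fintype α]
    [DecidableEq α] [Fintype β] (μ : Measure Ω) [IsProbabilityMeasure μ]
    (U : α → Ω → ℝ) (V : β → Ω → ℝ) (hU : ∀ a, AEMeasurable (U a) μ)
    (hV : ∀ b, AEMeasurable (V b) μ) (g : BoundedContinuousFunction (β → ℝ) ℝ) :
    Continuous fun u => ∫ v, g v ∂(gaussianCondLaw μ U V u) := by
  let L : (α → ℝ) →L[ℝ] (β → ℝ) :=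
    LinearMap.toContinuousLinearMap (Matrix.mulVecLin (regressionMatrix μ U V))
  have hm : ∀ u : α → ℝ, AEMeasurable
      (fun ω => (fun b => V b ω) + L (u - fun a => U a ω)) μ := fun u =>
    (aemeasurable_pi_lambda _ hV).add (L.continuous.measurable.comp_aemeasurable
      (aemeasurable_const.sub (aemeasurable_pi_lambda _ hU)))
  have he : ∀ u, ∫ v, g v ∂(gaussianCondLaw μ U V u)
      = ∫ ω, g ((fun b => V b ω) + L (u - fun a => U a ω)) ∂μ := fun u =>
    integral_map (hm u) g.continuous.aestronglyMeasurable
  simp only [he]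
  refine continuous_of_dominated (bound := fun _ => ‖g‖)
    (fun u => g.continuous.measurable.comp_aemeasurable (hm u) |>.aestronglyMeasurable)
    (fun u => ae_of_all _ fun ω => g.norm_coe_le_norm _) (integrable_const _)
    (ae_of_all _ fun ω => ?_)
  exact g.continuous.comp (continuous_const.add (L.continuous.comp (by fun_prop)))

/-! ### Stationary Gaussian processes on the real line -/

/-- The correlation function `κ : x ↦ 𝔼[f(0) f(x)]`. -/
def correlationFunction {Ω : Type*} [MeasurableSpace Ω] (μ : Measure Ω) (f : ℝ → Ω → ℝ) (x : ℝ) :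
    ℝ :=
  ∫ ω, f 0 ω * f x ω ∂μ

/-- `f` is a normalized stationary centered Gaussian process of class `C^p` on `ℝ`. -/
structure IsNormalizedStationaryGaussian {Ω : Type*} [MeasurableSpace Ω] (μ : Measure Ω) (p : ℕ)
    (f : ℝ → Ω → ℝ) : Prop where
  /-- `f(x)` is a random variable for every `x` -/
  measurable : ∀ x, Measurable (f x)
  gaussian : IsGaussianProcess f μ
  centered : ∀ x, ∫ ω, f x ω ∂μ = 0
  /-- the process `x ↦ f(x + t)` is distributed as `f` -/
  stationary : ∀ t, IdentDistrib (fun ω x => f (x + t) ω) (fun ω x => f x ω) μ μ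
  /-- the trajectories are almost surely of class `C^p` -/
  contDiff : ∀ᵐ ω ∂μ, ContDiff ℝ p (fun x => f x ω)
  correlation_zero : correlationFunction μ f 0 = 1
  neg_correlation_deriv_two : -iteratedDeriv 2 (correlationFunction μ f) 0 = 1

/-- The random variable `f^{(i)}(x)`. -/
def processDeriv {Ω : Type*} (f : ℝ → Ω → ℝ) (i : ℕ) (x : ℝ) (ω : Ω) : ℝ :=
  iteratedDeriv i (fun t => f t ω) x

/-! ### The `k`-point function of the zero set -/

/-- The (random) zero set `f⁻¹(0)`. -/
def zeroSet {Ω : Type*} (f : ℝ → Ω → ℝ) (ω : Ω) : Set ℝ :=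
  {x | f x ω = 0}

/-- The large diagonal of `ℝ^k`. -/
def largeDiagonal (k : ℕ) : Set (Fin k → ℝ) :=
  {x | ∃ i j, i ≠ j ∧ x i = x j}

/-- `∏ i, card (Z ∩ [x i - ε, x i + ε])`, with values in `[0, ∞]`. -/
def cardProd {k : ℕ} (Z : Set ℝ) (x : Fin k → ℝ) (ε : ℝ) : ℝ≥0∞ :=
  ∏ i, ((Z ∩ Set.Icc (x i - ε) (x i + ε)).encard : ℝ≥0∞)

/-- The `k`-point function of the random set `Z` is well-defined at `x`, with (finite) value `r`:
`(2ε)^{-k} 𝔼[∏ i, card (Z ∩ [x i - ε, x i + ε])] → r` as `ε → 0`, where these products are random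
variables (up to a null set), so that the expectations make sense in `[0, ∞]`. -/
def HasKPointFunctionAt {Ω : Type*} [MeasurableSpace Ω] (μ : Measure Ω) {k : ℕ}
    (Z : Ω → Set ℝ) (x : Fin k → ℝ) (r : ℝ) : Prop :=
  0 ≤ r ∧
  (∀ᶠ ε in 𝓝[>] (0 : ℝ), AEMeasurable (fun ω => cardProd (Z ω) x ε) μ) ∧
  Tendsto (fun ε : ℝ => (∫⁻ ω, cardProd (Z ω) x ε ∂μ) / ENNReal.ofReal ((2 * ε) ^ k))
    (𝓝[>] 0) (𝓝 (ENNReal.ofReal r))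

/-! ### Clusters -/

/-- `P` is the partition of `{1, …, k}` such that `y i = y j` if and only if `i` and `j` are in
the same block, and `yv I` is the common value of the `y i` with `i ∈ I`, for every block `I`. -/
structure IsClusterPartition {k : ℕ} (y : Fin k → ℝ)
    (P : Finpartition (Finset.univ : Finset (Fin k))) (yv : Finset (Fin k) → ℝ) : Prop where
  eq_iff : ∀ i j, y i = y j ↔ ∃ I ∈ P.parts, i ∈ I ∧ j ∈ I
  value : ∀ I ∈ P.parts, ∀ i ∈ I, y i = yv I

/-- The vector `(f^{(i)}(y_I))_{I ∈ P, 0 ≤ i < |I|}`. -/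
def clusterJet {Ω : Type*} {k : ℕ} (f : ℝ → Ω → ℝ)
    (P : Finpartition (Finset.univ : Finset (Fin k))) (yv : Finset (Fin k) → ℝ) :
    (Σ I : P.parts, Fin I.1.card) → Ω → ℝ :=
  fun a => processDeriv f a.2 (yv a.1)

/-- The vector `(f^{(i)}(y_I))_{I ∈ P, 0 ≤ i ≤ |I|}`. -/
def clusterJetExt {Ω : Type*} {k : ℕ} (f : ℝ → Ω → ℝ)
    (P : Finpartition (Finset.univ : Finset (Fin k))) (yv : Finset (Fin k) → ℝ) :
    (Σ I : P.parts, Fin (I.1.card + 1)) → Ω → ℝ :=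
  fun a => processDeriv f a.2 (yv a.1)

/-- The vector `(f^{(|I|)}(y_I))_{I ∈ P}`. -/
def clusterTop {Ω : Type*} {k : ℕ} (f : ℝ → Ω → ℝ)
    (P : Finpartition (Finset.univ : Finset (Fin k))) (yv : Finset (Fin k) → ℝ) :
    P.parts → Ω → ℝ :=
  fun I => processDeriv f I.1.card (yv I)

/-- The constant `ℓ(y)`. -/
def vanishingConstant {Ω : Type*} [MeasurableSpace Ω] (μ : Measure Ω) {k : ℕ} (f : ℝ → Ω → ℝ)
    (P : Finpartition (Finset.univ : Finset (Fin k))) (yv : Finset (Fin k) → ℝ) : ℝ :=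
  (∏ I ∈ P.parts, ∏ i ∈ Finset.range I.card, ((i ! : ℝ) / (I.card ! : ℝ))) *
    (gaussianCondExpZero μ (clusterJet f P yv) (clusterTop f P yv)
        (fun v => ∏ I : P.parts, |v I| ^ I.1.card) /
      ((2 * Real.pi) ^ ((k : ℝ) / 2) *
        (varMatrix μ (clusterJet f P yv)).det ^ ((1 : ℝ) / 2)))

/-- The normalizing factor `∏_I ∏_{i < j in I} |x_i - x_j|⁻¹`. -/
def clusterFactor {k : ℕ} (P : Finpartition (Finset.univ : Finset (Fin k))) (x : Fin k → ℝ) : ℝ :=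
  ∏ I ∈ P.parts, ∏ p ∈ (I ×ˢ I).filter (fun p => p.1 < p.2), 1 / |x p.1 - x p.2|

end

noncomputable section

/-! ### Almost sure limits of centered Gaussian vectors -/

/-! The theorem rests on two facts about the Kac–Rice density `𝔼[∏ |B i| | A = 0] p_A(0)` of a
Gaussian pair `(A, B)`. It is the `k`-point function when `A` is the vector of values `f (x i)` and
`B` the vector of derivatives `f' (x i)`, and it transforms simply under linear changes of `(A, B)`.

The first fact (`hasKPointFunctionAt`) is obtained by counting sign changes rather than by
integrating over level sets. Write `B = W + R A` with `W` the regression residual, which is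
independent of `A`. In the variable `A = h b`, the event that every `A i` and `A i + h B i` have
opposite signs is a set of `b` that tends to a box with sides `|W i|`. Its probability divided by `h
^ k` therefore tends to the Kac–Rice density (`tendsto_measureReal_signChange`). Applied with `A + h
B = f (x + h)`, this holds jointly as the base points tend to `x` and the step to `0`. It thus
controls all the cells of a fine grid around `x` at once. Almost surely the zeros of `f` are simple
and avoid the grids, so the numbers of sign changes never exceed the number of zeros and converge to
it. A one-cell grid bounds the expectation from below and Fatou's lemma bounds it from above.

The second fact (`kacRiceDensity_linComb`) is that passing from `(A, B)` to `(M A, d B + N A)`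
multiplies the density by `|det M|⁻¹ ∏ |d i|`. Near `y` the values `f (x i)` degenerate, but their
divided differences along each cluster do not. Replace the values by Newton divided differences, and
the derivatives by divided differences with one doubled node. If `p` is the product of the `|x i - x
j|⁻¹` over pairs in a common cluster, then `|det M| = p` and `∏ |d i| = p ^ 2`, so the density is
multiplied by exactly the normalizing factor `p` of the theorem.

The new vectors converge almost surely to the `f^{(i)}(y_I) / i!` and to the `f^{(|I|)}(y_I) /
|I|!`, by Rolle's theorem applied to interpolation polynomials. Almost sure limits of Gaussian
vectors are Gaussian with convergent covariances, so the Kac–Rice density passes to the limit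
(`tendsto_kacRiceDensity`). The factorials account for the constant in front of `ℓ(y)`, and the
`|I|` copies of the same top derivative account for the exponent `|I|`. Finally `ℓ(y)` is positive
as soon as no residual of a top derivative vanishes identically. -/

/-- A jointly Gaussian family of centered real random variables. -/
structure IsCenteredGaussianVector {Ω ι : Type*} [MeasurableSpace Ω] (X : ι → Ω → ℝ)
    (μ : Measure Ω) : Prop where
  gaussian : HasGaussianLaw (fun ω i => X i ω) μ
  mean : ∀ i, ∫ ω, X i ω ∂μ = 0

section Limits

variable {Ω : Type*} [MeasurableSpace Ω] {μ : Measure Ω}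

theorem tendsto_charFun_map {T : Type*} {l : Filter T} [l.IsCountablyGenerated]
    [IsProbabilityMeasure μ] {X : T → Ω → ℝ} {X₀ : Ω → ℝ} (hX : ∀ t, AEMeasurable (X t) μ)
    (hX₀ : AEMeasurable X₀ μ) (hlim : ∀ᵐ ω ∂μ, Tendsto (fun t => X t ω) l (𝓝 (X₀ ω))) (s : ℝ) :
    Tendsto (fun t => charFun (μ.map (X t)) s) l (𝓝 (charFun (μ.map X₀) s)) := by
  have e : ∀ Y : Ω → ℝ, AEMeasurable Y μ →
      charFun (μ.map Y) s = ∫ ω, Complex.exp (s * Y ω * Complex.I) ∂μ := fun Y hY => by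
    rw [charFun_apply_real, integral_map hY (by fun_prop)]
  simp only [e _ (hX _), e _ hX₀]
  refine tendsto_integral_filter_of_dominated_convergence (fun _ => 1)
    (Eventually.of_forall fun t => ?_) (Eventually.of_forall fun t => ae_of_all _ fun ω => ?_)
    (integrable_const _) ?_
  · have : AEMeasurable (fun ω => Complex.exp (s * X t ω * Complex.I)) μ :=
      (by fun_prop : Measurable fun x : ℝ => Complex.exp (s * x * Complex.I)).comp_aemeasurable (hX t)
    exact this.aestronglyMeasurable
  · have := Complex.norm_exp_ofReal_mul_I (s * X t ω)
    push_cast at this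
    exact this.le
  · filter_upwards [hlim] with ω hω
    exact ((by fun_prop : Continuous fun x : ℝ => Complex.exp (s * x * Complex.I)).tendsto _).comp hω

theorem charFun_gaussianReal_zero (v : NNReal) (s : ℝ) :
    charFun (gaussianReal 0 v) s = ((Real.exp (-(v * s ^ 2 / 2)) : ℝ) : ℂ) := by
  rw [charFun_gaussianReal]
  push_cast
  congr 1
  ring

/-- An almost sure limit of centered real Gaussian variables is a centered Gaussian variable, and
the variances converge. -/
theorem exists_map_eq_gaussianReal_of_tendsto {T : Type*} {l : Filter T} [l.NeBot]
    [l.IsCountablyGenerated] [IsProbabilityMeasure μ] {X : T → Ω → ℝ} {X₀ : Ω → ℝ}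
    {v : T → NNReal} (hX : ∀ t, μ.map (X t) = gaussianReal 0 (v t)) (hX₀ : AEMeasurable X₀ μ)
    (hlim : ∀ᵐ ω ∂μ, Tendsto (fun t => X t ω) l (𝓝 (X₀ ω))) :
    ∃ w : NNReal, μ.map X₀ = gaussianReal 0 w ∧ Tendsto v l (𝓝 w) := by
  have hXm : ∀ t, AEMeasurable (X t) μ := fun t =>
    aemeasurable_of_map_neZero (by rw [hX]; infer_instance)
  have hP : IsProbabilityMeasure (μ.map X₀) := Measure.isProbabilityMeasure_map hX₀
  have h1 : ∀ s, Tendsto (fun t => ((Real.exp (-(v t * s ^ 2 / 2)) : ℝ) : ℂ)) l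
      (𝓝 (charFun (μ.map X₀) s)) := fun s => by
    have := tendsto_charFun_map hXm hX₀ hlim s
    simpa only [hX, charFun_gaussianReal_zero] using this
  have h2 : ∀ s, Tendsto (fun t => Real.exp (-(v t * s ^ 2 / 2))) l
      (𝓝 (charFun (μ.map X₀) s).re) := fun s => by
    exact ((Complex.continuous_re.tendsto _).comp (h1 s)).congr fun t => Complex.ofReal_re _
  have hc : Continuous fun s => (charFun (μ.map X₀) s).re :=
    Complex.continuous_re.comp continuous_charFun
  -- A characteristic function is continuous and equal to `1` at `0`, so it is positive at some `s ≠
  -- 0`. At that `s` the variances are recovered as `-2 log φ(s) / s ^ 2`, which proves that they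
  -- converge without any tightness argument.
  obtain ⟨s, hs0, hs⟩ : ∃ s : ℝ, s ≠ 0 ∧ 0 < (charFun (μ.map X₀) s).re := by
    have h0 : 0 < (charFun (μ.map X₀) 0).re := by simp
    have := (hc.tendsto 0).eventually (lt_mem_nhds h0)
    have h3 : ∀ᶠ s in 𝓝[≠] (0 : ℝ), 0 < (charFun (μ.map X₀) s).re := this.filter_mono inf_le_left
    obtain ⟨s, hs, hs'⟩ := (h3.and self_mem_nhdsWithin).exists
    exact ⟨s, hs', hs⟩
  have h4 : Tendsto (fun t => (v t : ℝ)) l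
      (𝓝 (-(Real.log (charFun (μ.map X₀) s).re) * 2 / s ^ 2)) := by
    have := (((Real.continuousAt_log hs.ne').tendsto.comp (h2 s)).neg.mul_const 2).div_const (s ^ 2)
    refine this.congr fun t => ?_
    simp only [Function.comp_apply, Real.log_exp]
    field_simp
  generalize -(Real.log (charFun (μ.map X₀) s).re) * 2 / s ^ 2 = w at h4
  have hw : 0 ≤ w := ge_of_tendsto' h4 fun t => (v t).2
  lift w to NNReal using hw
  refine ⟨w, ?_, ?_⟩
  · refine Measure.ext_of_charFun (funext fun r => ?_)
    rw [charFun_gaussianReal_zero]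
    refine tendsto_nhds_unique (h1 r) ?_
    refine (Complex.continuous_ofReal.tendsto _).comp ?_
    refine (Real.continuous_exp.tendsto _).comp ?_
    exact ((h4.mul_const _).div_const _).neg
  · exact NNReal.tendsto_coe.mp h4

theorem integral_eq_of_map_eq_gaussianReal {X : Ω → ℝ} {m : ℝ} {v : NNReal}
    (h : μ.map X = gaussianReal m v) : ∫ ω, X ω ∂μ = m := by
  have hX : AEMeasurable X μ := aemeasurable_of_map_neZero (by rw [h]; infer_instance)
  have := integral_map (μ := μ) (f := fun x : ℝ => x) hX (by fun_prop)
  rw [← this, h, integral_id_gaussianReal]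

theorem variance_eq_of_map_eq_gaussianReal {X : Ω → ℝ} {m : ℝ} {v : NNReal}
    (h : μ.map X = gaussianReal m v) : Var[X; μ] = v := by
  have hX : AEMeasurable X μ := aemeasurable_of_map_neZero (by rw [h]; infer_instance)
  have := variance_map (X := id) (μ := μ) (Y := X) (by fun_prop) hX
  rw [h, variance_id_gaussianReal] at this
  exact this.symm

theorem tendsto_variance_of_hasGaussianLaw {T : Type*} {l : Filter T}
    [l.IsCountablyGenerated] [IsProbabilityMeasure μ] {X : T → Ω → ℝ} {X₀ : Ω → ℝ}
    (hX : ∀ t, HasGaussianLaw (X t) μ) (hXm : ∀ t, ∫ ω, X t ω ∂μ = 0) (hX₀ : AEMeasurable X₀ μ)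
    (hlim : ∀ᵐ ω ∂μ, Tendsto (fun t => X t ω) l (𝓝 (X₀ ω))) :
    Tendsto (fun t => Var[X t; μ]) l (𝓝 Var[X₀; μ]) := by
  rcases l.eq_or_neBot with rfl | hl
  · exact tendsto_bot
  have h1 : ∀ t, μ.map (X t) = gaussianReal 0 Var[X t; μ].toNNReal := fun t => by
    rw [(hX t).map_eq_gaussianReal, hXm]
  obtain ⟨w, hw, hlim'⟩ := exists_map_eq_gaussianReal_of_tendsto h1 hX₀ hlim
  rw [variance_eq_of_map_eq_gaussianReal hw]
  exact ((NNReal.continuous_coe.tendsto _).comp hlim').congr fun t =>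
    (variance_eq_of_map_eq_gaussianReal (h1 t)).symm

/-! ### Closure properties of centered Gaussian vectors -/

namespace IsCenteredGaussianVector

variable {ι : Type*} {X : ι → Ω → ℝ}

theorem aemeasurable (hX : IsCenteredGaussianVector X μ) (i : ι) : AEMeasurable (X i) μ :=
  (measurable_pi_apply i).comp_aemeasurable hX.gaussian.aemeasurable

theorem of_hasGaussianLaw_sum [Fintype ι] [IsProbabilityMeasure μ]
    (hX : ∀ i, AEMeasurable (X i) μ)
    (h : ∀ c : ι → ℝ, ∃ v, μ.map (fun ω => ∑ i, c i * X i ω) = gaussianReal 0 v) :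
    IsCenteredGaussianVector X μ := by
  classical
  have hXm : AEMeasurable (fun ω i => X i ω) μ := aemeasurable_pi_lambda _ hX
  have key : ∀ L : StrongDual ℝ (ι → ℝ), ∃ v, (μ.map (fun ω i => X i ω)).map L = gaussianReal 0 v :=
    fun L => by
      obtain ⟨v, hv⟩ := h fun i => L (Pi.single i 1)
      refine ⟨v, ?_⟩
      rw [AEMeasurable.map_map_of_aemeasurable (by fun_prop) hXm, ← hv]
      congr 1
      funext ω
      have : (fun i => X i ω) = ∑ i, X i ω • Pi.single (M := fun _ => ℝ) i 1 := by
        ext j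
        simp [Finset.sum_apply, Pi.single_apply]
      simp only [Function.comp_apply]
      rw [this, map_sum]
      simp only [map_smul, smul_eq_mul, mul_comm]
  refine ⟨⟨⟨fun L => ?_⟩⟩, fun i => ?_⟩
  · obtain ⟨v, hv⟩ := key L
    have h1 : ∫ x, L x ∂(μ.map fun ω i => X i ω) = 0 := integral_eq_of_map_eq_gaussianReal hv
    have h2 := variance_eq_of_map_eq_gaussianReal hv
    rw [hv, h1, h2]
    simp
  · obtain ⟨v, hv⟩ := h (Pi.single i 1)
    have := integral_eq_of_map_eq_gaussianReal hv
    simpa [Pi.single_apply] using this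

theorem hasGaussianLaw_sum [Fintype ι] (hX : IsCenteredGaussianVector X μ) (c : ι → ℝ) :
    HasGaussianLaw (fun ω => ∑ i, c i * X i ω) μ := by
  have := hX.gaussian.map_fun (∑ i, c i • (ContinuousLinearMap.proj i : (ι → ℝ) →L[ℝ] ℝ))
  simpa using this

theorem eval [Finite ι] (hX : IsCenteredGaussianVector X μ) (i : ι) : HasGaussianLaw (X i) μ := by
  have := Fintype.ofFinite ι
  exact hX.gaussian.eval i

theorem memLp [Finite ι] (hX : IsCenteredGaussianVector X μ) (i : ι) {p : ℝ≥0∞} (hp : p ≠ ∞) :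
    MemLp (X i) p μ :=
  (hX.eval i).memLp hp

theorem integral_sum [Fintype ι] (hX : IsCenteredGaussianVector X μ) (c : ι → ℝ) :
    ∫ ω, ∑ i, c i * X i ω ∂μ = 0 := by
  rw [integral_finsetSum _ fun i _ => (hX.eval i).integrable.const_mul _]
  simp [integral_const_mul, hX.mean]

theorem map_sum_eq [Fintype ι] (hX : IsCenteredGaussianVector X μ) (c : ι → ℝ) :
    μ.map (fun ω => ∑ i, c i * X i ω) =
      gaussianReal 0 Var[fun ω => ∑ i, c i * X i ω; μ].toNNReal := by
  rw [(hX.hasGaussianLaw_sum c).map_eq_gaussianReal, hX.integral_sum]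

/-- Finite linear combinations of a centered Gaussian vector form a centered Gaussian vector. -/
theorem comb [Fintype ι] {κ : Type*} [Fintype κ] (hX : IsCenteredGaussianVector X μ)
    (c : κ → ι → ℝ) : IsCenteredGaussianVector (fun j ω => ∑ i, c j i * X i ω) μ := by
  refine ⟨?_, fun j => hX.integral_sum _⟩
  have := hX.gaussian.map_fun (ContinuousLinearMap.pi fun j =>
    ∑ i, c j i • (ContinuousLinearMap.proj i : (ι → ℝ) →L[ℝ] ℝ))
  refine this.congr (ae_of_all _ fun ω => ?_)
  funext j
  simp

theorem congr [Fintype ι] {Y : ι → Ω → ℝ} (hX : IsCenteredGaussianVector X μ)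
    (h : ∀ i, X i =ᵐ[μ] Y i) : IsCenteredGaussianVector Y μ := by
  refine ⟨hX.gaussian.congr ?_, fun i => ?_⟩
  · filter_upwards [ae_all_iff.mpr h] with ω hω
    funext i
    exact hω i
  · rw [← hX.mean i]
    exact integral_congr_ae (h i).symm

theorem comp [Fintype ι] {κ : Type*} [Fintype κ] (hX : IsCenteredGaussianVector X μ) (e : κ → ι) :
    IsCenteredGaussianVector (fun j => X (e j)) μ := by
  classical
  have := hX.comb (fun j => Pi.single (e j) 1)
  simpa [Pi.single_apply] using this

/-- Polarization; it reduces the convergence of covariances to that of variances of single Gaussian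
variables. -/
theorem covariance_eq [Finite ι] [IsProbabilityMeasure μ] (hX : IsCenteredGaussianVector X μ)
    (i j : ι) :
    cov[X i, X j; μ] = (Var[fun ω => X i ω + X j ω; μ] - Var[X i; μ] - Var[X j; μ]) / 2 := by
  rw [variance_fun_add (hX.memLp i (by simp)) (hX.memLp j (by simp))]
  ring

/-- Joint Gaussianity is tested on linear combinations, and each of these is an almost sure limit of
real centered Gaussian variables. -/
theorem of_tendsto [Fintype ι] [IsProbabilityMeasure μ] {T : Type*} {l : Filter T} [l.NeBot]
    [l.IsCountablyGenerated] {X : T → ι → Ω → ℝ} {X₀ : ι → Ω → ℝ}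
    (hX : ∀ t, IsCenteredGaussianVector (X t) μ)
    (hlim : ∀ i, ∀ᵐ ω ∂μ, Tendsto (fun t => X t i ω) l (𝓝 (X₀ i ω))) :
    IsCenteredGaussianVector X₀ μ := by
  have hX₀ : ∀ i, AEMeasurable (X₀ i) μ := fun i =>
    aemeasurable_of_tendsto_metrizable_ae l (fun t => (hX t).aemeasurable i) (hlim i)
  refine of_hasGaussianLaw_sum hX₀ fun c => ?_
  obtain ⟨w, hw, -⟩ := exists_map_eq_gaussianReal_of_tendsto (l := l)
    (fun t => (hX t).map_sum_eq c) (Finset.aemeasurable_fun_sum _ fun i _ => (hX₀ i).const_mul _) (by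
      filter_upwards [ae_all_iff.mpr hlim] with ω hω
      exact tendsto_finsetSum _ fun i _ => (hω i).const_mul _)
  exact ⟨w, hw⟩

theorem tendsto_covariance [Fintype ι] [IsProbabilityMeasure μ] {T : Type*} {l : Filter T}
    [l.IsCountablyGenerated] {X : T → ι → Ω → ℝ} {X₀ : ι → Ω → ℝ}
    (hX : ∀ t, IsCenteredGaussianVector (X t) μ) (hX₀ : IsCenteredGaussianVector X₀ μ)
    (hlim : ∀ i, ∀ᵐ ω ∂μ, Tendsto (fun t => X t i ω) l (𝓝 (X₀ i ω))) (i j : ι) :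
    Tendsto (fun t => cov[X t i, X t j; μ]) l (𝓝 cov[X₀ i, X₀ j; μ]) := by
  simp only [fun t => (hX t).covariance_eq i j, hX₀.covariance_eq i j]
  have hv : ∀ i, Tendsto (fun t => Var[X t i; μ]) l (𝓝 Var[X₀ i; μ]) := fun i =>
    tendsto_variance_of_hasGaussianLaw (fun t => (hX t).eval i) (fun t => (hX t).mean i)
      (hX₀.aemeasurable i) (hlim i)
  refine ((Tendsto.sub ?_ (hv i)).sub (hv j)).div_const 2
  refine tendsto_variance_of_hasGaussianLaw
    (fun t => ((hX t).gaussian.prodMk i j).fun_add) (fun t => ?_)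
    ((hX₀.aemeasurable i).add (hX₀.aemeasurable j)) ?_
  · rw [integral_add ((hX t).eval i).integrable ((hX t).eval j).integrable, (hX t).mean,
      (hX t).mean, add_zero]
  · filter_upwards [hlim i, hlim j] with ω h1 h2
    exact h1.add h2

end IsCenteredGaussianVector

end Limits

/-! ### The jets of a smooth Gaussian process -/

section Jets

variable {Ω : Type*} [MeasurableSpace Ω] {μ : Measure Ω}

theorem hasDerivAt_iteratedDeriv {g : ℝ → ℝ} {n i : ℕ} (hg : ContDiff ℝ n g) (hi : i < n) (x : ℝ) :
    HasDerivAt (iteratedDeriv i g) (iteratedDeriv (i + 1) g x) x := by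
  rw [iteratedDeriv_succ]
  exact ((hg.differentiable_iteratedDeriv i (by exact_mod_cast hi)) x).hasDerivAt

theorem IsNormalizedStationaryGaussian.isCenteredGaussianVector [IsProbabilityMeasure μ] {p : ℕ}
    {f : ℝ → Ω → ℝ} (hf : IsNormalizedStationaryGaussian μ p f) {κ : Type*} [Fintype κ]
    (e : κ → ℝ) : IsCenteredGaussianVector (fun c => f (e c)) μ := by
  classical
  -- The process gives Gaussian laws along finite sets of points; a family with repetitions is
  -- pulled back from the set of its values.
  have h : IsCenteredGaussianVector (fun t : Finset.univ.image e => f t) μ :=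
    ⟨hf.gaussian.hasGaussianLaw _, fun i => hf.centered _⟩
  exact h.comp fun c => ⟨e c, Finset.mem_image_of_mem _ (Finset.mem_univ c)⟩

/-- The derivatives up to order `p` of a Gaussian process of class `C^p` are jointly Gaussian. -/
theorem IsNormalizedStationaryGaussian.isCenteredGaussianVector_processDeriv
    [IsProbabilityMeasure μ] {p : ℕ} {f : ℝ → Ω → ℝ} (hf : IsNormalizedStationaryGaussian μ p f)
    {κ : Type*} [Fintype κ] (d : κ → ℕ) (e : κ → ℝ) (hd : ∀ c, d c ≤ p) :
    IsCenteredGaussianVector (fun c => processDeriv f (d c) (e c)) μ := by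
  classical
  -- Induction on a bound for the orders. The index family stays general because the inductive step
  -- doubles it.
  suffices H : ∀ i ≤ p, ∀ {κ : Type _} [Fintype κ] (d : κ → ℕ) (e : κ → ℝ), (∀ c, d c ≤ i) →
      IsCenteredGaussianVector (fun c => processDeriv f (d c) (e c)) μ from H p le_rfl d e hd
  intro i
  induction i with
  | zero =>
    intro _ κ _ d e hd
    have : ∀ c, d c = 0 := fun c => Nat.le_zero.mp (hd c)
    have hp : ∀ x, processDeriv f 0 x = f x := fun x => by
      funext ω
      simp [processDeriv]
    simpa only [this, hp] using hf.isCenteredGaussianVector e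
  | succ i IH =>
    intro hi κ _ d e hd
    -- A derivative of order `i + 1` is the limit of the difference quotients of `f^{(i)}` with step
    -- `1 / (n + 1)`. The left copy of the index set carries the base points and the right copy the
    -- shifted points. The coefficients in `hZ` keep a component of order at most `i` and form the
    -- quotient for the others.
    have hY : ∀ n : ℕ, IsCenteredGaussianVector (fun (s : κ ⊕ κ) =>
        processDeriv f (s.elim (fun c => min i (d c)) (fun _ => i))
          (s.elim e (fun c => e c + (1 : ℝ) / (n + 1)))) μ := fun n =>
      IH (by omega) _ _ (by rintro (c | c) <;> simp)
    have hZ := fun n : ℕ => (hY n).comb (fun (c : κ) (s : κ ⊕ κ) =>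
      s.elim (fun c' => if c = c' then (if d c ≤ i then (1 : ℝ) else -(n + 1)) else 0)
        (fun c' => if c = c' then (if d c ≤ i then (0 : ℝ) else (n + 1)) else 0))
    refine IsCenteredGaussianVector.of_tendsto (l := atTop) hZ fun c => ?_
    simp only [Fintype.sum_sum_type, Sum.elim_inl, Sum.elim_inr, ite_mul, zero_mul,
      Finset.sum_ite_eq, Finset.mem_univ, if_true]
    by_cases hc : d c ≤ i
    · simp [hc]
    · have hc' : d c = i + 1 := le_antisymm (hd c) (by omega)
      filter_upwards [hf.contDiff] with ω hω
      have h1 := (hasDerivAt_iteratedDeriv hω (by omega : i < p) (e c)).tendsto_slope_zero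
      have h2 : Tendsto (fun n : ℕ => (1 : ℝ) / (n + 1)) atTop (𝓝[≠] 0) :=
        tendsto_nhdsWithin_iff.mpr ⟨tendsto_one_div_add_atTop_nhds_zero_nat,
          Eventually.of_forall fun n => (by positivity : (0 : ℝ) < 1 / (n + 1)).ne'⟩
      have h3 := h1.comp h2
      simp only [hc', processDeriv]
      refine h3.congr fun n => ?_
      simp only [Function.comp_apply, smul_eq_mul, one_div, inv_inv]
      simp
      ring

theorem IsNormalizedStationaryGaussian.variance_eq_one [IsProbabilityMeasure μ] {p : ℕ}
    {f : ℝ → Ω → ℝ} (hf : IsNormalizedStationaryGaussian μ p f) (t : ℝ) : Var[f t; μ] = 1 := by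
  have h0 : IdentDistrib (f t) (f 0) μ μ := by
    have := (hf.stationary t).comp (measurable_pi_apply (0 : ℝ))
    simpa [Function.comp_def] using this
  rw [h0.variance_eq, variance_of_integral_eq_zero (hf.measurable 0).aemeasurable (hf.centered 0)]
  have := hf.correlation_zero
  simp only [correlationFunction] at this
  rw [← this]
  simp [sq]

theorem IsNormalizedStationaryGaussian.map_eq_gaussianReal [IsProbabilityMeasure μ] {p : ℕ}
    {f : ℝ → Ω → ℝ} (hf : IsNormalizedStationaryGaussian μ p f) (t : ℝ) :
    μ.map (f t) = gaussianReal 0 1 := by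
  have h : HasGaussianLaw (f t) μ :=
    (hf.isCenteredGaussianVector (fun _ : Unit => t)).eval ()
  rw [h.map_eq_gaussianReal, hf.centered, hf.variance_eq_one]
  simp

theorem IsNormalizedStationaryGaussian.ae_ne_zero [IsProbabilityMeasure μ] {p : ℕ}
    {f : ℝ → Ω → ℝ} (hf : IsNormalizedStationaryGaussian μ p f) (t : ℝ) : ∀ᵐ ω ∂μ, f t ω ≠ 0 := by
  have := nullSingletonClass_gaussianReal (μ := 0) (one_ne_zero (α := NNReal))
  have h : μ.map (f t) {0} = 0 := by rw [hf.map_eq_gaussianReal]; exact measure_singleton 0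
  rw [Measure.map_apply (hf.measurable t) (measurableSet_singleton 0)] at h
  exact measure_eq_zero_iff_ae_notMem.mp h

/-- The standard Gaussian density is at most `1 / √(2π) ≤ 1`. Only the linearity of the bound in `c`
and its uniformity in `t` matter for the simplicity of the zeros. -/
theorem IsNormalizedStationaryGaussian.measure_abs_le [IsProbabilityMeasure μ] {p : ℕ}
    {f : ℝ → Ω → ℝ} (hf : IsNormalizedStationaryGaussian μ p f) (t c : ℝ) :
    μ {ω | |f t ω| ≤ c} ≤ ENNReal.ofReal (2 * c) := by
  have h1 : {ω | |f t ω| ≤ c} = f t ⁻¹' Set.Icc (-c) c := by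
    ext ω
    simp [abs_le]
  rw [h1, ← Measure.map_apply (hf.measurable t) measurableSet_Icc, hf.map_eq_gaussianReal,
    gaussianReal_apply _ one_ne_zero]
  calc ∫⁻ x in Set.Icc (-c) c, gaussianPDF 0 1 x ≤ ∫⁻ x in Set.Icc (-c) c, 1 := by
        refine lintegral_mono fun x => ?_
        rw [gaussianPDF, ← ENNReal.ofReal_one]
        refine ENNReal.ofReal_le_ofReal ?_
        rw [gaussianPDFReal]
        refine mul_le_one₀ (inv_le_one_of_one_le₀ ?_) (Real.exp_pos _).le (Real.exp_le_one_iff.mpr ?_)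
        · rw [Real.one_le_sqrt]
          simp only [NNReal.coe_one]
          nlinarith [Real.pi_gt_three]
        · rw [neg_div]
          exact neg_nonpos.mpr (by positivity)
    _ = ENNReal.ofReal (2 * c) := by
        rw [setLIntegral_one, Real.volume_Icc]
        ring_nf

end Jets

/-! ### Covariance matrices of linear images and Gaussian densities -/

section Density

variable {Ω : Type*} [MeasurableSpace Ω] {μ : Measure Ω}

/-- The random vector `M X`. -/
def linComb {Ω ι κ : Type*} [Fintype ι] (M : Matrix κ ι ℝ) (X : ι → Ω → ℝ) : κ → Ω → ℝ :=
  fun j ω => ∑ i, M j i * X i ω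

omit [MeasurableSpace Ω] in
theorem linComb_apply_eq_mulVec {ι κ : Type*} [Fintype ι] (M : Matrix κ ι ℝ) (X : ι → Ω → ℝ)
    (ω : Ω) : (fun j => linComb M X j ω) = M.mulVec fun i => X i ω :=
  rfl

theorem IsCenteredGaussianVector.mulMatrix {ι κ : Type*} [Fintype ι] [Fintype κ] {X : ι → Ω → ℝ}
    (hX : IsCenteredGaussianVector X μ) (M : Matrix κ ι ℝ) :
    IsCenteredGaussianVector (linComb M X) μ :=
  hX.comb M

theorem covMatrix_linComb_left [IsProbabilityMeasure μ] {ι κ α : Type*} [Fintype ι]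
    {X : ι → Ω → ℝ} {Y : α → Ω → ℝ}
    (hX : ∀ i, MemLp (X i) 2 μ) (hY : ∀ a, MemLp (Y a) 2 μ) (M : Matrix κ ι ℝ) :
    covMatrix μ (linComb M X) Y = M * covMatrix μ X Y := by
  ext j a
  simp only [covMatrix, Matrix.of_apply, Matrix.mul_apply]
  unfold linComb
  rw [covariance_fun_sum_left (fun i => (hX i).const_mul _) (hY a)]
  exact Finset.sum_congr rfl fun i _ => by rw [covariance_const_mul_left]

theorem covMatrix_transpose {α β : Type*} (X : α → Ω → ℝ) (Y : β → Ω → ℝ) :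
    (covMatrix μ X Y).transpose = covMatrix μ Y X := by
  ext a b
  simp [covMatrix, covariance_comm]

theorem covMatrix_linComb_right [IsProbabilityMeasure μ] {ι κ α : Type*} [Fintype ι]
    {X : ι → Ω → ℝ} {Y : α → Ω → ℝ}
    (hX : ∀ i, MemLp (X i) 2 μ) (hY : ∀ a, MemLp (Y a) 2 μ) (M : Matrix κ ι ℝ) :
    covMatrix μ Y (linComb M X) = covMatrix μ Y X * M.transpose := by
  rw [← covMatrix_transpose, covMatrix_linComb_left hX hY, Matrix.transpose_mul,
    covMatrix_transpose]

theorem varMatrix_linComb [IsProbabilityMeasure μ] {ι κ : Type*} [Fintype ι] [Fintype κ]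
    {X : ι → Ω → ℝ} (hX : ∀ i, MemLp (X i) 2 μ) (M : Matrix κ ι ℝ) :
    varMatrix μ (linComb M X) = M * varMatrix μ X * M.transpose := by
  have hMX : ∀ j, MemLp (linComb M X j) 2 μ := fun j =>
    memLp_finsetSum _ fun i _ => (hX i).const_mul _
  rw [varMatrix, covMatrix_linComb_left hX hMX, covMatrix_linComb_right hX hX, varMatrix,
    Matrix.mul_assoc]

/-- The quadratic form at `x` is the variance of `∑ i, x i * X i`. -/
theorem posSemidef_varMatrix [IsProbabilityMeasure μ] {ι : Type*} [Fintype ι]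
    {X : ι → Ω → ℝ} (hX : ∀ i, MemLp (X i) 2 μ) : (varMatrix μ X).PosSemidef := by
  refine Matrix.PosSemidef.of_dotProduct_mulVec_nonneg ?_ fun x => ?_
  · ext i j
    simp [varMatrix, covMatrix, covariance_comm]
  · have h := varMatrix_linComb hX (Matrix.of fun (_ : Unit) i => x i)
    have h' := congrFun (congrFun h ()) ()
    have hv : Var[linComb (Matrix.of fun (_ : Unit) i => x i) X (); μ]
        = ∑ i, (∑ j, x j * varMatrix μ X j i) * x i := by
      rw [← covariance_self]
      · simpa [varMatrix, covMatrix, Matrix.mul_apply] using h'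
      · exact (memLp_finsetSum _ fun i _ => (hX i).const_mul _ : MemLp _ 2 μ).aemeasurable
    have h0 := variance_nonneg (linComb (Matrix.of fun (_ : Unit) i => x i) X ()) μ
    rw [hv] at h0
    simp only [dotProduct, Matrix.mulVec, star_trivial]
    refine h0.trans_eq ?_
    simp only [Finset.sum_mul, Finset.mul_sum]
    rw [Finset.sum_comm]
    exact Finset.sum_congr rfl fun i _ => Finset.sum_congr rfl fun j _ => by ring

/-- The density of the centered Gaussian vector with variance matrix `S`. -/
def gaussianDensity {ι : Type*} [Fintype ι] [DecidableEq ι] (S : Matrix ι ι ℝ) (a : ι → ℝ) : ℝ :=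
  ((2 * Real.pi) ^ ((Fintype.card ι : ℝ) / 2) * S.det ^ ((1 : ℝ) / 2))⁻¹ *
    Real.exp (-(a ⬝ᵥ S⁻¹.mulVec a) / 2)

theorem pi_gaussianReal_eq_withDensity (ι : Type*) [Fintype ι] :
    Measure.pi (fun _ : ι => gaussianReal 0 1) =
      volume.withDensity fun x : ι → ℝ => ENNReal.ofReal (∏ i, gaussianPDFReal 0 1 (x i)) := by
  refine Measure.pi_eq fun s hs => ?_
  have hint : ∀ i, Integrable (gaussianPDFReal 0 1) (volume.restrict (s i)) := fun i =>
    (integrable_gaussianPDFReal 0 1).restrict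
  rw [withDensity_apply _ (MeasurableSet.univ_pi hs), volume_pi, Measure.restrict_pi_pi,
    ← ofReal_integral_eq_lintegral_ofReal (Integrable.fintype_prod hint)
      (ae_of_all _ fun x => Finset.prod_nonneg fun i _ => gaussianPDFReal_nonneg _ _ _),
    integral_fintype_prod_eq_prod, ENNReal.ofReal_prod_of_nonneg
      fun i _ => integral_nonneg fun x => gaussianPDFReal_nonneg _ _ _]
  exact Finset.prod_congr rfl fun i _ => (gaussianReal_apply_eq_integral _ one_ne_zero _).symm

theorem prod_gaussianPDFReal {ι : Type*} [Fintype ι] (x : ι → ℝ) :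
    ∏ i, gaussianPDFReal 0 1 (x i) =
      ((2 * Real.pi) ^ ((Fintype.card ι : ℝ) / 2))⁻¹ * Real.exp (-(x ⬝ᵥ x) / 2) := by
  simp only [gaussianPDFReal, NNReal.coe_one, mul_one, sub_zero, Finset.prod_mul_distrib,
    Finset.prod_const, Finset.card_univ, ← Real.exp_sum, inv_pow]
  congr 2
  · rw [Real.sqrt_eq_rpow, ← Real.rpow_mul_natCast (by positivity)]
    congr 1
    ring
  · rw [dotProduct, neg_div, Finset.sum_div, ← Finset.sum_neg_distrib]
    exact Finset.sum_congr rfl fun i _ => by ring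

/-- Whitening: with `S = Bᵀ B`, the vector `(Bᵀ)⁻¹ X` has identity variance. Its components are
jointly Gaussian and uncorrelated, hence independent and standard, and the product density is
transported back by `Bᵀ`. -/
theorem IsCenteredGaussianVector.map_eq_withDensity [IsProbabilityMeasure μ] {ι : Type*}
    [Fintype ι] [DecidableEq ι] {X : ι → Ω → ℝ} (hX : IsCenteredGaussianVector X μ)
    (hnd : IsNondegenerateVector μ X) :
    μ.map (fun ω i => X i ω) =
      volume.withDensity fun a => ENNReal.ofReal (gaussianDensity (varMatrix μ X) a) := by
  have hX2 : ∀ i, MemLp (X i) 2 μ := fun i => hX.memLp i (by simp)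
  have hXm : AEMeasurable (fun ω i => X i ω) μ := hX.gaussian.aemeasurable
  obtain ⟨B, hB⟩ : ∃ B : Matrix ι ι ℝ, varMatrix μ X = B.transpose * B := by
    open scoped MatrixOrder in
    obtain ⟨B, hB⟩ := CStarAlgebra.nonneg_iff_eq_star_mul_self.mp (posSemidef_varMatrix hX2).nonneg
    exact ⟨B, hB⟩
  set S := varMatrix μ X with hS
  have hdet : S.det = B.det ^ 2 := by rw [hB, Matrix.det_mul, Matrix.det_transpose, sq]
  have hBd : B.det ≠ 0 := fun h => hnd (by rw [← hS, hdet, h]; simp)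
  have hBt : IsUnit B.transpose.det := by rw [Matrix.det_transpose]; exact hBd.isUnit
  have hBu : IsUnit B.det := hBd.isUnit
  set T : Matrix ι ι ℝ := B.transpose⁻¹ with hT
  have hY := hX.mulMatrix T
  have hYvar : varMatrix μ (linComb T X) = 1 := by
    rw [varMatrix_linComb hX2, ← hS, hB, hT, ← Matrix.mul_assoc, Matrix.nonsing_inv_mul _ hBt,
      Matrix.one_mul, Matrix.transpose_nonsing_inv, Matrix.transpose_transpose,
      Matrix.mul_nonsing_inv _ hBu]
  have hYc : ∀ i j, cov[linComb T X i, linComb T X j; μ] = if i = j then 1 else 0 :=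
    fun i j => by
      have := congrFun (congrFun hYvar i) j
      simpa [varMatrix, covMatrix, Matrix.one_apply] using this
  have hYlaw : μ.map (fun ω i => linComb T X i ω) =
      Measure.pi fun _ : ι => gaussianReal 0 1 := by
    rw [(iIndepFun_iff_map_fun_eq_pi_map fun i => hY.aemeasurable i).mp
      (hY.gaussian.iIndepFun_of_covariance_eq_zero fun i j hij => by rw [hYc, if_neg hij])]
    congr 1
    funext i
    rw [(hY.eval i).map_eq_gaussianReal, hY.mean, ← covariance_self (hY.aemeasurable i), hYc]
    simp
  have hXY : (fun ω i => X i ω) =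
      (Matrix.toLin' B.transpose) ∘ (fun ω i => linComb T X i ω) := by
    funext ω
    simp only [Function.comp_apply, linComb_apply_eq_mulVec, Matrix.toLin'_apply,
      Matrix.mulVec_mulVec, hT, Matrix.mul_nonsing_inv _ hBt, Matrix.one_mulVec]
  have hL : Measurable (Matrix.toLin' B.transpose) :=
    (LinearMap.continuous_of_finiteDimensional _).measurable
  have hTm : Measurable fun a : ι → ℝ => T.mulVec a :=
    (LinearMap.continuous_of_finiteDimensional (Matrix.toLin' T)).measurable
  have hG : Measurable fun x : ι → ℝ => ENNReal.ofReal (∏ i, gaussianPDFReal 0 1 (x i)) :=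
    (Finset.measurable_prod _ fun i _ =>
      (measurable_gaussianPDFReal 0 1).comp (measurable_pi_apply i)).ennreal_ofReal
  have hd : Measurable fun a => ENNReal.ofReal (gaussianDensity S a) := by
    unfold gaussianDensity
    simp only [dotProduct, Matrix.mulVec]
    fun_prop
  rw [hXY, ← AEMeasurable.map_map_of_aemeasurable hL.aemeasurable hY.gaussian.aemeasurable, hYlaw,
    pi_gaussianReal_eq_withDensity]
  refine Measure.ext_of_lintegral _ fun F hF => ?_
  have hFL : Measurable fun x => F (Matrix.toLin' B.transpose x) := hF.comp hL
  rw [lintegral_map hF hL, lintegral_withDensity_eq_lintegral_mul _ hG hFL,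
    lintegral_withDensity_eq_lintegral_mul _ hd hF]
  have e1 : ∀ x : ι → ℝ, (fun x : ι → ℝ => ENNReal.ofReal (∏ i, gaussianPDFReal 0 1 (x i)) *
      F (Matrix.toLin' B.transpose x)) x = (fun a => ENNReal.ofReal
        (∏ i, gaussianPDFReal 0 1 (T.mulVec a i)) * F a) (Matrix.toLin' B.transpose x) := fun x => by
    simp only [Matrix.toLin'_apply, Matrix.mulVec_mulVec, hT, Matrix.nonsing_inv_mul _ hBt,
      Matrix.one_mulVec]
  have hF' : Measurable fun a => ENNReal.ofReal (∏ i, gaussianPDFReal 0 1 (T.mulVec a i)) * F a :=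
    (hG.comp hTm).mul hF
  simp only [Pi.mul_apply]
  rw [lintegral_congr e1, ← lintegral_map hF' hL,
    Real.map_matrix_volume_pi_eq_smul_volume_pi (by rwa [Matrix.det_transpose]),
    lintegral_smul_measure, smul_eq_mul, ← lintegral_const_mul _ hF']
  refine lintegral_congr fun a => ?_
  rw [← mul_assoc, ← ENNReal.ofReal_mul (abs_nonneg _)]
  congr 2
  rw [prod_gaussianPDFReal, gaussianDensity, mul_inv, Matrix.det_transpose, hdet, ← mul_assoc]
  congr 1
  · rw [mul_comm]
    congr 1
    rw [← Real.sqrt_eq_rpow, Real.sqrt_sq_eq_abs, abs_inv]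
  · congr 3
    rw [hB, Matrix.mul_inv_rev, ← Matrix.mulVec_mulVec, ← hT, Matrix.dotProduct_mulVec a B⁻¹,
      ← Matrix.mulVec_transpose, Matrix.transpose_nonsing_inv]

end Density

/-! ### Convergence of expectations of functionals of Gaussian vectors -/

section Convergence

variable {Ω : Type*} [MeasurableSpace Ω] {μ : Measure Ω}

/-- Almost sure convergence and boundedness in `L²` imply the convergence of expectations. -/
theorem tendsto_integral_of_sq_bounded [IsProbabilityMeasure μ] {T : Type*} {l : Filter T}
    [l.IsCountablyGenerated] {X : T → Ω → ℝ} {X₀ : Ω → ℝ} {M : ℝ}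
    (hX : ∀ᶠ t in l, MemLp (X t) 2 μ ∧ (∀ᵐ ω ∂μ, 0 ≤ X t ω) ∧ ∫ ω, X t ω ^ 2 ∂μ ≤ M)
    (hX₀ : MemLp X₀ 2 μ) (hX₀n : ∀ᵐ ω ∂μ, 0 ≤ X₀ ω) (hX₀M : ∫ ω, X₀ ω ^ 2 ∂μ ≤ M)
    (hlim : ∀ᵐ ω ∂μ, Tendsto (fun t => X t ω) l (𝓝 (X₀ ω))) :
    Tendsto (fun t => ∫ ω, X t ω ∂μ) l (𝓝 (∫ ω, X₀ ω ∂μ)) := by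
  have hM : 0 ≤ M := (integral_nonneg fun ω => sq_nonneg (X₀ ω)).trans hX₀M
  -- Truncation at level `K` costs at most `M / K`, since `Y - min Y K ≤ Y ^ 2 / K` for `Y ≥ 0`. The
  -- truncated expectations converge by dominated convergence.
  have trunc : ∀ K > 0, ∀ Y : Ω → ℝ, MemLp Y 2 μ → (∀ᵐ ω ∂μ, 0 ≤ Y ω) → ∫ ω, Y ω ^ 2 ∂μ ≤ M →
      |∫ ω, Y ω ∂μ - ∫ ω, min (Y ω) K ∂μ| ≤ M / K := by
    intro K hK Y hY hYn hYM
    have hYi : Integrable Y μ := hY.integrable (by norm_num)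
    have hmin : Integrable (fun ω => min (Y ω) K) μ := hYi.inf (integrable_const K)
    rw [← integral_sub hYi hmin]
    have hb : ∀ᵐ ω ∂μ, 0 ≤ Y ω - min (Y ω) K ∧ Y ω - min (Y ω) K ≤ Y ω ^ 2 / K := by
      filter_upwards [hYn] with ω h0
      refine ⟨sub_nonneg.mpr (min_le_left _ _), ?_⟩
      rw [le_div_iff₀ hK]
      rcases le_total (Y ω) K with h | h
      · rw [min_eq_left h]; nlinarith [sq_nonneg (Y ω)]
      · rw [min_eq_right h]; nlinarith
    rw [abs_of_nonneg (integral_nonneg_of_ae (hb.mono fun ω h => h.1))]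
    calc ∫ ω, (Y ω - min (Y ω) K) ∂μ ≤ ∫ ω, Y ω ^ 2 / K ∂μ :=
          integral_mono_ae (hYi.sub hmin) (hY.integrable_sq.div_const K) (hb.mono fun ω h => h.2)
      _ ≤ M / K := by
          rw [integral_div]
          gcongr
  -- The level `K` below makes each of the two truncation errors less than `ε / 3`; the `+ 1` keeps
  -- it positive when `M = 0`.
  rw [Metric.tendsto_nhds]
  intro ε hε
  set K : ℝ := 3 * (M + 1) / ε with hK
  have hKpos : 0 < K := by positivity
  have hMK : M / K < ε / 3 := by
    rw [div_lt_iff₀ hKpos, hK]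
    field_simp
    linarith
  have hdom : Tendsto (fun t => ∫ ω, min (X t ω) K ∂μ) l (𝓝 (∫ ω, min (X₀ ω) K ∂μ)) := by
    refine tendsto_integral_filter_of_dominated_convergence (fun _ => K) ?_ ?_
      (integrable_const _) ?_
    · filter_upwards [hX] with t ht
      exact (ht.1.aestronglyMeasurable.inf aestronglyMeasurable_const)
    · filter_upwards [hX] with t ht
      filter_upwards [ht.2.1] with ω h0
      rw [Real.norm_of_nonneg (le_min h0 hKpos.le)]
      exact min_le_right _ _
    · filter_upwards [hlim] with ω hω
      exact hω.min tendsto_const_nhds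
  filter_upwards [hX, Metric.tendsto_nhds.mp hdom (ε / 3) (by positivity)] with t ht h2
  have h1 := trunc K hKpos (X t) ht.1 ht.2.1 ht.2.2
  have h3 := trunc K hKpos X₀ hX₀ hX₀n hX₀M
  rw [Real.dist_eq] at h2 ⊢
  rw [abs_le] at h1 h3
  rw [abs_lt] at h2 ⊢
  constructor <;> linarith [h1.1, h1.2, h2.1, h2.2, h3.1, h3.2]

theorem integral_abs_pow_of_map_eq_gaussianReal {X : Ω → ℝ} {v : NNReal}
    (h : μ.map X = gaussianReal 0 v) (n : ℕ) :
    ∫ ω, |X ω| ^ n ∂μ = Real.sqrt v ^ n * ∫ x, |x| ^ n ∂(gaussianReal 0 1) := by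
  have hX : AEMeasurable X μ := aemeasurable_of_map_neZero (by rw [h]; infer_instance)
  have h1 := integral_map (μ := μ) (f := fun x : ℝ => |x| ^ n) hX (by fun_prop)
  have h2 : gaussianReal 0 v = (gaussianReal 0 1).map (Real.sqrt v * ·) := by
    rw [gaussianReal_map_const_mul]
    congr 1
    · simp
    · ext
      simp
  rw [← h1, h, h2, integral_map (by fun_prop) (by fun_prop), ← integral_const_mul]
  refine integral_congr_ae (ae_of_all _ fun x => ?_)
  simp only [abs_mul, mul_pow, abs_of_nonneg (Real.sqrt_nonneg _)]

/-- Convergence of the expectation of functionals with polynomial growth of Gaussian vectors that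
converge almost surely. -/
theorem tendsto_integral_of_le_gaussian [IsProbabilityMeasure μ] {ι T : Type*} [Fintype ι]
    {l : Filter T} [l.IsCountablyGenerated] {W : T → ι → Ω → ℝ} {W₀ : ι → Ω → ℝ}
    (hW : ∀ t, IsCenteredGaussianVector (W t) μ) (hW₀ : IsCenteredGaussianVector W₀ μ)
    (hWlim : ∀ i, ∀ᵐ ω ∂μ, Tendsto (fun t => W t i ω) l (𝓝 (W₀ i ω)))
    {F : T → Ω → ℝ} {F₀ : Ω → ℝ} {C : ℝ} {n : ℕ}
    (hFm : ∀ᶠ t in l, AEStronglyMeasurable (F t) μ)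
    (hF : ∀ᶠ t in l, ∀ᵐ ω ∂μ, 0 ≤ F t ω ∧ F t ω ≤ C * (1 + ∑ i, |W t i ω| ^ n))
    (hFlim : ∀ᵐ ω ∂μ, Tendsto (fun t => F t ω) l (𝓝 (F₀ ω))) :
    Tendsto (fun t => ∫ ω, F t ω ∂μ) l (𝓝 (∫ ω, F₀ ω ∂μ)) := by
  rcases l.eq_or_neBot with rfl | hl
  · exact tendsto_bot
  -- The filter is countably generated, so measurability and the growth bound pass to the limit
  -- along a sequence tending to it.
  have hF₀m : AEStronglyMeasurable F₀ μ := by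
    obtain ⟨u, hu⟩ := l.exists_seq_tendsto
    obtain ⟨N, hN⟩ := eventually_atTop.mp (hu.eventually hFm)
    refine aestronglyMeasurable_of_tendsto_ae atTop (f := fun m => F (u (m + N)))
      (fun m => hN _ (by omega)) ?_
    filter_upwards [hFlim] with ω hω
    exact (hω.comp hu).comp (tendsto_add_atTop_nat N)
  have hF₀ : ∀ᵐ ω ∂μ, 0 ≤ F₀ ω ∧ F₀ ω ≤ C * (1 + ∑ i, |W₀ i ω| ^ n) := by
    obtain ⟨u, hu⟩ := l.exists_seq_tendsto
    obtain ⟨N, hN⟩ := eventually_atTop.mp (hu.eventually hF)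
    have hall : ∀ᵐ ω ∂μ, ∀ m : ℕ, 0 ≤ F (u (m + N)) ω ∧
        F (u (m + N)) ω ≤ C * (1 + ∑ i, |W (u (m + N)) i ω| ^ n) :=
      ae_all_iff.mpr fun m => hN _ (by omega)
    filter_upwards [hall, hFlim, ae_all_iff.mpr hWlim] with ω h1 h2 h3
    have hu' : Tendsto (fun m => u (m + N)) atTop l := hu.comp (tendsto_add_atTop_nat N)
    refine ⟨ge_of_tendsto' (h2.comp hu') fun m => (h1 m).1, ?_⟩
    refine le_of_tendsto_of_tendsto' (h2.comp hu') ?_ fun m => (h1 m).2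
    refine (Tendsto.const_add _ (tendsto_finsetSum _ fun i _ => ?_)).const_mul _
    exact (((h3 i).comp hu').abs).pow n
  have hv : ∀ i, Tendsto (fun t => Var[W t i; μ]) l (𝓝 Var[W₀ i; μ]) := fun i =>
    tendsto_variance_of_hasGaussianLaw (fun t => (hW t).eval i) (fun t => (hW t).mean i)
      (hW₀.aemeasurable i) (hWlim i)
  set c : ℝ := ∫ x, |x| ^ (2 * n) ∂(gaussianReal 0 1) with hc
  have hmom : ∀ {Y : ι → Ω → ℝ}, IsCenteredGaussianVector Y μ → ∀ i,
      ∫ ω, |Y i ω| ^ (2 * n) ∂μ = Var[Y i; μ] ^ n * c := fun {Y} hY i => by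
    have := (hY.eval i).map_eq_gaussianReal
    rw [hY.mean] at this
    rw [integral_abs_pow_of_map_eq_gaussianReal this, pow_mul,
      Real.sq_sqrt (NNReal.coe_nonneg _), Real.coe_toNNReal _ (variance_nonneg _ _)]
  have hpow : ∀ {Y : ι → Ω → ℝ}, IsCenteredGaussianVector Y μ → ∀ i,
      MemLp (fun ω => |Y i ω| ^ n) 2 μ := fun {Y} hY i => by
    have h1 : MemLp (Y i) (2 * n : ℕ) μ := hY.memLp i (ENNReal.natCast_ne_top _)
    rw [memLp_two_iff_integrable_sq]
    · have := h1.integrable_norm_pow' 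
      refine this.congr (ae_of_all _ fun ω => ?_)
      simp only [Real.norm_eq_abs]
      ring
    · exact (by fun_prop : Continuous fun x : ℝ => |x| ^ n).comp_aestronglyMeasurable
        h1.aestronglyMeasurable
  have hG : ∀ {Y : ι → Ω → ℝ}, IsCenteredGaussianVector Y μ →
      MemLp (fun ω => C * (1 + ∑ i, |Y i ω| ^ n)) 2 μ := fun {Y} hY =>
    ((memLp_const (1 : ℝ)).add (memLp_finsetSum _ fun i _ => hpow hY i)).const_mul C
  -- The second moment is controlled by a continuous function of the variances alone. As the
  -- variances converge, this yields a bound that is eventually uniform.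
  have hbound : ∀ {Y : ι → Ω → ℝ}, IsCenteredGaussianVector Y μ → ∀ {Z : Ω → ℝ},
      AEStronglyMeasurable Z μ → (∀ᵐ ω ∂μ, 0 ≤ Z ω ∧ Z ω ≤ C * (1 + ∑ i, |Y i ω| ^ n)) →
      MemLp Z 2 μ ∧ (∀ᵐ ω ∂μ, 0 ≤ Z ω) ∧
        ∫ ω, Z ω ^ 2 ∂μ ≤ C ^ 2 * (2 * (1 + Fintype.card ι * ∑ i, Var[Y i; μ] ^ n * c)) := by
    intro Y hY Z hZm hZ
    have hZ2 : MemLp Z 2 μ := (hG hY).mono hZm (hZ.mono fun ω h => by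
      rw [Real.norm_of_nonneg h.1, Real.norm_of_nonneg (h.1.trans h.2)]
      exact h.2)
    refine ⟨hZ2, hZ.mono fun ω h => h.1, ?_⟩
    have hi : ∀ i, Integrable (fun ω => |Y i ω| ^ (2 * n)) μ := fun i => by
      refine (hpow hY i).integrable_sq.congr (ae_of_all _ fun ω => ?_)
      simp only
      ring
    have hi' : Integrable (fun ω => C ^ 2 * (2 * (1 + Fintype.card ι * ∑ i, |Y i ω| ^ (2 * n)))) μ :=
      (((integrable_const (1 : ℝ)).add ((integrable_finsetSum _ fun i _ => hi i).const_mul _)).const_mul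
        2).const_mul (C ^ 2)
    calc ∫ ω, Z ω ^ 2 ∂μ
        ≤ ∫ ω, C ^ 2 * (2 * (1 + Fintype.card ι * ∑ i, |Y i ω| ^ (2 * n))) ∂μ := by
          refine integral_mono_ae hZ2.integrable_sq hi' (hZ.mono fun ω h => ?_)
          have hs := sq_sum_le_card_mul_sum_sq (s := Finset.univ) (f := fun i => |Y i ω| ^ n)
          have he : ∑ i, (|Y i ω| ^ n) ^ 2 = ∑ i, |Y i ω| ^ (2 * n) :=
            Finset.sum_congr rfl fun i _ => by ring
          rw [he, Finset.card_univ] at hs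
          calc Z ω ^ 2 ≤ (C * (1 + ∑ i, |Y i ω| ^ n)) ^ 2 := pow_le_pow_left₀ h.1 h.2 2
            _ = C ^ 2 * (1 + ∑ i, |Y i ω| ^ n) ^ 2 := by ring
            _ ≤ C ^ 2 * (2 * (1 + Fintype.card ι * ∑ i, |Y i ω| ^ (2 * n))) := by
              refine mul_le_mul_of_nonneg_left ?_ (sq_nonneg C)
              nlinarith [sq_nonneg (1 - ∑ i, |Y i ω| ^ n)]
      _ = C ^ 2 * (2 * (1 + Fintype.card ι * ∑ i, Var[Y i; μ] ^ n * c)) := by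
          rw [integral_const_mul, integral_const_mul, integral_add (integrable_const _)
            ((integrable_finsetSum _ fun i _ => hi i).const_mul _), integral_const_mul,
            integral_finsetSum _ fun i _ => hi i]
          simp [hmom hY]
  set M : ℝ := C ^ 2 * (2 * (1 + Fintype.card ι * ∑ i, Var[W₀ i; μ] ^ n * c)) with hM
  have hlimM : Tendsto (fun t => C ^ 2 * (2 * (1 + Fintype.card ι * ∑ i, Var[W t i; μ] ^ n * c))) l
      (𝓝 M) :=
    ((((tendsto_finsetSum _ fun i _ => ((hv i).pow n).mul_const c).const_mul _).const_add
      1).const_mul 2).const_mul _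
  obtain ⟨h1, h2, h3⟩ := hbound hW₀ hF₀m hF₀
  refine tendsto_integral_of_sq_bounded (M := M + 1) ?_ h1 h2 (h3.trans (by linarith)) hFlim
  filter_upwards [hFm, hF, hlimM.eventually (gt_mem_nhds (lt_add_one M))] with t ht1 ht2 ht3
  obtain ⟨g1, g2, g3⟩ := hbound (hW t) ht1 ht2
  exact ⟨g1, g2, g3.trans ht3.le⟩

/-- The largest factor, raised to the number of factors, dominates the product and is one of the
summands. The term `1` is there for the empty index set. -/
theorem prod_abs_le_one_add_sum {ι : Type*} [Fintype ι] (w : ι → ℝ) :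
    ∏ i, |w i| ≤ 1 + ∑ i, |w i| ^ Fintype.card ι := by
  rcases isEmpty_or_nonempty ι with h | h
  · simp
  obtain ⟨j, -, hj⟩ := Finset.exists_max_image Finset.univ (fun i => |w i|) Finset.univ_nonempty
  calc ∏ i, |w i| ≤ ∏ _i : ι, |w j| :=
        Finset.prod_le_prod (fun i _ => abs_nonneg _) fun i hi => hj i hi
    _ = |w j| ^ Fintype.card ι := by simp
    _ ≤ ∑ i, |w i| ^ Fintype.card ι :=
        Finset.single_le_sum (f := fun i => |w i| ^ Fintype.card ι) (fun i _ => by positivity)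
          (Finset.mem_univ j)
    _ ≤ _ := by linarith

theorem norm_pow_le_one_add_sum {ι : Type*} [Fintype ι] (w : ι → ℝ) :
    ‖w‖ ^ Fintype.card ι ≤ 1 + ∑ i, |w i| ^ Fintype.card ι := by
  rcases isEmpty_or_nonempty ι with h | h
  · simp
  obtain ⟨j, -, hj⟩ := Finset.exists_max_image Finset.univ (fun i => |w i|) Finset.univ_nonempty
  have hn : ‖w‖ ≤ |w j| := (pi_norm_le_iff_of_nonneg (abs_nonneg _)).mpr fun i => hj i (by simp)
  calc ‖w‖ ^ Fintype.card ι ≤ |w j| ^ Fintype.card ι := pow_le_pow_left₀ (norm_nonneg _) hn _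
    _ ≤ ∑ i, |w i| ^ Fintype.card ι :=
        Finset.single_le_sum (f := fun i => |w i| ^ Fintype.card ι) (fun i _ => by positivity)
          (Finset.mem_univ j)
    _ ≤ _ := by linarith

end Convergence

/-! ### Small ball asymptotics for the sign changes of a Gaussian vector -/

section Matrices

variable {ι T : Type*} [Fintype ι] [DecidableEq ι] {l : Filter T}

theorem tendsto_matrix_inv {S : T → Matrix ι ι ℝ} {S₀ : Matrix ι ι ℝ} (hS : Tendsto S l (𝓝 S₀))
    (h₀ : S₀.det ≠ 0) : Tendsto (fun t => (S t)⁻¹) l (𝓝 S₀⁻¹) := by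
  refine (continuousAt_matrix_inv S₀ ?_).tendsto.comp hS
  have : (Ring.inverse : ℝ → ℝ) = Inv.inv := Ring.inverse_eq_inv'
  rw [this]
  exact continuousAt_inv₀ h₀

theorem tendsto_gaussianDensity {S : T → Matrix ι ι ℝ} {S₀ : Matrix ι ι ℝ}
    (hS : Tendsto S l (𝓝 S₀)) (h₀ : 0 < S₀.det) {a : T → ι → ℝ} {a₀ : ι → ℝ}
    (ha : Tendsto a l (𝓝 a₀)) :
    Tendsto (fun t => gaussianDensity (S t) (a t)) l (𝓝 (gaussianDensity S₀ a₀)) := by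
  have hd : Tendsto (fun t => (S t).det) l (𝓝 S₀.det) :=
    ((continuous_id.matrix_det).tendsto S₀).comp hS
  have hi := tendsto_matrix_inv hS h₀.ne'
  refine Tendsto.mul (Tendsto.inv₀ (Tendsto.const_mul _ ?_) ?_) ?_
  · exact (Real.continuousAt_rpow_const _ _ (Or.inl h₀.ne')).tendsto.comp hd
  · have := Real.rpow_pos_of_pos h₀ (1 / 2)
    positivity
  · refine (Real.continuous_exp.tendsto _).comp (Tendsto.div_const (Tendsto.neg ?_) _)
    have hc : Continuous fun p : Matrix ι ι ℝ × (ι → ℝ) => p.2 ⬝ᵥ p.1.mulVec p.2 :=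
      continuous_snd.dotProduct (continuous_fst.matrix_mulVec continuous_snd)
    exact (hc.tendsto (S₀⁻¹, a₀)).comp (hi.prodMk_nhds ha)

theorem gaussianDensity_nonneg {S : Matrix ι ι ℝ} (h : 0 ≤ S.det) (a : ι → ℝ) :
    0 ≤ gaussianDensity S a := by
  have := Real.rpow_nonneg h (1 / 2)
  unfold gaussianDensity
  positivity

theorem gaussianDensity_le {S : Matrix ι ι ℝ} (hS : S.PosSemidef) (a : ι → ℝ) :
    gaussianDensity S a ≤ gaussianDensity S 0 := by
  have h := Real.rpow_nonneg hS.det_nonneg (1 / 2)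
  unfold gaussianDensity
  refine mul_le_mul_of_nonneg_left (Real.exp_le_exp.mpr ?_) (by positivity)
  have := hS.inv.dotProduct_mulVec_nonneg a
  simp only [star_trivial] at this
  simp only [zero_dotProduct, neg_zero, zero_div]
  linarith

theorem measurable_gaussianDensity (S : Matrix ι ι ℝ) : Measurable (gaussianDensity S) := by
  unfold gaussianDensity
  simp only [dotProduct, Matrix.mulVec]
  fun_prop

omit [DecidableEq ι] in
theorem abs_mulVec_le (R : Matrix ι ι ℝ) (b : ι → ℝ) (i : ι) :
    |R.mulVec b i| ≤ (∑ i, ∑ j, |R i j|) * ‖b‖ := by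
  calc |R.mulVec b i| ≤ ∑ j, |R i j * b j| := Finset.abs_sum_le_sum_abs _ _
    _ ≤ ∑ j, |R i j| * ‖b‖ := Finset.sum_le_sum fun j _ => by
        rw [abs_mul]
        exact mul_le_mul_of_nonneg_left (norm_le_pi_norm b j) (abs_nonneg _)
    _ = (∑ j, |R i j|) * ‖b‖ := by rw [Finset.sum_mul]
    _ ≤ _ := mul_le_mul_of_nonneg_right
        (Finset.single_le_sum (f := fun i => ∑ j, |R i j|)
          (fun i _ => Finset.sum_nonneg fun j _ => abs_nonneg _) (Finset.mem_univ i))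
        (norm_nonneg _)

end Matrices

/-! ### Geometry of the rescaled sign-change sets -/

section SignChange

variable {ι T : Type*} [Fintype ι]

/-- The set of the `b` such that `b i` and `b i + w i + h (R b) i` have opposite signs for all `i`. -/
def signChangeSet (R : Matrix ι ι ℝ) (h : ℝ) (w : ι → ℝ) : Set (ι → ℝ) :=
  {b | ∀ i, b i * (b i + (w i + h * R.mulVec b i)) < 0}

theorem measurableSet_signChangeSet_uncurry (R : Matrix ι ι ℝ) (h : ℝ) :
    MeasurableSet {p : (ι → ℝ) × (ι → ℝ) | p.1 ∈ signChangeSet R h p.2} := by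
  have hm : ∀ i, Measurable fun p : (ι → ℝ) × (ι → ℝ) =>
      p.1 i * (p.1 i + (p.2 i + h * R.mulVec p.1 i)) := fun i => by
    simp only [Matrix.mulVec, dotProduct]
    fun_prop
  have he : {p : (ι → ℝ) × (ι → ℝ) | p.1 ∈ signChangeSet R h p.2} =
      ⋂ i, {p | p.1 i * (p.1 i + (p.2 i + h * R.mulVec p.1 i)) < 0} := by
    ext p
    simp [signChangeSet]
  rw [he]
  exact MeasurableSet.iInter fun i => measurableSet_lt (hm i) measurable_const

theorem measurableSet_signChangeSet (R : Matrix ι ι ℝ) (h : ℝ) (w : ι → ℝ) :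
    MeasurableSet (signChangeSet R h w) :=
  measurable_prodMk_right (measurableSet_signChangeSet_uncurry R h)

/-- If `b i` and `b i + c i` have opposite signs then `|b i| ≤ |c i|`. Here `c i = w i + h (R b) i`,
and smallness of `h R` lets half of `‖b‖` be absorbed in the left-hand side. -/
theorem norm_le_of_mem_signChangeSet {R : Matrix ι ι ℝ} {h : ℝ} {w b : ι → ℝ}
    (hR : |h| * (∑ i, ∑ j, |R i j|) ≤ 1 / 2) (hb : b ∈ signChangeSet R h w) :
    ‖b‖ ≤ 2 * ‖w‖ := by
  have h1 : ‖b‖ ≤ ‖w‖ + 1 / 2 * ‖b‖ := by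
    refine (pi_norm_le_iff_of_nonneg (by positivity)).mpr fun i => ?_
    have h2 : |b i| ≤ |w i + h * R.mulVec b i| := by
      have h3 := hb i
      set c := w i + h * R.mulVec b i
      rw [← sq_le_sq]
      nlinarith [sq_nonneg (b i + c), sq_nonneg (b i), sq_nonneg c]
    calc |b i| ≤ |w i| + |h * R.mulVec b i| := h2.trans (abs_add_le _ _)
      _ ≤ ‖w‖ + |h| * ((∑ i, ∑ j, |R i j|) * ‖b‖) := by
          rw [abs_mul]
          exact add_le_add (norm_le_pi_norm w i)
            (mul_le_mul_of_nonneg_left (abs_mulVec_le R b i) (abs_nonneg _))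
      _ ≤ ‖w‖ + 1 / 2 * ‖b‖ := by
          rw [← mul_assoc]
          gcongr
  linarith

/-- The coordinates decouple: each `b i` ranges over the open interval between `0` and `-w i`. This
is the source of the factors `|B i|` in the Kac–Rice formula. -/
theorem volume_signChangeSet_zero (w : ι → ℝ) :
    volume.real (signChangeSet 0 0 w) = ∏ i, |w i| := by
  have h : signChangeSet 0 0 w = Set.univ.pi fun i => Set.Ioo (min 0 (-w i)) (max 0 (-w i)) := by
    ext b
    simp only [signChangeSet, Set.mem_ofPred, Set.mem_univ_pi, zero_mul, add_zero, Set.mem_Ioo,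
      min_lt_iff, lt_max_iff]
    refine forall_congr' fun i => ?_
    rw [mul_neg_iff]
    constructor
    · rintro (⟨h1, h2⟩ | ⟨h1, h2⟩)
      · exact ⟨Or.inl h1, Or.inr (by linarith)⟩
      · exact ⟨Or.inr (by linarith), Or.inl h1⟩
    · rintro ⟨h1 | h1, h2 | h2⟩
      · linarith
      · exact Or.inl ⟨h1, by linarith⟩
      · exact Or.inr ⟨h2, by linarith⟩
      · linarith
  rw [h, measureReal_def, Real.volume_pi_Ioo_toReal fun i => min_le_max]
  refine Finset.prod_congr rfl fun i _ => ?_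
  rw [max_sub_min_eq_abs]
  simp

theorem ae_forall_eval_ne (c : ι → ℝ) : ∀ᵐ b : ι → ℝ, ∀ i, b i ≠ c i := by
  refine ae_all_iff.mpr fun i => ?_
  have h := (Measure.quasiMeasurePreserving_eval (fun _ : ι => (volume : Measure ℝ)) i).ae
    (p := fun x => x ≠ c i)
    (by simp [ae_iff])
  exact h

variable [DecidableEq ι] {l : Filter T}

/-- Polynomial domination in `w`, which permits integrating the pointwise limit over the law of the
residual. -/
theorem setIntegral_signChangeSet_le {S R : Matrix ι ι ℝ} {h : ℝ} {w : ι → ℝ}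
    (hS : S.PosSemidef) (hR : |h| * (∑ i, ∑ j, |R i j|) ≤ 1 / 2) :
    0 ≤ ∫ b in signChangeSet R h w, gaussianDensity S (h • b) ∧
    ∫ b in signChangeSet R h w, gaussianDensity S (h • b) ≤
      gaussianDensity S 0 * 4 ^ Fintype.card ι * ‖w‖ ^ Fintype.card ι := by
  refine ⟨integral_nonneg fun b => gaussianDensity_nonneg hS.det_nonneg _, ?_⟩
  have hsub : signChangeSet R h w ⊆ Metric.closedBall 0 (2 * ‖w‖) := fun b hb =>
    mem_closedBall_zero_iff.mpr (norm_le_of_mem_signChangeSet hR hb)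
  have hfin : volume (signChangeSet R h w) < ⊤ :=
    (measure_mono hsub).trans_lt measure_closedBall_lt_top
  have h1 := norm_setIntegral_le_of_norm_le_const (f := fun b => gaussianDensity S (h • b)) hfin
    (C := gaussianDensity S 0) (fun b _ => by
      rw [Real.norm_of_nonneg (gaussianDensity_nonneg hS.det_nonneg _)]
      exact gaussianDensity_le hS _)
  refine (Real.le_norm_self _).trans (h1.trans ?_)
  rw [mul_assoc]
  refine mul_le_mul_of_nonneg_left ?_ (gaussianDensity_nonneg hS.det_nonneg _)
  -- In the sup norm the ball of radius `2 * ‖w‖` is a cube of side `4 * ‖w‖`.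
  calc volume.real (signChangeSet R h w) ≤ volume.real (Metric.closedBall (0 : ι → ℝ) (2 * ‖w‖)) :=
        measureReal_mono hsub measure_closedBall_lt_top.ne
    _ = 4 ^ Fintype.card ι * ‖w‖ ^ Fintype.card ι := by
        rw [measureReal_def, Real.volume_pi_closedBall _ (by positivity),
          ENNReal.toReal_ofReal (by positivity), ← mul_pow]
        ring

/-- Dominated convergence: the sets eventually stay in a fixed ball, and their indicators converge
outside the hyperplanes bounding the limit box. -/
theorem tendsto_setIntegral_signChangeSet [l.IsCountablyGenerated] {S R : T → Matrix ι ι ℝ}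
    {S₀ R₀ : Matrix ι ι ℝ} {h : T → ℝ} {w : T → ι → ℝ} {w₀ : ι → ℝ} (hS : Tendsto S l (𝓝 S₀))
    (hSp : ∀ t, (S t).PosSemidef) (hS₀ : 0 < S₀.det) (hR : Tendsto R l (𝓝 R₀))
    (hh : Tendsto h l (𝓝 0)) (hhR : ∀ᶠ t in l, |h t| * (∑ i, ∑ j, |R t i j|) ≤ 1 / 2)
    (hw : Tendsto w l (𝓝 w₀)) :
    Tendsto (fun t => ∫ b in signChangeSet (R t) (h t) (w t), gaussianDensity (S t) (h t • b)) l
      (𝓝 (gaussianDensity S₀ 0 * ∏ i, |w₀ i|)) := by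
  have hlim0 := tendsto_gaussianDensity hS hS₀ (tendsto_const_nhds (x := (0 : ι → ℝ)))
  have e0 : gaussianDensity S₀ 0 * ∏ i, |w₀ i| =
      ∫ b, (signChangeSet 0 0 w₀).indicator (fun _ => gaussianDensity S₀ 0) b := by
    rw [integral_indicator (measurableSet_signChangeSet _ _ _), setIntegral_const,
      volume_signChangeSet_zero, smul_eq_mul, mul_comm]
  have e1 : ∀ t, ∫ b in signChangeSet (R t) (h t) (w t), gaussianDensity (S t) (h t • b) =
      ∫ b, (signChangeSet (R t) (h t) (w t)).indicator
        (fun b => gaussianDensity (S t) (h t • b)) b := fun t =>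
    (integral_indicator (measurableSet_signChangeSet _ _ _)).symm
  rw [e0]
  simp only [e1]
  set B := Metric.closedBall (0 : ι → ℝ) (2 * (‖w₀‖ + 1))
  refine tendsto_integral_filter_of_dominated_convergence
    (B.indicator fun _ => gaussianDensity S₀ 0 + 1) ?_ ?_ ?_ ?_
  · refine Eventually.of_forall fun t => Measurable.aestronglyMeasurable ?_
    refine Measurable.indicator ?_ (measurableSet_signChangeSet _ _ _)
    exact (measurable_gaussianDensity _).comp (measurable_const_smul _)
  · filter_upwards [hhR, hw.norm.eventually (gt_mem_nhds (lt_add_one ‖w₀‖)),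
      hlim0.eventually (gt_mem_nhds (lt_add_one _))] with t ht1 ht2 ht3
    refine ae_of_all _ fun b => ?_
    by_cases hb : b ∈ signChangeSet (R t) (h t) (w t)
    · have hbB : b ∈ B := mem_closedBall_zero_iff.mpr
        ((norm_le_of_mem_signChangeSet ht1 hb).trans (by linarith))
      rw [Set.indicator_of_mem hb, Set.indicator_of_mem hbB,
        Real.norm_of_nonneg (gaussianDensity_nonneg (hSp t).det_nonneg _)]
      exact (gaussianDensity_le (hSp t) _).trans ht3.le
    · rw [Set.indicator_of_notMem hb, norm_zero]
      exact Set.indicator_nonneg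
        (fun _ _ => by have := gaussianDensity_nonneg hS₀.le (0 : ι → ℝ); positivity) _
  · exact (integrable_indicator_iff measurableSet_closedBall).mpr
      (integrableOn_const (measure_closedBall_lt_top.ne))
  -- Off the null set where `b i = 0` or `b i = -w₀ i`, the limiting products are nonzero. Their
  -- sign then decides membership for all late parameters.
  · filter_upwards [ae_forall_eval_ne (0 : ι → ℝ), ae_forall_eval_ne fun i => -w₀ i] with b hb1 hb2
    have hlimi : ∀ i, Tendsto (fun t => b i * (b i + (w t i + h t * (R t).mulVec b i))) l
        (𝓝 (b i * (b i + (w₀ i + 0 * (0 : Matrix ι ι ℝ).mulVec b i)))) := fun i => by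
      have h1 : Tendsto (fun t => (R t).mulVec b i) l (𝓝 (R₀.mulVec b i)) :=
        (((continuous_id.matrix_mulVec continuous_const).tendsto R₀).comp hR).apply_nhds i
      have h2 := hh.mul h1
      simp only [zero_mul] at h2 ⊢
      exact (((hw.apply_nhds i).add h2).const_add _).const_mul _
    have hne : ∀ i, b i * (b i + (w₀ i + 0 * (0 : Matrix ι ι ℝ).mulVec b i)) ≠ 0 := fun i => by
      simp only [zero_mul, add_zero]
      exact mul_ne_zero (hb1 i) fun h => hb2 i (by linarith)
    have hdens : Tendsto (fun t => gaussianDensity (S t) (h t • b)) l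
        (𝓝 (gaussianDensity S₀ 0)) := by
      refine tendsto_gaussianDensity hS hS₀ ?_
      simpa using hh.smul_const b
    by_cases hb : b ∈ signChangeSet 0 0 w₀
    · have hev : ∀ᶠ t in l, b ∈ signChangeSet (R t) (h t) (w t) :=
        eventually_all.mpr fun i => (hlimi i).eventually (gt_mem_nhds (hb i))
      rw [Set.indicator_of_mem hb]
      refine hdens.congr' ?_
      filter_upwards [hev] with t ht
      rw [Set.indicator_of_mem ht]
    · obtain ⟨i, hi⟩ : ∃ i, ¬ b i * (b i + (w₀ i + 0 * (0 : Matrix ι ι ℝ).mulVec b i)) < 0 := by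
        simpa only [signChangeSet, Set.mem_ofPred, not_forall] using hb
      rw [Set.indicator_of_notMem hb]
      refine tendsto_const_nhds.congr' ?_
      filter_upwards [(hlimi i).eventually (lt_mem_nhds (lt_of_le_of_ne (not_lt.mp hi) (hne i).symm))]
        with t ht
      rw [Set.indicator_of_notMem]
      exact fun hmem => absurd (hmem i) (not_lt.mpr ht.le)

end SignChange

/-! ### The Kac--Rice density -/

section KacRice

variable {Ω : Type*} [MeasurableSpace Ω] {μ : Measure Ω}

/-- The residual `V - Cov(V, U) Var(U)⁻¹ U` of the linear regression of `V` on `U`. -/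
def regressionResidual {α β : Type*} [Fintype α] [DecidableEq α] (μ : Measure Ω)
    (U : α → Ω → ℝ) (V : β → Ω → ℝ) : β → Ω → ℝ :=
  fun b ω => V b ω - (regressionMatrix μ U V).mulVec (fun a => U a ω) b

/-- The value at `0` of the Kac--Rice density `𝔼[∏ |B i| | A = 0] p_A(0)`. -/
def kacRiceDensity {ι : Type*} [Fintype ι] [DecidableEq ι] (μ : Measure Ω) (A B : ι → Ω → ℝ) : ℝ :=
  gaussianDensity (varMatrix μ A) 0 * ∫ ω, ∏ i, |regressionResidual μ A B i ω| ∂μ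

theorem gaussianCondExpZero_eq_integral_residual {α β : Type*} [Fintype α] [DecidableEq α]
    [Fintype β] {U : α → Ω → ℝ} {V : β → Ω → ℝ} (hU : ∀ a, AEMeasurable (U a) μ)
    (hV : ∀ b, AEMeasurable (V b) μ) {g : (β → ℝ) → ℝ} (hg : Measurable g) :
    gaussianCondExpZero μ U V g = ∫ ω, g (fun b => regressionResidual μ U V b ω) ∂μ := by
  have hUm : AEMeasurable (fun ω a => U a ω) μ := aemeasurable_pi_lambda _ hU
  have hVm : AEMeasurable (fun ω b => V b ω) μ := aemeasurable_pi_lambda _ hV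
  have hL : Measurable fun u : α → ℝ => (regressionMatrix μ U V).mulVec u :=
    (LinearMap.continuous_of_finiteDimensional (Matrix.mulVecLin (regressionMatrix μ U V))).measurable
  have hm : AEMeasurable (fun ω => (fun b => V b ω) +
      (regressionMatrix μ U V).mulVec (0 - fun a => U a ω)) μ :=
    hVm.add (hL.comp_aemeasurable (aemeasurable_const.sub hUm))
  rw [gaussianCondExpZero, gaussianCondLaw, integral_map hm hg.aestronglyMeasurable]
  refine integral_congr_ae (ae_of_all _ fun ω => ?_)
  simp only [zero_sub, Matrix.mulVec_neg, regressionResidual]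
  congr 1

/-! ### Independence of the regression residual -/

section Residual

variable {α β : Type*} [Fintype α] [Fintype β] {U : α → Ω → ℝ} {V : β → Ω → ℝ}

theorem isCenteredGaussianVector_left (h : IsCenteredGaussianVector (Sum.elim U V) μ) :
    IsCenteredGaussianVector U μ :=
  h.comp Sum.inl

theorem isCenteredGaussianVector_right (h : IsCenteredGaussianVector (Sum.elim U V) μ) :
    IsCenteredGaussianVector V μ :=
  h.comp Sum.inr

variable [DecidableEq α]

theorem isCenteredGaussianVector_elim_residual
    (h : IsCenteredGaussianVector (Sum.elim U V) μ) :
    IsCenteredGaussianVector (Sum.elim U (regressionResidual μ U V)) μ := by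
  classical
  have := h.mulMatrix (Matrix.fromBlocks (1 : Matrix α α ℝ) 0 (-regressionMatrix μ U V)
    (1 : Matrix β β ℝ))
  refine this.congr fun s => ae_of_all _ fun ω => ?_
  rcases s with a | b
  · simp [linComb, Matrix.one_apply]
  · simp [linComb, regressionResidual, Matrix.mulVec, dotProduct, Matrix.one_apply]
    ring

omit [Fintype β] in
theorem regressionMatrix_mul_varMatrix (hU : IsNondegenerateVector μ U) :
    regressionMatrix μ U V * varMatrix μ U = covMatrix μ V U := by
  rw [regressionMatrix, Matrix.mul_assoc, Matrix.nonsing_inv_mul, Matrix.mul_one]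
  exact isUnit_iff_ne_zero.mpr hU

/-- These are the normal equations `R Var(U) = Cov(V, U)` of linear regression. -/
theorem covariance_residual [IsProbabilityMeasure μ]
    (h : IsCenteredGaussianVector (Sum.elim U V) μ) (hU : IsNondegenerateVector μ U) (a : α)
    (b : β) : cov[U a, regressionResidual μ U V b; μ] = 0 := by
  have hU2 : ∀ a, MemLp (U a) 2 μ := fun a => (isCenteredGaussianVector_left h).memLp a (by simp)
  have hV2 : ∀ b, MemLp (V b) 2 μ := fun b => (isCenteredGaussianVector_right h).memLp b (by simp)
  have h1 : regressionResidual μ U V b = fun ω => V b ω - linComb (regressionMatrix μ U V) U b ω := rfl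
  have h3 : MemLp (linComb (regressionMatrix μ U V) U b) 2 μ :=
    memLp_finsetSum _ fun c _ => (hU2 c).const_mul _
  have h2 := congrFun (congrFun (covMatrix_linComb_left hU2 hU2 (regressionMatrix μ U V)) b) a
  rw [← varMatrix, regressionMatrix_mul_varMatrix hU] at h2
  simp only [covMatrix, Matrix.of_apply] at h2
  rw [h1, covariance_fun_sub_right (hU2 a) (hV2 b) h3, covariance_comm (U a) (linComb _ _ _)]
  change _ - cov[linComb (regressionMatrix μ U V) U b, U a; μ] = 0
  rw [h2, covariance_comm, sub_self]

/-- For jointly Gaussian vectors, absence of correlation is independence. -/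
theorem map_prodMk_residual [IsProbabilityMeasure μ]
    (h : IsCenteredGaussianVector (Sum.elim U V) μ) (hU : IsNondegenerateVector μ U) :
    μ.map (fun ω => ((fun a => U a ω), (fun b => regressionResidual μ U V b ω))) =
      (μ.map fun ω a => U a ω).prod (μ.map fun ω b => regressionResidual μ U V b ω) := by
  have hW := isCenteredGaussianVector_elim_residual h
  have hG : HasGaussianLaw (fun ω => ((fun a => U a ω), (fun b => regressionResidual μ U V b ω))) μ := by
    have := hW.gaussian.map_fun
      ((ContinuousLinearMap.pi fun a => (ContinuousLinearMap.proj (Sum.inl a) :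
        (α ⊕ β → ℝ) →L[ℝ] ℝ)).prod (ContinuousLinearMap.pi fun b =>
          (ContinuousLinearMap.proj (Sum.inr b) : (α ⊕ β → ℝ) →L[ℝ] ℝ)))
    exact this
  exact (indepFun_iff_map_prod_eq_prod_map_map hG.fst.aemeasurable hG.snd.aemeasurable).mp
    (hG.indepFun_of_covariance_eval fun a b => covariance_residual h hU a b)

end Residual

variable {ι : Type*} [Fintype ι] [DecidableEq ι]

theorem varMatrix_det_pos [IsProbabilityMeasure μ] {A : ι → Ω → ℝ} (hA : ∀ i, MemLp (A i) 2 μ)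
    (h : IsNondegenerateVector μ A) : 0 < (varMatrix μ A).det :=
  lt_of_le_of_ne (posSemidef_varMatrix hA).det_nonneg (Ne.symm h)

open scoped Pointwise in
-- Under `a = h • b` the defining products are multiplied by `h ^ 2`, so their signs are unchanged.
-- The volume element contributes `h ^ k`, with `k` the number of coordinates.
theorem measureReal_map_smul_signChangeSet [IsProbabilityMeasure μ] {A : ι → Ω → ℝ}
    (hA : IsCenteredGaussianVector A μ) (hnd : IsNondegenerateVector μ A) (R : Matrix ι ι ℝ)
    {h : ℝ} (hh : 0 < h) (w : ι → ℝ) :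
    (μ.map fun ω i => A i ω).real (signChangeSet R h (h • w)) =
      h ^ Fintype.card ι *
        ∫ b in signChangeSet R h w, gaussianDensity (varMatrix μ A) (h • b) := by
  have hd := (varMatrix_det_pos (fun i => hA.memLp i (by simp)) hnd).le
  have hset : signChangeSet R h (h • w) = h • signChangeSet R h w := by
    ext a
    rw [Set.mem_smul_set_iff_inv_smul_mem₀ hh.ne']
    refine forall_congr' fun i => ?_
    have e : (h⁻¹ • a) i * ((h⁻¹ • a) i + (w i + h * R.mulVec (h⁻¹ • a) i)) =
        (h⁻¹) ^ 2 * (a i * (a i + ((h • w) i + h * R.mulVec a i))) := by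
      rw [Matrix.mulVec_smul]
      simp only [Pi.smul_apply, smul_eq_mul]
      field_simp
    rw [e]
    have hp : 0 < (h⁻¹) ^ 2 := by positivity
    exact ⟨fun hn => mul_neg_of_pos_of_neg hp hn, fun hn => not_le.mp fun hc =>
      absurd (mul_nonneg hp.le hc) (not_le.mpr hn)⟩
  rw [Measure.setIntegral_comp_smul_of_pos volume _ _ hh, ← hset, Module.finrank_pi, smul_eq_mul,
    mul_inv_cancel_left₀ (by positivity), measureReal_def, hA.map_eq_withDensity hnd,
    withDensity_apply _ (measurableSet_signChangeSet _ _ _),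
    integral_eq_lintegral_of_nonneg_ae (ae_of_all _ fun a => gaussianDensity_nonneg hd a)
      (measurable_gaussianDensity _).aestronglyMeasurable]

/-- Conditioning on the residual in the probability that all the pairs `A i`, `A i + h B i` have
opposite signs. -/
theorem measureReal_signChange [IsProbabilityMeasure μ] {A B : ι → Ω → ℝ}
    (hAB : IsCenteredGaussianVector (Sum.elim A B) μ) (hnd : IsNondegenerateVector μ A)
    {h : ℝ} (hh : 0 < h) :
    AEStronglyMeasurable (fun ω => ∫ b in signChangeSet (regressionMatrix μ A B) h
      (fun i => regressionResidual μ A B i ω), gaussianDensity (varMatrix μ A) (h • b)) μ ∧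
    μ.real {ω | ∀ i, A i ω * (A i ω + h * B i ω) < 0} = h ^ Fintype.card ι *
      ∫ ω, (∫ b in signChangeSet (regressionMatrix μ A B) h (fun i => regressionResidual μ A B i ω),
        gaussianDensity (varMatrix μ A) (h • b)) ∂μ := by
  set R := regressionMatrix μ A B with hR
  set W := regressionResidual μ A B with hW
  have hA := isCenteredGaussianVector_left hAB
  have hWg : IsCenteredGaussianVector W μ :=
    isCenteredGaussianVector_right (isCenteredGaussianVector_elim_residual hAB)
  have hAm : AEMeasurable (fun ω i => A i ω) μ := hA.gaussian.aemeasurable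
  have hWm : AEMeasurable (fun ω i => W i ω) μ := hWg.gaussian.aemeasurable
  have hPA : IsProbabilityMeasure (μ.map fun ω i => A i ω) := Measure.isProbabilityMeasure_map hAm
  set E : Set ((ι → ℝ) × (ι → ℝ)) := {p | p.1 ∈ signChangeSet R h (h • p.2)} with hE
  have hEm : MeasurableSet E :=
    ((measurable_fst.prodMk (measurable_snd.const_smul h)) :
      Measurable fun p : (ι → ℝ) × (ι → ℝ) => (p.1, h • p.2))
      (measurableSet_signChangeSet_uncurry R h)
  -- Since `B = W + R A`, the event says that `A` lies in the sign-change set of parameter `h • W`.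
  -- As `W` is independent of `A`, Fubini then lets `W` be frozen.
  have hev : {ω | ∀ i, A i ω * (A i ω + h * B i ω) < 0} =
      (fun ω => ((fun i => A i ω), (fun i => W i ω))) ⁻¹' E := by
    ext ω
    refine forall_congr' fun i => ?_
    have : B i ω = W i ω + R.mulVec (fun i => A i ω) i := by
      simp only [hW, hR, regressionResidual, sub_add_cancel]
    rw [this, mul_add h]
    rfl
  have hmeas : Measurable fun w : ι → ℝ => (μ.map fun ω i => A i ω).real
      (signChangeSet R h (h • w)) :=
    (measurable_measure_prodMk_right (μ := μ.map fun ω i => A i ω) hEm).ennreal_toReal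
  have hfib : ∀ w, (μ.map fun ω i => A i ω).real (signChangeSet R h (h • w)) =
      h ^ Fintype.card ι * ∫ b in signChangeSet R h w, gaussianDensity (varMatrix μ A) (h • b) :=
    fun w => measureReal_map_smul_signChangeSet hA hnd R hh w
  constructor
  · have h1 : AEStronglyMeasurable (fun ω => (h ^ Fintype.card ι)⁻¹ *
        (μ.map fun ω i => A i ω).real (signChangeSet R h (h • fun i => W i ω))) μ :=
      ((hmeas.const_mul _).comp_aemeasurable hWm).aestronglyMeasurable
    refine h1.congr (ae_of_all _ fun ω => ?_)
    simp only [hfib]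
    rw [inv_mul_cancel_left₀ (by positivity)]
  · rw [hev, measureReal_def, ← Measure.map_apply_of_aemeasurable (hAm.prodMk hWm) hEm,
      map_prodMk_residual hAB hnd, Measure.prod_apply_symm hEm, ← integral_toReal
        (measurable_measure_prodMk_right hEm).aemeasurable (ae_of_all _ fun w => measure_lt_top _ _)]
    rw [← integral_const_mul]
    change ∫ w, (μ.map fun ω i => A i ω).real (signChangeSet R h (h • w)) ∂(μ.map _) = _
    rw [integral_map hWm hmeas.aestronglyMeasurable]
    exact integral_congr_ae (ae_of_all _ fun ω => hfib _)

/-! ### Passage to the limit in the Kac–Rice density -/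

section Limit

variable [IsProbabilityMeasure μ] {T : Type*} {l : Filter T} [l.IsCountablyGenerated]
  {A B : T → ι → Ω → ℝ} {A₀ B₀ : ι → Ω → ℝ}

theorem tendsto_covMatrix_of_ae {α β : Type*} [Fintype α] [Fintype β] {U : T → α → Ω → ℝ}
    {V : T → β → Ω → ℝ} {U₀ : α → Ω → ℝ} {V₀ : β → Ω → ℝ}
    (h : ∀ t, IsCenteredGaussianVector (Sum.elim (U t) (V t)) μ)
    (h₀ : IsCenteredGaussianVector (Sum.elim U₀ V₀) μ)
    (hU : ∀ i, ∀ᵐ ω ∂μ, Tendsto (fun t => U t i ω) l (𝓝 (U₀ i ω)))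
    (hV : ∀ i, ∀ᵐ ω ∂μ, Tendsto (fun t => V t i ω) l (𝓝 (V₀ i ω))) :
    Tendsto (fun t => covMatrix μ (U t) (V t)) l (𝓝 (covMatrix μ U₀ V₀)) := by
  refine tendsto_pi_nhds.mpr fun i => tendsto_pi_nhds.mpr fun j => ?_
  have := IsCenteredGaussianVector.tendsto_covariance h h₀ (l := l)
    (by rintro (i | i); exacts [hU i, hV i]) (Sum.inl i) (Sum.inr j)
  simpa [covMatrix] using this

theorem tendsto_varMatrix_of_ae {α : Type*} [Fintype α] {U : T → α → Ω → ℝ} {U₀ : α → Ω → ℝ}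
    (h : ∀ t, IsCenteredGaussianVector (U t) μ) (h₀ : IsCenteredGaussianVector U₀ μ)
    (hU : ∀ i, ∀ᵐ ω ∂μ, Tendsto (fun t => U t i ω) l (𝓝 (U₀ i ω))) :
    Tendsto (fun t => varMatrix μ (U t)) l (𝓝 (varMatrix μ U₀)) := by
  refine tendsto_pi_nhds.mpr fun i => tendsto_pi_nhds.mpr fun j => ?_
  simpa [varMatrix, covMatrix] using
    IsCenteredGaussianVector.tendsto_covariance h h₀ hU i j

variable (h : ∀ t, IsCenteredGaussianVector (Sum.elim (A t) (B t)) μ)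
  (h₀ : IsCenteredGaussianVector (Sum.elim A₀ B₀) μ)
  (hA : ∀ i, ∀ᵐ ω ∂μ, Tendsto (fun t => A t i ω) l (𝓝 (A₀ i ω)))
  (hB : ∀ i, ∀ᵐ ω ∂μ, Tendsto (fun t => B t i ω) l (𝓝 (B₀ i ω)))
  (hnd : IsNondegenerateVector μ A₀)

include h h₀ hA hB hnd

theorem tendsto_regressionMatrix :
    Tendsto (fun t => regressionMatrix μ (A t) (B t)) l (𝓝 (regressionMatrix μ A₀ B₀)) := by
  have h1 := tendsto_varMatrix_of_ae (fun t => isCenteredGaussianVector_left (h t))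
    (isCenteredGaussianVector_left h₀) hA
  have h2 := tendsto_covMatrix_of_ae h h₀ hA hB
  have h3 : Tendsto (fun t => covMatrix μ (B t) (A t)) l (𝓝 (covMatrix μ B₀ A₀)) := by
    have := (continuous_id.matrix_transpose.tendsto (covMatrix μ A₀ B₀)).comp h2
    simpa only [Function.comp_def, id_eq, covMatrix_transpose] using this
  have hc : Continuous fun p : Matrix ι ι ℝ × Matrix ι ι ℝ => p.1 * p.2 :=
    continuous_fst.matrix_mul continuous_snd
  exact (hc.tendsto (_, _)).comp (h3.prodMk_nhds (tendsto_matrix_inv h1 hnd))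

theorem ae_tendsto_residual (i : ι) : ∀ᵐ ω ∂μ,
    Tendsto (fun t => regressionResidual μ (A t) (B t) i ω) l (𝓝 (regressionResidual μ A₀ B₀ i ω)) := by
  have hR := tendsto_regressionMatrix h h₀ hA hB hnd
  have hc : Continuous fun p : Matrix ι ι ℝ × (ι → ℝ) => p.1.mulVec p.2 :=
    continuous_fst.matrix_mulVec continuous_snd
  filter_upwards [ae_all_iff.mpr hA, hB i] with ω h1 h2
  refine h2.sub ?_
  have h3 := (hc.tendsto (_, _)).comp (hR.prodMk_nhds (tendsto_pi_nhds.mpr h1))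
  exact h3.apply_nhds i

/-- Variance and regression matrices depend continuously on the law as long as the limit of `A` is
non-degenerate, so the residuals converge almost surely. The product of their absolute values has
polynomial growth, whence convergence of the expectations. -/
theorem tendsto_kacRiceDensity :
    Tendsto (fun t => kacRiceDensity μ (A t) (B t)) l (𝓝 (kacRiceDensity μ A₀ B₀)) := by
  have hS := tendsto_varMatrix_of_ae (fun t => isCenteredGaussianVector_left (h t))
    (isCenteredGaussianVector_left h₀) hA
  have hW : ∀ t, IsCenteredGaussianVector (regressionResidual μ (A t) (B t)) μ := fun t =>
    isCenteredGaussianVector_right (isCenteredGaussianVector_elim_residual (h t))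
  have hW₀ : IsCenteredGaussianVector (regressionResidual μ A₀ B₀) μ :=
    isCenteredGaussianVector_right (isCenteredGaussianVector_elim_residual h₀)
  have hlim := ae_tendsto_residual h h₀ hA hB hnd
  refine (tendsto_gaussianDensity hS (varMatrix_det_pos (fun i =>
    (isCenteredGaussianVector_left h₀).memLp i (by simp)) hnd) tendsto_const_nhds).mul ?_
  refine tendsto_integral_of_le_gaussian hW hW₀ hlim (C := 1) (n := Fintype.card ι)
    (Eventually.of_forall fun t => ?_) (Eventually.of_forall fun t => ae_of_all _ fun ω => ?_) ?_
  · exact (by fun_prop : Continuous fun x : ι → ℝ => ∏ i, |x i|).comp_aestronglyMeasurable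
      (hW t).gaussian.aemeasurable.aestronglyMeasurable
  · rw [one_mul]
    exact ⟨Finset.prod_nonneg fun i _ => abs_nonneg _, prod_abs_le_one_add_sum _⟩
  · filter_upwards [ae_all_iff.mpr hlim] with ω hω
    exact tendsto_finsetProd _ fun i _ => (hω i).abs

/-- The probability that all the pairs `A i`, `A i + η B i` have opposite signs is equivalent to
`η ^ k` times the Kac--Rice density as `η → 0`. -/
theorem tendsto_measureReal_signChange {η : T → ℝ} (hη : Tendsto η l (𝓝 0))
    (hηpos : ∀ᶠ t in l, 0 < η t) :
    Tendsto (fun t => μ.real {ω | ∀ i, A t i ω * (A t i ω + η t * B t i ω) < 0} /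
      η t ^ Fintype.card ι) l (𝓝 (kacRiceDensity μ A₀ B₀)) := by
  have hS := tendsto_varMatrix_of_ae (fun t => isCenteredGaussianVector_left (h t))
    (isCenteredGaussianVector_left h₀) hA
  have hR := tendsto_regressionMatrix h h₀ hA hB hnd
  have hW : ∀ t, IsCenteredGaussianVector (regressionResidual μ (A t) (B t)) μ := fun t =>
    isCenteredGaussianVector_right (isCenteredGaussianVector_elim_residual (h t))
  have hW₀ : IsCenteredGaussianVector (regressionResidual μ A₀ B₀) μ :=
    isCenteredGaussianVector_right (isCenteredGaussianVector_elim_residual h₀)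
  have hlim := ae_tendsto_residual h h₀ hA hB hnd
  have hdet : 0 < (varMatrix μ A₀).det := varMatrix_det_pos (fun i =>
    (isCenteredGaussianVector_left h₀).memLp i (by simp)) hnd
  have hSp : ∀ t, (varMatrix μ (A t)).PosSemidef := fun t =>
    posSemidef_varMatrix fun i => (isCenteredGaussianVector_left (h t)).memLp i (by simp)
  have hdett : ∀ᶠ t in l, IsNondegenerateVector μ (A t) :=
    ((continuous_id.matrix_det.tendsto _).comp hS).eventually_ne hdet.ne'
  -- The regression matrices converge, hence are bounded, so the step eventually meets the smallness
  -- condition that confines the sign-change sets to balls.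
  have hηR : ∀ᶠ t in l, |η t| * (∑ i, ∑ j, |regressionMatrix μ (A t) (B t) i j|) ≤ 1 / 2 := by
    have h1 : Tendsto (fun t => ∑ i, ∑ j, |regressionMatrix μ (A t) (B t) i j|) l
        (𝓝 (∑ i, ∑ j, |regressionMatrix μ A₀ B₀ i j|)) :=
      tendsto_finsetSum _ fun i _ => tendsto_finsetSum _ fun j _ =>
        ((hR.apply_nhds i).apply_nhds j).abs
    have h2 := hη.abs.mul h1
    simp only [abs_zero, zero_mul] at h2
    filter_upwards [h2.eventually (gt_mem_nhds (by norm_num : (0 : ℝ) < 1 / 2))] with t ht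
    exact ht.le
  have hd0 := tendsto_gaussianDensity hS hdet (tendsto_const_nhds (x := (0 : ι → ℝ)))
  have key : Tendsto (fun t => ∫ ω, (∫ b in signChangeSet (regressionMatrix μ (A t) (B t)) (η t)
      (fun i => regressionResidual μ (A t) (B t) i ω), gaussianDensity (varMatrix μ (A t)) (η t • b)) ∂μ) l
      (𝓝 (∫ ω, gaussianDensity (varMatrix μ A₀) 0 * ∏ i, |regressionResidual μ A₀ B₀ i ω| ∂μ)) := by
    refine tendsto_integral_of_le_gaussian hW hW₀ hlim (n := Fintype.card ι)
      (C := (gaussianDensity (varMatrix μ A₀) 0 + 1) * 4 ^ Fintype.card ι) ?_ ?_ ?_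
    · filter_upwards [hηpos, hdett] with t h1 h2
      exact (measureReal_signChange (h t) h2 h1).1
    · filter_upwards [hηR, hd0.eventually (gt_mem_nhds (lt_add_one _))] with t h1 h2
      refine ae_of_all _ fun ω => ?_
      obtain ⟨g1, g2⟩ := setIntegral_signChangeSet_le (hSp t) h1
        (w := fun i => regressionResidual μ (A t) (B t) i ω)
      refine ⟨g1, g2.trans ?_⟩
      have := gaussianDensity_nonneg hdet.le (0 : ι → ℝ)
      exact mul_le_mul (mul_le_mul_of_nonneg_right h2.le (by positivity))
        (norm_pow_le_one_add_sum _) (by positivity) (by positivity)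
    · filter_upwards [ae_all_iff.mpr hlim] with ω hω
      exact tendsto_setIntegral_signChangeSet hS hSp hdet hR hη hηR (tendsto_pi_nhds.mpr hω)
  rw [integral_const_mul] at key
  refine key.congr' ?_
  filter_upwards [hηpos, hdett] with t h1 h2
  rw [(measureReal_signChange (h t) h2 h1).2, mul_div_cancel_left₀ _ (by positivity)]

end Limit

end KacRice

/-! ### Zeros of Gaussian processes and sign changes -/

section Bulinskaya

variable {Ω : Type*} [MeasurableSpace Ω] {μ : Measure Ω}

/-- Near a degenerate zero `|g s| ≤ η |s - t|`, so a grid point within `1 / (n + 1)` of `t` carries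
a value of size `η / (n + 1)`. That is smaller, by the factor `η`, than the inverse of the number of
grid points. -/
theorem exists_grid_abs_le {g : ℝ → ℝ} {a t η : ℝ} (hη : 0 < η) (ht : t ∈ Set.Icc a (a + 1))
    (h0 : g t = 0) (hd : HasDerivAt g 0 t) :
    ∀ᶠ n : ℕ in atTop, ∃ j ∈ Finset.range (n + 2), |g (a + j / (n + 1))| ≤ η / (n + 1) := by
  have h1 : ∀ᶠ s in 𝓝 t, |g s| ≤ η * |s - t| := by
    have := (hasDerivAt_iff_isLittleO.mp hd).def hη
    filter_upwards [this] with s hs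
    simpa [h0] using hs
  obtain ⟨δ, hδ, hδ'⟩ := Metric.eventually_nhds_iff.mp h1
  have h2 := (tendsto_one_div_add_atTop_nhds_zero_nat (𝕜 := ℝ)).eventually (gt_mem_nhds hδ)
  filter_upwards [h2] with n hn
  have hn0 : (0 : ℝ) < n + 1 := by positivity
  have hta : 0 ≤ t - a := by linarith [ht.1]
  have hpos : 0 ≤ (t - a) * (n + 1) := by positivity
  -- The last grid point to the left of `t`. For `t = a + 1` it has index `n + 1`, hence the `n + 2`
  -- grid points.
  set j := ⌊(t - a) * (n + 1)⌋₊ with hj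
  have hj1 : (j : ℝ) ≤ (t - a) * (n + 1) := Nat.floor_le hpos
  have hj2 : (t - a) * (n + 1) < j + 1 := Nat.lt_floor_add_one _
  have hdist : |a + j / (n + 1) - t| ≤ 1 / (n + 1) := by
    have e : a + j / (n + 1) - t = -(((t - a) * (n + 1) - j) / (n + 1)) := by
      field_simp
      ring
    rw [e, abs_neg, abs_of_nonneg (div_nonneg (by linarith) hn0.le)]
    gcongr
    linarith
  refine ⟨j, Finset.mem_range.mpr ?_, ?_⟩
  · have : (j : ℝ) ≤ n + 1 := hj1.trans (by nlinarith [ht.2])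
    have : j ≤ n + 1 := by exact_mod_cast this
    omega
  · have := hδ' (y := a + j / (n + 1)) (by rw [Real.dist_eq]; exact hdist.trans_lt hn)
    calc |g (a + j / (n + 1))| ≤ η * |a + j / (n + 1) - t| := this
      _ ≤ η * (1 / (n + 1)) := by gcongr
      _ = η / (n + 1) := by rw [mul_one_div]

/-- Almost surely, the zeros of a Gaussian process of class `C¹` are non-degenerate. -/
theorem IsNormalizedStationaryGaussian.ae_deriv_ne_zero [IsProbabilityMeasure μ] {p : ℕ}
    {f : ℝ → Ω → ℝ} (hf : IsNormalizedStationaryGaussian μ p f) (hp : 1 ≤ p) :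
    ∀ᵐ ω ∂μ, ∀ t, f t ω = 0 → deriv (fun s => f s ω) t ≠ 0 := by
  have key : ∀ a : ℝ, μ {ω | ∃ t ∈ Set.Icc a (a + 1), f t ω = 0 ∧
      HasDerivAt (fun s => f s ω) 0 t} = 0 := by
    intro a
    refine le_antisymm (ENNReal.le_of_forall_pos_le_add fun η hη _ => ?_) zero_le
    rw [zero_add]
    -- Each of the `n + 2` events has probability at most `2 c / (n + 1)`, and `2 c (n + 2) / (n +
    -- 1) ≤ 4 c = η`.
    set c : ℝ := η / 4 with hc
    have hcpos : 0 < c := by positivity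
    set E : ℕ → Set Ω := fun n => ⋃ j ∈ Finset.range (n + 2),
      {ω | |f (a + j / (n + 1)) ω| ≤ c / (n + 1)} with hE
    have hEm : ∀ n, μ (E n) ≤ η := fun n => by
      calc μ (E n) ≤ ∑ j ∈ Finset.range (n + 2), μ {ω | |f (a + j / (n + 1)) ω| ≤ c / (n + 1)} :=
            measure_biUnion_finset_le _ _
        _ ≤ ∑ _j ∈ Finset.range (n + 2), ENNReal.ofReal (2 * (c / (n + 1))) :=
            Finset.sum_le_sum fun j _ => hf.measure_abs_le _ _
        _ = ENNReal.ofReal ((n + 2) * (2 * (c / (n + 1)))) := by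
            rw [Finset.sum_const, Finset.card_range, nsmul_eq_mul, ← ENNReal.ofReal_natCast,
              ← ENNReal.ofReal_mul (by positivity)]
            push_cast
            rfl
        _ ≤ ENNReal.ofReal η := by
            refine ENNReal.ofReal_le_ofReal ?_
            rw [hc]
            have : (0 : ℝ) < n + 1 := by positivity
            field_simp
            nlinarith [hη, η.2]
        _ = η := ENNReal.ofReal_coe_nnreal
    -- The exceptional event lies in the lower limit of the events `E n`, and so inherits their
    -- uniform bound by continuity of the measure along increasing unions.
    have hsub : {ω | ∃ t ∈ Set.Icc a (a + 1), f t ω = 0 ∧ HasDerivAt (fun s => f s ω) 0 t} ⊆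
        ⋃ N : ℕ, ⋂ n ≥ N, E n := by
      rintro ω ⟨t, ht, h0, hd⟩
      obtain ⟨N, hN⟩ := eventually_atTop.mp (exists_grid_abs_le hcpos ht h0 hd)
      refine Set.mem_iUnion.mpr ⟨N, Set.mem_iInter₂.mpr fun n hn => ?_⟩
      obtain ⟨j, hj, hj'⟩ := hN n hn
      exact Set.mem_iUnion₂.mpr ⟨j, hj, hj'⟩
    refine (measure_mono hsub).trans ?_
    have hmono : Monotone fun N : ℕ => ⋂ n ≥ N, E n := fun N M hNM =>
      Set.biInter_subset_biInter_left fun n (hn : M ≤ n) => hNM.trans hn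
    rw [hmono.measure_iUnion]
    exact iSup_le fun N => (measure_mono (Set.biInter_subset_of_mem (le_refl N))).trans (hEm N)
  have hall : ∀ᵐ ω ∂μ, ∀ m : ℤ, ¬ ∃ t ∈ Set.Icc (m : ℝ) (m + 1), f t ω = 0 ∧
      HasDerivAt (fun s => f s ω) 0 t :=
    ae_all_iff.mpr fun m => measure_eq_zero_iff_ae_notMem.mp (key m)
  filter_upwards [hall, hf.contDiff] with ω h1 h2 t ht hd
  refine h1 ⌊t⌋ ⟨t, ⟨Int.floor_le t, (Int.lt_floor_add_one t).le⟩, ht, ?_⟩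
  rw [← hd]
  exact ((h2.differentiable (by exact_mod_cast (by omega : p ≠ 0))) t).hasDerivAt

end Bulinskaya

/-! ### Counting simple zeros by sign changes on a grid -/

section Counting

/-- The number of sign changes of `g` on the regular subdivision of `[a, a + L]` into `n + 1`
intervals. -/
def signChangeCount (g : ℝ → ℝ) (a L : ℝ) (n : ℕ) : ℕ :=
  ((Finset.range (n + 1)).filter fun j : ℕ =>
    g (a + j * (L / (n + 1))) * g (a + j * (L / (n + 1)) + L / (n + 1)) < 0).card

/-- The intermediate value theorem puts a zero in the interior of every cell with a sign change, and
distinct cells have disjoint interiors. -/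
theorem signChangeCount_le_encard {g : ℝ → ℝ} (hg : Continuous g) {a L : ℝ} (hL : 0 < L) (n : ℕ) :
    (signChangeCount g a L n : ℕ∞) ≤ ({x | g x = 0} ∩ Set.Icc a (a + L)).encard := by
  set h := L / (n + 1) with hh
  have hpos : 0 < h := by positivity
  set J := (Finset.range (n + 1)).filter fun j : ℕ => g (a + j * h) * g (a + j * h + h) < 0 with hJ
  have hz : ∀ j : ℕ, g (a + j * h) * g (a + j * h + h) < 0 →
      ∃ z ∈ Set.Ioo (a + j * h) (a + j * h + h), g z = 0 := fun j hj => by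
    rcases mul_neg_iff.mp hj with ⟨h1, h2⟩ | ⟨h1, h2⟩
    · obtain ⟨z, hz, hz'⟩ := intermediate_value_Ioo' (by linarith : a + j * h ≤ a + j * h + h)
        hg.continuousOn ⟨h2, h1⟩
      exact ⟨z, hz, hz'⟩
    · obtain ⟨z, hz, hz'⟩ := intermediate_value_Ioo (by linarith : a + j * h ≤ a + j * h + h)
        hg.continuousOn ⟨h1, h2⟩
      exact ⟨z, hz, hz'⟩
  choose! z hz1 hz2 using hz
  have hinj : Set.InjOn z J := fun i hi j hj hij => by
    have hi' := hz1 i (Finset.mem_filter.mp hi).2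
    have hj' := hz1 j (Finset.mem_filter.mp hj).2
    rw [hij] at hi'
    have h1 : (i : ℝ) * h < (j + 1) * h := by linarith [hi'.1, hj'.2]
    have h2 : (j : ℝ) * h < (i + 1) * h := by linarith [hj'.1, hi'.2]
    have h3 : (i : ℝ) < j + 1 := lt_of_mul_lt_mul_right h1 hpos.le
    have h4 : (j : ℝ) < i + 1 := lt_of_mul_lt_mul_right h2 hpos.le
    have h5 : i < j + 1 := by exact_mod_cast h3
    have h6 : j < i + 1 := by exact_mod_cast h4
    omega
  have hcard : (signChangeCount g a L n : ℕ∞) = (z '' J).encard := by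
    rw [hinj.encard_image, Set.encard_coe_eq_coe_finsetCard]
    rfl
  rw [hcard]
  refine Set.encard_le_encard ?_
  rintro _ ⟨j, hj, rfl⟩
  have hj2 := (Finset.mem_filter.mp hj).2
  have hj1 : j + 1 ≤ n + 1 := Finset.mem_range.mp (Finset.mem_filter.mp hj).1
  have hj' := hz1 j hj2
  refine ⟨hz2 j hj2, ?_, ?_⟩
  · have : 0 ≤ (j : ℝ) * h := by positivity
    linarith [hj'.1]
  · have h1 : ((j + 1 : ℕ) : ℝ) ≤ ((n + 1 : ℕ) : ℝ) := by exact_mod_cast hj1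
    push_cast at h1
    have h2 : ((j : ℝ) + 1) * h ≤ (n + 1) * h := by gcongr
    have h3 : ((n : ℝ) + 1) * h = L := by rw [hh]; field_simp
    linarith [hj'.2]

/-- Close to `z`, the slope has the sign of `c`, so `c * g s` has the sign of `s - z`. -/
theorem exists_sign_change_of_deriv_ne_zero {g : ℝ → ℝ} {z c : ℝ} (hg : HasDerivAt g c z)
    (hz : g z = 0) (hc : c ≠ 0) :
    ∃ δ > 0, ∀ s s', z - δ < s → s < z → z < s' → s' < z + δ → g s * g s' < 0 := by
  have h1 : Tendsto (fun s => c * slope g z s) (𝓝[≠] z) (𝓝 (c * c)) :=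
    (hasDerivAt_iff_tendsto_slope.mp hg).const_mul c
  have h2 := h1.eventually (lt_mem_nhds (mul_self_pos.mpr hc))
  rw [eventually_nhdsWithin_iff] at h2
  obtain ⟨δ, hδ, h3⟩ := Metric.eventually_nhds_iff.mp h2
  refine ⟨δ, hδ, fun s s' hs1 hs2 hs3 hs4 => ?_⟩
  have e1 := h3 (y := s) (by rw [Real.dist_eq, abs_lt]; constructor <;> linarith) hs2.ne
  have e2 := h3 (y := s') (by rw [Real.dist_eq, abs_lt]; constructor <;> linarith) hs3.ne'
  rw [slope_def_field, hz, sub_zero] at e1 e2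
  have f1 : c * g s < 0 := by
    have : c * g s = (c * (g s / (s - z))) * (s - z) := by
      field_simp [sub_ne_zero.mpr hs2.ne]
    rw [this]
    exact mul_neg_of_pos_of_neg e1 (by linarith)
  have f2 : 0 < c * g s' := by
    have : c * g s' = (c * (g s' / (s' - z))) * (s' - z) := by
      field_simp [sub_ne_zero.mpr hs3.ne']
    rw [this]
    exact mul_pos e2 (by linarith)
  by_contra hcon
  have := mul_nonneg (mul_self_nonneg c) (not_lt.mp hcon)
  nlinarith [mul_neg_of_neg_of_pos f1 f2]

/-- Finitely many zeros fall into distinct cells of a fine grid. They lie in the interiors because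
no grid point is a zero, and being simple they each produce a sign change. Working with a finite `m`
avoids assuming that the zero set is finite. -/
theorem eventually_le_signChangeCount {g : ℝ → ℝ} (hg : Differentiable ℝ g)
    (hz : ∀ t, g t = 0 → deriv g t ≠ 0) {a L : ℝ} (hL : 0 < L)
    (hgrid : ∀ n j : ℕ, g (a + j * (L / (n + 1))) ≠ 0) {m : ℕ}
    (hm : (m : ℕ∞) ≤ ({x | g x = 0} ∩ Set.Icc a (a + L)).encard) :
    ∀ᶠ n : ℕ in atTop, m ≤ signChangeCount g a L n := by
  obtain ⟨F, hFsub, hFcard⟩ := Set.exists_subset_encard_eq hm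
  have hFfin : F.Finite := Set.finite_of_encard_eq_coe hFcard
  lift F to Finset ℝ using hFfin
  rw [Set.encard_coe_eq_coe_finsetCard] at hFcard
  have hFm : F.card = m := by exact_mod_cast hFcard
  have hstep : Tendsto (fun n : ℕ => L / ((n : ℝ) + 1)) atTop (𝓝 0) := by
    have := (tendsto_one_div_add_atTop_nhds_zero_nat (𝕜 := ℝ)).const_mul L
    simpa [div_eq_mul_inv] using this
  have hsign : ∀ z ∈ F, ∀ᶠ n : ℕ in atTop, ∀ s s', z - L / (n + 1) < s → s < z → z < s' →
      s' ≤ z + L / (n + 1) → g s * g s' < 0 := fun z hzF => by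
    have hz0 : g z = 0 := (hFsub hzF).1
    obtain ⟨δ, hδ, h⟩ := exists_sign_change_of_deriv_ne_zero (hg z).hasDerivAt hz0 (hz z hz0)
    filter_upwards [hstep.eventually (gt_mem_nhds hδ)] with n hn s s' h1 h2 h3 h4
    exact h s s' (by linarith) h2 h3 (by linarith)
  have hgap : ∀ z ∈ F, ∀ w ∈ F, ∀ᶠ n : ℕ in atTop, z ≠ w → L / ((n : ℝ) + 1) < |z - w| :=
    fun z _ w _ => by
      by_cases hzw : z = w
      · exact Eventually.of_forall fun n h => absurd hzw h
      · filter_upwards [hstep.eventually (gt_mem_nhds (abs_pos.mpr (sub_ne_zero.mpr hzw)))]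
          with n hn _ using hn
  filter_upwards [(Finset.eventually_all F).mpr hsign,
    (Finset.eventually_all F).mpr fun z hz => (Finset.eventually_all F).mpr (hgap z hz)]
    with n h1 h2
  set h := L / ((n : ℝ) + 1) with hh
  have hpos : 0 < h := by positivity
  have hLh : ((n : ℝ) + 1) * h = L := by rw [hh]; field_simp
  have hfl : ∀ z ∈ F, a + ⌊(z - a) / h⌋₊ * h < z ∧ z < a + ⌊(z - a) / h⌋₊ * h + h := fun z hzF => by
    have hza : 0 ≤ (z - a) / h := div_nonneg (by linarith [(hFsub hzF).2.1]) hpos.le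
    have g1 : (⌊(z - a) / h⌋₊ : ℝ) * h ≤ z - a := (le_div_iff₀ hpos).mp (Nat.floor_le hza)
    have g2 : z - a < (⌊(z - a) / h⌋₊ + 1 : ℝ) * h := (div_lt_iff₀ hpos).mp (Nat.lt_floor_add_one _)
    refine ⟨lt_of_le_of_ne (by linarith) fun heq => ?_, by linarith⟩
    exact hgrid n _ (by rw [← hh, heq]; exact (hFsub hzF).1)
  rw [← hFm]
  refine Finset.card_le_card_of_injOn (fun z => ⌊(z - a) / h⌋₊) (fun z hzF => ?_) ?_
  · obtain ⟨g1, g2⟩ := hfl z hzF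
    simp only [Finset.coe_filter, Finset.mem_range, Set.mem_ofPred]
    constructor
    -- The right endpoint `a + L` is the grid point of index `n + 1`, so it is not a zero; this
    -- keeps the cell index at most `n`.
    · have hzL : z < a + L := by
        refine lt_of_le_of_ne (hFsub hzF).2.2 fun heq => ?_
        have := hgrid n (n + 1)
        push_cast at this
        rw [← hh, hLh, ← heq] at this
        exact this (hFsub hzF).1
      have : (⌊(z - a) / h⌋₊ : ℝ) * h < (n + 1) * h := by linarith
      have := lt_of_mul_lt_mul_right this hpos.le
      exact_mod_cast this
    · exact h1 z hzF _ _ (by linarith) g1 g2 (by linarith)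
  · intro z hzF w hwF hzw
    by_contra hne
    have g1 := hfl z hzF
    have g2 := hfl w hwF
    simp only at hzw
    rw [hzw] at g1
    have := h2 z hzF w hwF hne
    rw [lt_abs] at this
    rcases this with h3 | h3 <;> linarith [g1.1, g1.2, g2.1, g2.2]

theorem tendsto_signChangeCount {g : ℝ → ℝ} (hg : Differentiable ℝ g)
    (hz : ∀ t, g t = 0 → deriv g t ≠ 0) {a L : ℝ} (hL : 0 < L)
    (hgrid : ∀ n j : ℕ, g (a + j * (L / (n + 1))) ≠ 0) :
    Tendsto (fun n => (signChangeCount g a L n : ℝ≥0∞)) atTop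
      (𝓝 (({x | g x = 0} ∩ Set.Icc a (a + L)).encard : ℝ≥0∞)) := by
  set N := ({x | g x = 0} ∩ Set.Icc a (a + L)).encard with hN
  have hle : ∀ n, (signChangeCount g a L n : ℝ≥0∞) ≤ (N : ℝ≥0∞) := fun n => by
    have := ENat.toENNReal_le.mpr (signChangeCount_le_encard hg.continuous hL n (a := a))
    simpa using this
  refine tendsto_order.mpr ⟨fun b hb => ?_, fun b hb => Eventually.of_forall fun n =>
    (hle n).trans_lt hb⟩
  obtain ⟨m, hm1, hm2⟩ : ∃ m : ℕ, (m : ℕ∞) ≤ N ∧ b < (m : ℝ≥0∞) := by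
    rcases eq_or_ne N ⊤ with hT | hT
    · obtain ⟨m, hm⟩ := ENNReal.exists_nat_gt hb.ne_top
      exact ⟨m, by simp [hT], hm⟩
    · obtain ⟨m, hm⟩ := ENat.ne_top_iff_exists.mp hT
      exact ⟨m, hm.le, by simpa [← hm] using hb⟩
  filter_upwards [eventually_le_signChangeCount hg hz hL hgrid hm1] with n hn
  exact hm2.trans_le (by exact_mod_cast hn)

/-- Multiplication on `[0, ∞]` is discontinuous at `(0, ∞)`. If some limit is `0`, the upper bound
makes the corresponding factors, hence the products, identically `0`; otherwise multiplication is
continuous at the limits. -/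
theorem tendsto_prod_of_le {ι : Type*} [Fintype ι] {u : ℕ → ι → ℝ≥0∞} {v : ι → ℝ≥0∞}
    (hle : ∀ n i, u n i ≤ v i) (hlim : ∀ i, Tendsto (fun n => u n i) atTop (𝓝 (v i))) :
    Tendsto (fun n => ∏ i, u n i) atTop (𝓝 (∏ i, v i)) := by
  classical
  by_cases h0 : ∃ i, v i = 0
  · obtain ⟨i, hi⟩ := h0
    have h1 : ∀ n, ∏ i, u n i = 0 := fun n =>
      Finset.prod_eq_zero (Finset.mem_univ i) (le_zero_iff.mp (hi ▸ hle n i))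
    simp only [h1, Finset.prod_eq_zero (Finset.mem_univ i) hi]
    exact tendsto_const_nhds
  · push Not at h0
    have : ∀ s : Finset ι, Tendsto (fun n => ∏ i ∈ s, u n i) atTop (𝓝 (∏ i ∈ s, v i)) := by
      intro s
      induction s using Finset.induction_on with
      | empty => simp
      | insert i s hi IH =>
        simp only [Finset.prod_insert hi]
        exact ENNReal.Tendsto.mul (hlim i) (Or.inl (h0 i)) IH
          (Or.inl (Finset.prod_ne_zero_iff.mpr fun j _ => h0 j))
    exact this Finset.univ

end Counting

/-! ### The `k`-point function at points with a non-degenerate vector of values -/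

section KPoint

variable {Ω : Type*} [MeasurableSpace Ω] {μ : Measure Ω}

/-- Strict differentiability allows the base point to move together with the step. -/
theorem tendsto_difference_quotient {g : ℝ → ℝ} {g' x : ℝ} (hg : HasStrictDerivAt g g' x)
    {T : Type*} {l : Filter T} {s h : T → ℝ} (hs : Tendsto s l (𝓝 x)) (hh : Tendsto h l (𝓝 0))
    (hne : ∀ᶠ t in l, h t ≠ 0) :
    Tendsto (fun t => (h t)⁻¹ * (g (s t + h t) - g (s t))) l (𝓝 g') := by
  have h1 : Tendsto (fun t => (s t + h t, s t)) l (𝓝 (x, x)) := by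
    have := hs.add hh
    rw [add_zero] at this
    exact this.prodMk_nhds hs
  have h2 := (hg.hasStrictFDerivAt.isLittleO.comp_tendsto h1).tendsto_div_nhds_zero
  have h3 := h2.add_const g'
  rw [zero_add] at h3
  refine h3.congr' ?_
  filter_upwards [hne] with t ht
  simp only [Function.comp_apply, add_sub_cancel_left, ContinuousLinearMap.toSpanSingleton_apply,
    smul_eq_mul]
  field_simp
  ring

/-- The probability that `f` changes sign between `s i` and `s i + h` for all `i`. -/
def signChangeProb {k : ℕ} (μ : Measure Ω) (f : ℝ → Ω → ℝ) (s : Fin k → ℝ) (h : ℝ) : ℝ :=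
  μ.real {ω | ∀ i, f (s i) ω * f (s i + h) ω < 0}

/-- With `A = f (s)` and `B = (f (s + h) - f (s)) / h` one has `A + h B = f (s + h)`. The limit is
taken jointly in `s` and `h`, so that it is uniform over the cells of all grids near `x`. -/
theorem IsNormalizedStationaryGaussian.tendsto_signChangeProb [IsProbabilityMeasure μ] {p k : ℕ}
    {f : ℝ → Ω → ℝ} (hf : IsNormalizedStationaryGaussian μ p f) (hp : 1 ≤ p) (x : Fin k → ℝ)
    (hnd : IsNondegenerateVector μ fun i => f (x i)) :
    Tendsto (fun t : (Fin k → ℝ) × ℝ => signChangeProb μ f t.1 t.2 / t.2 ^ k)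
      (𝓝 x ×ˢ 𝓝[>] 0)
      (𝓝 (kacRiceDensity μ (fun i => f (x i)) fun i => processDeriv f 1 (x i))) := by
  set A : (Fin k → ℝ) × ℝ → Fin k → Ω → ℝ := fun t i => f (t.1 i)
  set B : (Fin k → ℝ) × ℝ → Fin k → Ω → ℝ := fun t i ω =>
    t.2⁻¹ * (f (t.1 i + t.2) ω - f (t.1 i) ω)
  have hAB : ∀ t, IsCenteredGaussianVector (Sum.elim (A t) (B t)) μ := fun t => by
    have h1 := (hf.isCenteredGaussianVector
      (Sum.elim t.1 fun i => t.1 i + t.2 : Fin k ⊕ Fin k → ℝ)).mulMatrix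
      (Matrix.fromBlocks (1 : Matrix (Fin k) (Fin k) ℝ) 0
        ((-t.2⁻¹) • (1 : Matrix (Fin k) (Fin k) ℝ)) (t.2⁻¹ • (1 : Matrix (Fin k) (Fin k) ℝ)))
    refine h1.congr fun c => ae_of_all _ fun ω => ?_
    rcases c with i | i
    · simp [linComb, Matrix.one_apply, A]
    · simp [linComb, Matrix.one_apply, B]
      ring
  have hAB₀ : IsCenteredGaussianVector
      (Sum.elim (fun i => f (x i)) fun i => processDeriv f 1 (x i)) μ := by
    have h1 := hf.isCenteredGaussianVector_processDeriv
      (Sum.elim (fun _ => 0) fun _ => 1 : Fin k ⊕ Fin k → ℕ) (Sum.elim x x)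
      (by rintro (i | i) <;> simp [hp])
    refine h1.congr fun c => ae_of_all _ fun ω => ?_
    rcases c with i | i <;> simp [processDeriv]
  have hs : ∀ i, Tendsto (fun t : (Fin k → ℝ) × ℝ => t.1 i) (𝓝 x ×ˢ 𝓝[>] 0) (𝓝 (x i)) :=
    fun i => (tendsto_fst (f := 𝓝 x)).apply_nhds i
  have hη' : Tendsto (fun t : (Fin k → ℝ) × ℝ => t.2) (𝓝 x ×ˢ 𝓝[>] 0) (𝓝[>] 0) := tendsto_snd
  have hη : Tendsto (fun t : (Fin k → ℝ) × ℝ => t.2) (𝓝 x ×ˢ 𝓝[>] 0) (𝓝 0) :=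
    hη'.mono_right inf_le_left
  have hpos : ∀ᶠ t : (Fin k → ℝ) × ℝ in 𝓝 x ×ˢ 𝓝[>] 0, 0 < t.2 :=
    hη'.eventually self_mem_nhdsWithin
  have hA : ∀ i, ∀ᵐ ω ∂μ, Tendsto (fun t => A t i ω) (𝓝 x ×ˢ 𝓝[>] 0) (𝓝 (f (x i) ω)) := fun i => by
    filter_upwards [hf.contDiff] with ω hω
    exact (hω.continuous.tendsto (x i)).comp (hs i)
  have hB : ∀ i, ∀ᵐ ω ∂μ,
      Tendsto (fun t => B t i ω) (𝓝 x ×ˢ 𝓝[>] 0) (𝓝 (processDeriv f 1 (x i) ω)) := fun i => by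
    filter_upwards [hf.contDiff] with ω hω
    have h1 : HasStrictDerivAt (fun t => f t ω) (deriv (fun t => f t ω) (x i)) (x i) :=
      hω.contDiffAt.hasStrictDerivAt (by exact_mod_cast (by omega : p ≠ 0))
    rw [processDeriv, iteratedDeriv_one]
    exact tendsto_difference_quotient h1 (hs i) hη (hpos.mono fun t ht => ht.ne')
  have := tendsto_measureReal_signChange hAB hAB₀ hA hB hnd hη hpos
  refine this.congr' ?_
  filter_upwards [hpos] with t ht
  rw [Fintype.card_fin, signChangeProb]
  congr 2
  refine congrArg _ (Set.ext fun ω => forall_congr' fun i => ?_)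
  simp only [A, B]
  rw [mul_inv_cancel_left₀ ht.ne', add_sub_cancel]

theorem measurable_signChangeCount {f : ℝ → Ω → ℝ} (hf : ∀ x, Measurable (f x)) (a L : ℝ) (n : ℕ) :
    Measurable fun ω => (signChangeCount (fun t => f t ω) a L n : ℝ≥0∞) := by
  simp only [signChangeCount, Finset.card_filter, Nat.cast_sum, Nat.cast_ite, Nat.cast_one,
    Nat.cast_zero]
  refine Finset.measurable_sum _ fun j _ => Measurable.ite ?_ measurable_const measurable_const
  exact measurableSet_lt ((hf _).mul (hf _)) measurable_const

/-- Each count is a sum of indicators over cells; expanding the product gives one joint sign-change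
event for each choice of a cell around every point. -/
theorem lintegral_prod_signChangeCount [IsProbabilityMeasure μ] {f : ℝ → Ω → ℝ} {k : ℕ}
    (hf : ∀ x, Measurable (f x)) (a : Fin k → ℝ) (L : ℝ) (n : ℕ) :
    ∫⁻ ω, ∏ i, (signChangeCount (fun t => f t ω) (a i) L n : ℝ≥0∞) ∂μ =
      ∑ j ∈ Fintype.piFinset fun _ : Fin k => Finset.range (n + 1),
        ENNReal.ofReal (signChangeProb μ f (fun i => a i + j i * (L / (n + 1))) (L / (n + 1))) := by
  set h := L / (n + 1) with hh
  have hS : ∀ (j : Fin k → ℕ), MeasurableSet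
      {ω | ∀ i, f (a i + j i * h) ω * f (a i + j i * h + h) ω < 0} := fun j => by
    rw [Set.ofPred_forall]
    exact MeasurableSet.iInter fun i => measurableSet_lt ((hf _).mul (hf _)) measurable_const
  have e : ∀ ω, ∏ i, (signChangeCount (fun t => f t ω) (a i) L n : ℝ≥0∞) =
      ∑ j ∈ Fintype.piFinset fun _ : Fin k => Finset.range (n + 1),
        {ω | ∀ i, f (a i + j i * h) ω * f (a i + j i * h + h) ω < 0}.indicator 1 ω := fun ω => by
    simp only [signChangeCount, Finset.card_filter, Nat.cast_sum, Nat.cast_ite, Nat.cast_one,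
      Nat.cast_zero, ← hh]
    rw [Finset.prod_univ_sum]
    refine Finset.sum_congr rfl fun j _ => ?_
    simp only [Set.indicator_apply, Set.mem_ofPred, Pi.one_apply]
    by_cases hj : ∀ i, f (a i + j i * h) ω * f (a i + j i * h + h) ω < 0
    · simp [hj]
    · rw [if_neg hj]
      obtain ⟨i, hi⟩ := not_forall.mp hj
      exact Finset.prod_eq_zero (Finset.mem_univ i) (if_neg hi)
  simp only [e]
  rw [lintegral_finsetSum _ fun j _ => measurable_one.indicator (hS j)]
  refine Finset.sum_congr rfl fun j _ => ?_
  rw [lintegral_indicator_one (hS j), signChangeProb, ofReal_measureReal]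

theorem ENNReal.tendsto_ofReal_of_forall {T : Type*} {l : Filter T} {X : T → ℝ≥0∞} {r : ℝ}
    (hr : 0 ≤ r) (h : ∀ η > 0, ∀ᶠ t in l, ENNReal.ofReal (r - η) ≤ X t ∧
      X t ≤ ENNReal.ofReal (r + η)) : Tendsto X l (𝓝 (ENNReal.ofReal r)) := by
  have hfin : ∀ᶠ t in l, ENNReal.ofReal (X t).toReal = X t := by
    filter_upwards [h 1 one_pos] with t ht
    exact ENNReal.ofReal_toReal (ht.2.trans_lt ENNReal.ofReal_lt_top).ne
  refine Tendsto.congr' hfin (ENNReal.tendsto_ofReal (Metric.tendsto_nhds.mpr fun ε hε => ?_))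
  filter_upwards [h (ε / 2) (by positivity)] with t ht
  have h1 := ENNReal.toReal_mono ENNReal.ofReal_ne_top ht.2
  have h2 := ENNReal.toReal_mono (ht.2.trans_lt ENNReal.ofReal_lt_top).ne ht.1
  rw [ENNReal.toReal_ofReal (by positivity)] at h1
  have h3 : r - ε / 2 ≤ (X t).toReal := (Real.le_coe_toNNReal _).trans h2
  rw [Real.dist_eq, abs_lt]
  constructor <;> linarith

/-- The `k`-point function of the zero set is given by the Kac--Rice density. -/
theorem IsNormalizedStationaryGaussian.hasKPointFunctionAt [IsProbabilityMeasure μ] {p k : ℕ}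
    {f : ℝ → Ω → ℝ} (hf : IsNormalizedStationaryGaussian μ p f) (hp : 1 ≤ p) (x : Fin k → ℝ)
    (hnd : IsNondegenerateVector μ fun i => f (x i)) :
    HasKPointFunctionAt μ (zeroSet f) x
      (kacRiceDensity μ (fun i => f (x i)) fun i => processDeriv f 1 (x i)) := by
  set r := kacRiceDensity μ (fun i => f (x i)) fun i => processDeriv f 1 (x i) with hr
  have hr0 : 0 ≤ r := by
    refine mul_nonneg (gaussianDensity_nonneg (posSemidef_varMatrix fun i =>
      (hf.isCenteredGaussianVector x).memLp i (by simp)).det_nonneg _)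
      (integral_nonneg fun ω => Finset.prod_nonneg fun i _ => abs_nonneg _)
  have hgood : ∀ᵐ ω ∂μ, Differentiable ℝ (fun t => f t ω) ∧
      ∀ t, f t ω = 0 → deriv (fun s => f s ω) t ≠ 0 := by
    filter_upwards [hf.contDiff, hf.ae_deriv_ne_zero hp] with ω h1 h2
    exact ⟨h1.differentiable (by exact_mod_cast (by omega : p ≠ 0)), h2⟩
  have hle : ∀ᵐ ω ∂μ, ∀ ε : ℝ, 0 < ε → ∀ (n : ℕ) (i : Fin k),
      (signChangeCount (fun t => f t ω) (x i - ε) (2 * ε) n : ℝ≥0∞) ≤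
        ((zeroSet f ω ∩ Set.Icc (x i - ε) (x i + ε)).encard : ℝ≥0∞) := by
    filter_upwards [hgood] with ω hω ε hε n i
    have h1 := ENat.toENNReal_le.mpr (signChangeCount_le_encard hω.1.continuous
      (by positivity : 0 < 2 * ε) n (a := x i - ε))
    rw [show x i - ε + 2 * ε = x i + ε by ring] at h1
    simpa [zeroSet] using h1
  have hlim : ∀ ε : ℝ, 0 < ε → ∀ i : Fin k, ∀ᵐ ω ∂μ,
      Tendsto (fun n => (signChangeCount (fun t => f t ω) (x i - ε) (2 * ε) n : ℝ≥0∞)) atTop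
        (𝓝 ((zeroSet f ω ∩ Set.Icc (x i - ε) (x i + ε)).encard : ℝ≥0∞)) := by
    intro ε hε i
    have hgrid : ∀ᵐ ω ∂μ, ∀ n j : ℕ, f (x i - ε + j * (2 * ε / (n + 1))) ω ≠ 0 :=
      ae_all_iff.mpr fun n => ae_all_iff.mpr fun j => hf.ae_ne_zero _
    filter_upwards [hgood, hgrid] with ω hω h1
    have h2 := tendsto_signChangeCount hω.1 hω.2 (by positivity : 0 < 2 * ε) h1
    rw [show x i - ε + 2 * ε = x i + ε by ring] at h2
    exact h2
  have hprod : ∀ ε : ℝ, 0 < ε → ∀ᵐ ω ∂μ, Tendsto (fun n =>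
      ∏ i, (signChangeCount (fun t => f t ω) (x i - ε) (2 * ε) n : ℝ≥0∞)) atTop
        (𝓝 (cardProd (zeroSet f ω) x ε)) := by
    intro ε hε
    filter_upwards [hle, ae_all_iff.mpr (hlim ε hε)] with ω h1 h2
    exact tendsto_prod_of_le (fun n i => h1 ε hε n i) h2
  have hmeas : ∀ (ε : ℝ) (n : ℕ), Measurable fun ω =>
      ∏ i, (signChangeCount (fun t => f t ω) (x i - ε) (2 * ε) n : ℝ≥0∞) := fun ε n =>
    Finset.measurable_prod _ fun i _ => measurable_signChangeCount hf.measurable _ _ _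
  refine ⟨hr0, ?_, ?_⟩
  · filter_upwards [self_mem_nhdsWithin] with ε hε
    exact aemeasurable_of_tendsto_metrizable_ae atTop (fun n => (hmeas ε n).aemeasurable)
      (hprod ε hε)
  refine ENNReal.tendsto_ofReal_of_forall hr0 fun η hη => ?_
  have hF := hf.tendsto_signChangeProb hp x hnd
  rw [← hr] at hF
  -- The joint limit gives a box of base points and steps on which the normalized probability is
  -- within `η` of `r`. Below, `ε < δ` keeps all base points in it, and `2 * ε < δ'` does the same
  -- for the steps of every grid.
  obtain ⟨U, hU, V, hV, hUV⟩ := Filter.mem_prod_iff.mp (Metric.tendsto_nhds.mp hF η hη)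
  obtain ⟨δ, hδ, hδU⟩ := Metric.mem_nhds_iff.mp hU
  obtain ⟨δ', hδ', hδV⟩ := mem_nhdsGT_iff_exists_Ioo_subset.mp hV
  have hεlt : ∀ᶠ ε in 𝓝[>] (0 : ℝ), ε < min δ (δ' / 2) :=
    (gt_mem_nhds (lt_min hδ (half_pos hδ'))).filter_mono inf_le_left
  filter_upwards [hεlt, self_mem_nhdsWithin] with ε hε (hε0 : 0 < ε)
  have hprob : ∀ n : ℕ, ∀ j ∈ Fintype.piFinset fun _ : Fin k => Finset.range (n + 1),
      |signChangeProb μ f (fun i => x i - ε + j i * (2 * ε / (n + 1))) (2 * ε / (n + 1)) /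
        (2 * ε / (n + 1)) ^ k - r| < η := fun n j hj => by
    have hn : (0 : ℝ) < n + 1 := by positivity
    have hU' : (fun i => x i - ε + j i * (2 * ε / (n + 1))) ∈ U := by
      refine hδU (lt_of_le_of_lt ((dist_pi_le_iff hε0.le).mpr fun i => ?_)
        (hε.trans_le (min_le_left _ _)))
      have h1 : (j i : ℝ) ≤ n + 1 := by
        have := Finset.mem_range.mp (Fintype.mem_piFinset.mp hj i)
        exact_mod_cast this.le
      have h2 : (j i : ℝ) * (2 * ε / (n + 1)) ≤ 2 * ε := by
        rw [mul_div_assoc', div_le_iff₀ hn]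
        nlinarith
      have h3 : 0 ≤ (j i : ℝ) * (2 * ε / (n + 1)) := by positivity
      rw [Real.dist_eq, abs_le]
      constructor <;> linarith
    have hV' : 2 * ε / (n + 1) ∈ V := by
      refine hδV ⟨by positivity, ?_⟩
      have h1 : 2 * ε / ((n : ℝ) + 1) ≤ 2 * ε := div_le_self (by positivity) (by linarith)
      linarith [hε.trans_le (min_le_right _ _)]
    have := hUV (Set.mk_mem_prod hU' hV')
    rwa [Set.mem_ofPred, Real.dist_eq] at this
  have hpk : ∀ n : ℕ, ((n : ℝ) + 1) ^ k * (2 * ε / (n + 1)) ^ k = (2 * ε) ^ k := fun n => by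
    rw [← mul_pow]
    congr 1
    field_simp
  have hpos : 0 < (2 * ε) ^ k := by positivity
  constructor
  · rw [ENNReal.le_div_iff_mul_le (Or.inl (by simpa using hpos)) (Or.inl ENNReal.ofReal_ne_top)]
    -- Lower bound: sign changes undercount zeros, so the grid with a single cell, `n = 0`, is
    -- enough.
    have h1 : ∫⁻ ω, ∏ i, (signChangeCount (fun t => f t ω) (x i - ε) (2 * ε) 0 : ℝ≥0∞) ∂μ ≤
        ∫⁻ ω, cardProd (zeroSet f ω) x ε ∂μ := by
      refine lintegral_mono_ae ?_
      filter_upwards [hle] with ω h1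
      exact Finset.prod_le_prod' fun i _ => h1 ε hε0 0 i
    refine le_trans ?_ h1
    rw [lintegral_prod_signChangeCount hf.measurable]
    have hj : (fun _ => (0 : ℕ)) ∈ Fintype.piFinset fun _ : Fin k => Finset.range (0 + 1) := by simp
    refine le_trans ?_ (Finset.single_le_sum (fun _ _ => zero_le) hj)
    rw [← ENNReal.ofReal_mul' hpos.le]
    refine ENNReal.ofReal_le_ofReal ?_
    have h2 := (abs_lt.mp (hprob 0 _ hj)).1
    have h3 : (2 * ε / (((0 : ℕ) : ℝ) + 1)) = 2 * ε := by simp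
    rw [h3] at h2 ⊢
    have h4 := (lt_div_iff₀ hpos).mp (lt_sub_iff_add_lt.mp h2)
    rw [neg_add_eq_sub] at h4
    exact h4.le
  · refine ENNReal.div_le_of_le_mul ?_
    -- Upper bound: there are `(n + 1) ^ k` choices of cells, each of probability at most `(r + η)
    -- (2 ε / (n + 1)) ^ k`, so the total does not depend on `n`. Fatou's lemma carries the bound
    -- over to the number of zeros.
    have h1 : ∀ n : ℕ,
        ∫⁻ ω, ∏ i, (signChangeCount (fun t => f t ω) (x i - ε) (2 * ε) n : ℝ≥0∞) ∂μ ≤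
        ENNReal.ofReal (r + η) * ENNReal.ofReal ((2 * ε) ^ k) := fun n => by
      rw [lintegral_prod_signChangeCount hf.measurable]
      have hhk : 0 < (2 * ε / ((n : ℝ) + 1)) ^ k := by positivity
      calc _ ≤ ∑ _j ∈ Fintype.piFinset fun _ : Fin k => Finset.range (n + 1),
            ENNReal.ofReal ((r + η) * (2 * ε / (n + 1)) ^ k) := by
              refine Finset.sum_le_sum fun j hj => ENNReal.ofReal_le_ofReal ?_
              have h2 := (abs_lt.mp (hprob n j hj)).2
              rw [add_comm r η]
              exact ((div_lt_iff₀ hhk).mp (sub_lt_iff_lt_add.mp h2)).le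
        _ = ENNReal.ofReal (r + η) * ENNReal.ofReal ((2 * ε) ^ k) := by
              rw [Finset.sum_const, Fintype.card_piFinset, Finset.prod_const, Finset.card_range,
                Finset.card_univ, Fintype.card_fin, nsmul_eq_mul, ← ENNReal.ofReal_natCast,
                ← ENNReal.ofReal_mul (by positivity), ← ENNReal.ofReal_mul (by positivity), ← hpk n]
              push_cast
              congr 1
              ring
    calc ∫⁻ ω, cardProd (zeroSet f ω) x ε ∂μ
        = ∫⁻ ω, liminf (fun n =>
            ∏ i, (signChangeCount (fun t => f t ω) (x i - ε) (2 * ε) n : ℝ≥0∞)) atTop ∂μ := by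
          refine lintegral_congr_ae ?_
          filter_upwards [hprod ε hε0] with ω hω
          exact hω.liminf_eq.symm
      _ ≤ liminf (fun n => ∫⁻ ω,
            ∏ i, (signChangeCount (fun t => f t ω) (x i - ε) (2 * ε) n : ℝ≥0∞) ∂μ) atTop :=
          lintegral_liminf_le (hmeas ε)
      _ ≤ liminf (fun _ : ℕ => ENNReal.ofReal (r + η) * ENNReal.ofReal ((2 * ε) ^ k)) atTop :=
          liminf_le_liminf (Eventually.of_forall h1)
      _ = _ := liminf_const _

end KPoint

/-! ### Linear transformations of the Kac--Rice density -/

section Transformation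

variable {Ω : Type*} [MeasurableSpace Ω] {μ : Measure Ω} {ι : Type*} [Fintype ι] [DecidableEq ι]
  {A B A' B' : ι → Ω → ℝ}

theorem det_varMatrix_linComb [IsProbabilityMeasure μ] (hA : ∀ i, MemLp (A i) 2 μ)
    (M : Matrix ι ι ℝ) :
    (varMatrix μ (linComb M A)).det = M.det ^ 2 * (varMatrix μ A).det := by
  rw [varMatrix_linComb hA, Matrix.det_mul, Matrix.det_mul, Matrix.det_transpose]
  ring

/-- Regressing on `M A` with `M` invertible is the same as regressing on `A`, and a term `N A` is
entirely explained by `A`. Only the scaling by `d` survives. -/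
theorem regressionResidual_linComb [IsProbabilityMeasure μ]
    (hA : ∀ i, MemLp (A i) 2 μ) (hB : ∀ i, MemLp (B i) 2 μ) (hnd : IsNondegenerateVector μ A)
    {M N : Matrix ι ι ℝ} (hM : M.det ≠ 0) (d : ι → ℝ) (i : ι) (ω : Ω) :
    regressionResidual μ (linComb M A) (fun i ω => d i * B i ω + linComb N A i ω) i ω =
      d i * regressionResidual μ A B i ω := by
  have hS : IsUnit (varMatrix μ A).det := isUnit_iff_ne_zero.mpr hnd
  have hMu : IsUnit M.det := isUnit_iff_ne_zero.mpr hM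
  have hMu' : IsUnit M.transpose.det := by rwa [Matrix.det_transpose]
  have hNA : ∀ i, MemLp (linComb N A i) 2 μ := fun j =>
    memLp_finsetSum _ fun i _ => (hA i).const_mul _
  have hB' : ∀ i, MemLp (fun ω => d i * B i ω + linComb N A i ω) 2 μ := fun i =>
    ((hB i).const_mul _).add (hNA i)
  have hcov : covMatrix μ (fun i ω => d i * B i ω + linComb N A i ω) A =
      Matrix.diagonal d * covMatrix μ B A + N * varMatrix μ A := by
    rw [varMatrix, ← covMatrix_linComb_left hA hA]
    ext i j
    simp only [covMatrix, Matrix.of_apply, Matrix.add_apply, Matrix.diagonal_mul]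
    rw [← covariance_const_mul_left]
    exact covariance_add_left ((hB i).const_mul _) (hNA i) (hA j)
  -- Multiplied by `M` on the right, because the regression matrix is applied to `M A`.
  have hreg : regressionMatrix μ (linComb M A) (fun i ω => d i * B i ω + linComb N A i ω) * M =
      Matrix.diagonal d * regressionMatrix μ A B + N := by
    rw [regressionMatrix, covMatrix_linComb_right hA hB', hcov, varMatrix_linComb hA,
      Matrix.mul_inv_rev, Matrix.mul_inv_rev, regressionMatrix]
    simp only [Matrix.mul_assoc]
    rw [Matrix.nonsing_inv_mul _ hMu, Matrix.mul_one, Matrix.mul_nonsing_inv_cancel_left _ _ hMu',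
      Matrix.add_mul, Matrix.mul_assoc, Matrix.mul_assoc, Matrix.mul_nonsing_inv _ hS,
      Matrix.mul_one]
  have h1 : (fun a => linComb M A a ω) = M.mulVec fun a => A a ω := rfl
  have h2 : linComb N A i ω = N.mulVec (fun a => A a ω) i := rfl
  simp only [regressionResidual]
  rw [h1, Matrix.mulVec_mulVec, hreg, Matrix.add_mulVec, ← Matrix.mulVec_mulVec, Pi.add_apply,
    Matrix.mulVec_diagonal, h2]
  ring

theorem gaussianDensity_zero (S : Matrix ι ι ℝ) :
    gaussianDensity S 0 =
      ((2 * Real.pi) ^ ((Fintype.card ι : ℝ) / 2) * S.det ^ ((1 : ℝ) / 2))⁻¹ := by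
  simp [gaussianDensity]

/-- The determinant of the variance is multiplied by `det M ^ 2`, which gives `|det M|⁻¹` in the
density at `0`; the residuals contribute the `|d i|`. -/
theorem kacRiceDensity_linComb [IsProbabilityMeasure μ]
    (hA : ∀ i, MemLp (A i) 2 μ) (hB : ∀ i, MemLp (B i) 2 μ) (hnd : IsNondegenerateVector μ A)
    {M N : Matrix ι ι ℝ} (hM : M.det ≠ 0) (d : ι → ℝ) :
    kacRiceDensity μ (linComb M A) (fun i ω => d i * B i ω + linComb N A i ω) =
      |M.det|⁻¹ * (∏ i, |d i|) * kacRiceDensity μ A B := by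
  have hS := varMatrix_det_pos hA hnd
  simp only [kacRiceDensity, regressionResidual_linComb hA hB hnd hM, abs_mul,
    Finset.prod_mul_distrib, integral_const_mul, gaussianDensity_zero]
  rw [det_varMatrix_linComb hA, Real.mul_rpow (sq_nonneg _) hS.le, ← Real.sqrt_eq_rpow,
    Real.sqrt_sq_eq_abs]
  simp only [mul_inv]
  ring

variable {α α' β : Type*} [Fintype α] [DecidableEq α] [Fintype α'] [DecidableEq α']

omit [Fintype ι] [DecidableEq ι] [Fintype α] [DecidableEq α] [Fintype α'] [DecidableEq α'] in
theorem varMatrix_comp (U : α → Ω → ℝ) (e : α' → α) :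
    varMatrix μ (fun a => U (e a)) = (varMatrix μ U).submatrix e e :=
  rfl

/-- The map `g` need not be injective. All the indices of a cluster carry the same top derivative,
and this repetition becomes the exponent `|I|` in `ℓ(y)`. -/
theorem regressionResidual_comp_equiv (U : α → Ω → ℝ) (V : β → Ω → ℝ) (e : α' ≃ α) {γ : Type*}
    (g : γ → β) (c : γ) (ω : Ω) :
    regressionResidual μ (fun a => U (e a)) (fun c => V (g c)) c ω =
      regressionResidual μ U V (g c) ω := by
  have h : regressionMatrix μ (fun a => U (e a)) (fun c => V (g c)) =
      (regressionMatrix μ U V).submatrix g e := by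
    rw [regressionMatrix, regressionMatrix, varMatrix_comp, Matrix.inv_submatrix_equiv]
    exact Matrix.submatrix_mul_equiv (covMatrix μ V U) _ g e e
  simp only [regressionResidual, h, Matrix.mulVec, dotProduct, Matrix.submatrix_apply]
  rw [e.sum_comp fun a => regressionMatrix μ U V (g c) a * U a ω]

end Transformation

/-! ### Divided differences -/

section DividedDifferences

open Polynomial

theorem Polynomial.contDiff_eval (q : ℝ[X]) {n : WithTop ℕ∞} :
    ContDiff ℝ n fun t => q.eval t :=
  contDiffOn_univ.mp (AnalyticOnNhd.eval_polynomial q).contDiffOn_of_completeSpace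

theorem Polynomial.iteratedDeriv_eval (q : ℝ[X]) (n : ℕ) :
    iteratedDeriv n (fun t => q.eval t) = fun t => (derivative^[n] q).eval t := by
  induction n generalizing q with
  | zero => simp
  | succ n ih =>
    rw [iteratedDeriv_succ', Function.iterate_succ_apply, ← ih]
    congr 1
    funext t
    exact q.deriv

theorem Polynomial.iteratedDeriv_eval_of_natDegree_le {q : ℝ[X]} {n : ℕ} (hq : q.natDegree ≤ n)
    (t : ℝ) : iteratedDeriv n (fun t => q.eval t) t = n ! * q.coeff n := by
  have h0 : (derivative^[n] q).natDegree ≤ 0 :=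
    (natDegree_iterate_derivative q n).trans (by omega)
  rw [Polynomial.iteratedDeriv_eval, eq_C_of_natDegree_le_zero h0]
  simp [coeff_iterate_derivative, Nat.descFactorial_self]

/-- Rolle's theorem between consecutive points. The new points are interior to the gaps, and this
disjointness is needed to add a double zero to them. -/
theorem exists_finset_deriv_eq_zero {g : ℝ → ℝ} (hg : Differentiable ℝ g) {a b : ℝ} {n : ℕ}
    {Z : Finset ℝ} (hZ : Z.card = n + 1) (hZab : ∀ z ∈ Z, z ∈ Set.Icc a b)
    (hg0 : ∀ z ∈ Z, g z = 0) :
    ∃ Z' : Finset ℝ, Z'.card = n ∧ Disjoint Z' Z ∧ (∀ z ∈ Z', z ∈ Set.Icc a b) ∧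
      ∀ z ∈ Z', deriv g z = 0 := by
  set z := Z.orderEmbOfFin hZ with hz
  have hzZ : ∀ i, z i ∈ Z := fun i => Finset.orderEmbOfFin_mem Z hZ i
  have hex : ∀ i : Fin n, ∃ c ∈ Set.Ioo (z i.castSucc) (z i.succ), deriv g c = 0 := fun i =>
    exists_deriv_eq_zero (z.strictMono i.castSucc_lt_succ) hg.continuous.continuousOn
      (by rw [hg0 _ (hzZ _), hg0 _ (hzZ _)])
  choose c hc hc0 using hex
  have hmono : StrictMono c := fun i j hij =>
    (hc i).2.trans_le ((z.monotone (Fin.succ_le_castSucc_iff.mpr hij)).trans (hc j).1.le)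
  refine ⟨Finset.univ.image c, ?_, ?_, ?_, ?_⟩
  · rw [Finset.card_image_of_injective _ hmono.injective, Finset.card_univ, Fintype.card_fin]
  · rw [Finset.disjoint_left]
    intro w hw hwZ
    obtain ⟨i, -, rfl⟩ := Finset.mem_image.mp hw
    obtain ⟨j, hj⟩ : c i ∈ Set.range z := by rwa [Finset.range_orderEmbOfFin]
    have h1 := (hc i).1
    have h2 := (hc i).2
    rw [← hj] at h1 h2
    have h1' := z.lt_iff_lt.mp h1
    have h2' := z.lt_iff_lt.mp h2
    rw [Fin.lt_def] at h1' h2'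
    simp at h1' h2'
    omega
  · intro w hw
    obtain ⟨i, -, rfl⟩ := Finset.mem_image.mp hw
    exact ⟨(hZab _ (hzZ _)).1.trans (hc i).1.le, (hc i).2.le.trans (hZab _ (hzZ _)).2⟩
  · intro w hw
    obtain ⟨i, -, rfl⟩ := Finset.mem_image.mp hw
    exact hc0 i

/-- The iterated form of Rolle's theorem. -/
theorem exists_iteratedDeriv_eq_zero {n : ℕ} {g : ℝ → ℝ} (hg : ContDiff ℝ n g) {a b : ℝ}
    {Z : Finset ℝ} (hZ : Z.card = n + 1) (hZab : ∀ z ∈ Z, z ∈ Set.Icc a b)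
    (hg0 : ∀ z ∈ Z, g z = 0) : ∃ ξ ∈ Set.Icc a b, iteratedDeriv n g ξ = 0 := by
  induction n generalizing g Z with
  | zero =>
    obtain ⟨z, hz⟩ := Finset.card_pos.mp (by omega : 0 < Z.card)
    exact ⟨z, hZab z hz, by simpa using hg0 z hz⟩
  | succ n ih =>
    have hg' := contDiff_succ_iff_deriv.mp (by exact_mod_cast hg : ContDiff ℝ ((n : WithTop ℕ∞) + 1) g)
    obtain ⟨Z', h1, -, h2, h3⟩ := exists_finset_deriv_eq_zero hg'.1 hZ hZab hg0
    rw [iteratedDeriv_succ']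
    exact ih hg'.2.2 h1 h2 h3

/-- The iterated form of Rolle's theorem for a function with a double zero. -/
theorem exists_iteratedDeriv_eq_zero_of_deriv_eq_zero {m : ℕ} {g : ℝ → ℝ} (hg : ContDiff ℝ m g)
    {a b : ℝ} {Z : Finset ℝ} (hZ : Z.card = m) (hZab : ∀ z ∈ Z, z ∈ Set.Icc a b)
    (hg0 : ∀ z ∈ Z, g z = 0) {x : ℝ} (hx : x ∈ Z) (hx' : deriv g x = 0) :
    ∃ ξ ∈ Set.Icc a b, iteratedDeriv m g ξ = 0 := by
  obtain ⟨n, rfl⟩ : ∃ n, m = n + 1 :=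
    ⟨m - 1, by have := Finset.card_pos.mpr ⟨x, hx⟩; omega⟩
  have hg' := contDiff_succ_iff_deriv.mp (by exact_mod_cast hg : ContDiff ℝ ((n : WithTop ℕ∞) + 1) g)
  obtain ⟨Z', h1, hd, h2, h3⟩ := exists_finset_deriv_eq_zero hg'.1 hZ hZab hg0
  -- The double zero `x` is a zero of the derivative distinct from those given by Rolle's theorem,
  -- so one more differentiation is available.
  have hxZ' : x ∉ Z' := fun h => Finset.disjoint_left.mp hd h hx
  rw [iteratedDeriv_succ']
  refine exists_iteratedDeriv_eq_zero hg'.2.2 (Z := insert x Z')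
    (by rw [Finset.card_insert_of_notMem hxZ', h1]) ?_ ?_
  · simpa using ⟨hZab x hx, h2⟩
  · simpa using ⟨hx', h3⟩

variable {ι : Type*} [DecidableEq ι] {s : Finset ι} {x : ι → ℝ} {g : ℝ → ℝ} {a b : ℝ}

theorem iteratedDeriv_sub_eval {n : ℕ} (hg : ContDiff ℝ n g) {q : ℝ[X]} (hq : q.natDegree ≤ n)
    (t : ℝ) : iteratedDeriv n (fun t => g t - q.eval t) t =
      iteratedDeriv n g t - n ! * q.coeff n := by
  rw [← Polynomial.iteratedDeriv_eval_of_natDegree_le hq t]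
  exact iteratedDeriv_fun_sub hg.contDiffAt q.contDiff_eval.contDiffAt

/-- The divided difference of `g` at the nodes `x i`, `i ∈ s`. -/
def dividedDifference (s : Finset ι) (x : ι → ℝ) (g : ℝ → ℝ) : ℝ :=
  ∑ j ∈ s, Lagrange.nodalWeight s x j * g (x j)

/-- The divided difference of `g` at the nodes `x j`, `j ∈ s`, where the node `x i` is doubled. -/
def dividedDifferenceDouble (s : Finset ι) (x : ι → ℝ) (i : ι) (g : ℝ → ℝ) : ℝ :=
  Lagrange.nodalWeight s x i * (deriv g (x i) -
    ∑ j ∈ s, (derivative (Lagrange.basis s x j)).eval (x i) * g (x j))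

theorem coeff_interpolate_eq_dividedDifference (hx : Set.InjOn x s) (g : ℝ → ℝ) :
    (Lagrange.interpolate s x fun i => g (x i)).coeff (s.card - 1) = dividedDifference s x g := by
  rw [Lagrange.coeff_eq_sum hx (Lagrange.degree_interpolate_lt _ hx)]
  refine Finset.sum_congr rfl fun i hi => ?_
  rw [Lagrange.eval_interpolate_at_node _ hx hi, Lagrange.nodalWeight, Finset.prod_inv_distrib]
  ring

/-- Subtracting the interpolation polynomial leaves a function with `n + 1` zeros, and the `n`-th
derivative of that polynomial is the constant `n !` times its coefficient of degree `n`. -/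
theorem exists_iteratedDeriv_eq_dividedDifference (hx : Set.InjOn x s) {n : ℕ}
    (hs : s.card = n + 1) (hxab : ∀ i ∈ s, x i ∈ Set.Icc a b) (hg : ContDiff ℝ n g) :
    ∃ ξ ∈ Set.Icc a b, iteratedDeriv n g ξ = n ! * dividedDifference s x g := by
  set q := Lagrange.interpolate s x fun i => g (x i) with hq
  have hdeg : q.natDegree ≤ n := by
    have := Lagrange.degree_interpolate_le (fun i => g (x i)) hx
    rw [hs, Nat.add_sub_cancel] at this
    exact natDegree_le_of_degree_le this
  obtain ⟨ξ, hξ, h⟩ := exists_iteratedDeriv_eq_zero (g := fun t => g t - q.eval t)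
    (hg.sub q.contDiff_eval) (Z := s.image x) (by rw [Finset.card_image_of_injOn hx, hs])
    (by simpa using hxab)
    (fun z hz => by
      obtain ⟨i, hi, rfl⟩ := Finset.mem_image.mp hz
      rw [hq, Lagrange.eval_interpolate_at_node _ hx hi, sub_self])
  refine ⟨ξ, hξ, ?_⟩
  rw [iteratedDeriv_sub_eval hg hdeg, sub_eq_zero] at h
  rw [h, ← coeff_interpolate_eq_dividedDifference hx, hs, Nat.add_sub_cancel]

/-- The same argument with the Hermite interpolation polynomial, which matches `g` at all nodes and
also `deriv g` at the doubled node. -/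
theorem exists_iteratedDeriv_eq_dividedDifferenceDouble (hx : Set.InjOn x s) {i : ι} (hi : i ∈ s)
    (hxab : ∀ i ∈ s, x i ∈ Set.Icc a b) (hg : ContDiff ℝ s.card g) :
    ∃ ξ ∈ Set.Icc a b,
      iteratedDeriv s.card g ξ = s.card ! * dividedDifferenceDouble s x i g := by
  set p := Lagrange.interpolate s x fun i => g (x i) with hp
  set e := dividedDifferenceDouble s x i g with he
  -- The nodal polynomial vanishes at the nodes and has derivative `w⁻¹` at `x i`, with `w` the
  -- nodal weight there. The coefficient `e` is thus the one that corrects the derivative of `p` at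
  -- `x i`.
  set q := p + C e * Lagrange.nodal s x with hq
  have hpdeg : p.degree < s.card := Lagrange.degree_interpolate_lt _ hx
  have hdeg : q.natDegree ≤ s.card := by
    refine (natDegree_add_le _ _).trans (max_le (natDegree_le_of_degree_le hpdeg.le) ?_)
    exact (natDegree_C_mul_le _ _).trans Lagrange.natDegree_nodal.le
  have hcoeff : q.coeff s.card = e := by
    have h1 : (Lagrange.nodal s x).coeff s.card = 1 := by
      have := (Lagrange.nodal_monic (s := s) (v := x)).coeff_natDegree
      rwa [Lagrange.natDegree_nodal] at this
    rw [hq, coeff_add, coeff_C_mul, h1, coeff_eq_zero_of_degree_lt hpdeg, zero_add, mul_one]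
  have hcard : (s.card : WithTop ℕ∞) ≠ 0 := by
    have := Finset.card_pos.mpr ⟨i, hi⟩
    exact_mod_cast this.ne'
  have hw : Lagrange.nodalWeight s x i ≠ 0 := Lagrange.nodalWeight_ne_zero hx hi
  have hqd : (derivative q).eval (x i) = deriv g (x i) := by
    have h1 := Lagrange.nodalWeight_eq_eval_derivative_nodal (v := x) hi
    have h2 : (derivative p).eval (x i) =
        ∑ j ∈ s, (derivative (Lagrange.basis s x j)).eval (x i) * g (x j) := by
      rw [hp, Lagrange.interpolate_apply, derivative_sum, eval_finsetSum]
      refine Finset.sum_congr rfl fun j _ => ?_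
      rw [derivative_C_mul, eval_mul, eval_C, mul_comm]
    have h3 : eval (x i) (derivative (Lagrange.nodal s x)) = (Lagrange.nodalWeight s x i)⁻¹ := by
      rw [h1, inv_inv]
    rw [hq, derivative_add, derivative_C_mul, eval_add, eval_mul, eval_C, h2, h3, he,
      dividedDifferenceDouble]
    field_simp
    ring
  obtain ⟨ξ, hξ, h⟩ := exists_iteratedDeriv_eq_zero_of_deriv_eq_zero
    (g := fun t => g t - q.eval t) (m := s.card)
    (hg.sub q.contDiff_eval) (Z := s.image x) (Finset.card_image_of_injOn hx)
    (by simpa using hxab)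
    (fun z hz => by
      obtain ⟨j, hj, rfl⟩ := Finset.mem_image.mp hz
      rw [hq, eval_add, eval_mul, Lagrange.eval_nodal_at_node hj, hp,
        Lagrange.eval_interpolate_at_node _ hx hj, mul_zero, add_zero, sub_self])
    (Finset.mem_image_of_mem x hi)
    (by rw [deriv_fun_sub ((hg.differentiable hcard) _) q.differentiableAt, q.deriv, hqd, sub_self])
  refine ⟨ξ, hξ, ?_⟩
  rw [iteratedDeriv_sub_eval hg hdeg, sub_eq_zero] at h
  rw [h, hcoeff]

omit [DecidableEq ι] in
/-- A quantity which is an intermediate value of a continuous function near `y₀` converges. -/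
theorem tendsto_of_exists_mem_Icc {X : Type*} {l : Filter X} {G : ℝ → ℝ} {y₀ : ℝ}
    (hG : ContinuousAt G y₀) {D : X → ℝ} {s : Finset ι} {x : X → ι → ℝ}
    (hx : ∀ i ∈ s, Tendsto (fun t => x t i) l (𝓝 y₀))
    (h : ∀ᶠ t in l, ∀ a b, (∀ i ∈ s, x t i ∈ Set.Icc a b) → ∃ ξ ∈ Set.Icc a b, G ξ = D t) :
    Tendsto D l (𝓝 (G y₀)) := by
  rw [Metric.tendsto_nhds]
  intro ε hε
  obtain ⟨δ, hδ, hGδ⟩ := Metric.continuousAt_iff.mp hG ε hε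
  have hev : ∀ᶠ t in l, ∀ i ∈ s, x t i ∈ Set.Icc (y₀ - δ / 2) (y₀ + δ / 2) := by
    rw [Filter.eventually_all_finset]
    exact fun i hi => (hx i hi).eventually (Icc_mem_nhds (by linarith) (by linarith))
  filter_upwards [hev, h] with t ht h'
  obtain ⟨ξ, hξ, hξD⟩ := h' _ _ ht
  rw [← hξD]
  refine hGδ ?_
  rw [Real.dist_eq, abs_lt]
  constructor <;> linarith [hξ.1, hξ.2]

theorem tendsto_dividedDifference {X : Type*} {l : Filter X} {y₀ : ℝ} {x : X → ι → ℝ} {n : ℕ}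
    (hs : s.card = n + 1) (hx : ∀ i ∈ s, Tendsto (fun t => x t i) l (𝓝 y₀))
    (hinj : ∀ᶠ t in l, Set.InjOn (x t) s) (hg : ContDiff ℝ n g) :
    Tendsto (fun t => dividedDifference s (x t) g) l (𝓝 ((n ! : ℝ)⁻¹ * iteratedDeriv n g y₀)) := by
  have hn : (n ! : ℝ) ≠ 0 := by exact_mod_cast n.factorial_ne_zero
  refine tendsto_of_exists_mem_Icc (G := fun t => (n ! : ℝ)⁻¹ * iteratedDeriv n g t)
    ((hg.continuous_iteratedDeriv n le_rfl).const_mul _).continuousAt hx ?_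
  filter_upwards [hinj] with t ht a b hab
  obtain ⟨ξ, hξ, h⟩ := exists_iteratedDeriv_eq_dividedDifference ht hs hab hg
  exact ⟨ξ, hξ, by rw [h, inv_mul_cancel_left₀ hn]⟩

theorem tendsto_dividedDifferenceDouble {X : Type*} {l : Filter X} {y₀ : ℝ} {x : X → ι → ℝ}
    {i : ι} (hi : i ∈ s) (hx : ∀ i ∈ s, Tendsto (fun t => x t i) l (𝓝 y₀))
    (hinj : ∀ᶠ t in l, Set.InjOn (x t) s) (hg : ContDiff ℝ s.card g) :
    Tendsto (fun t => dividedDifferenceDouble s (x t) i g) l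
      (𝓝 ((s.card ! : ℝ)⁻¹ * iteratedDeriv s.card g y₀)) := by
  have hn : (s.card ! : ℝ) ≠ 0 := by exact_mod_cast s.card.factorial_ne_zero
  refine tendsto_of_exists_mem_Icc (G := fun t => (s.card ! : ℝ)⁻¹ * iteratedDeriv s.card g t)
    ((hg.continuous_iteratedDeriv _ le_rfl).const_mul _).continuousAt hx ?_
  filter_upwards [hinj] with t ht a b hab
  obtain ⟨ξ, hξ, h⟩ := exists_iteratedDeriv_eq_dividedDifferenceDouble ht hi hab hg
  exact ⟨ξ, hξ, by rw [h, inv_mul_cancel_left₀ hn]⟩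

end DividedDifferences

/-! ### Newton coordinates of a configuration of points -/

section NewtonCoordinates

variable {k : ℕ}

/-- The indices `j` such that `y j = y i`. -/
def cluster (y : Fin k → ℝ) (i : Fin k) : Finset (Fin k) :=
  Finset.univ.filter fun j => y j = y i

/-- The indices `j < i` such that `y j = y i`. -/
def clusterBelow (y : Fin k → ℝ) (i : Fin k) : Finset (Fin k) :=
  Finset.univ.filter fun j => y j = y i ∧ j < i

variable {y : Fin k → ℝ}

theorem mem_cluster {i j : Fin k} : j ∈ cluster y i ↔ y j = y i := by simp [cluster]

theorem mem_clusterBelow {i j : Fin k} : j ∈ clusterBelow y i ↔ y j = y i ∧ j < i := by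
  simp [clusterBelow]

theorem notMem_clusterBelow_self (i : Fin k) : i ∉ clusterBelow y i := by
  simp [mem_clusterBelow]

theorem card_cluster_le (i : Fin k) : (cluster y i).card ≤ k :=
  card_finset_fin_le _

theorem card_clusterBelow_le (i : Fin k) : (clusterBelow y i).card ≤ k :=
  card_finset_fin_le _

theorem card_insert_clusterBelow (i : Fin k) :
    (insert i (clusterBelow y i)).card = (clusterBelow y i).card + 1 :=
  Finset.card_insert_of_notMem (notMem_clusterBelow_self i)

/-- The matrix that sends the values of a function at the points `x i` to its divided differences
along the clusters of `y`. -/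
def newtonMatrix (y x : Fin k → ℝ) : Matrix (Fin k) (Fin k) ℝ :=
  Matrix.of fun i j => if j ∈ insert i (clusterBelow y i) then
    Lagrange.nodalWeight (insert i (clusterBelow y i)) x j else 0

/-- The contribution of the values of a function at the points `x i` to its divided differences
along the clusters of `y` with a double node. -/
def hermiteMatrix (y x : Fin k → ℝ) : Matrix (Fin k) (Fin k) ℝ :=
  Matrix.of fun i j => if j ∈ cluster y i then
    -(Lagrange.nodalWeight (cluster y i) x i *
      (Polynomial.derivative (Lagrange.basis (cluster y i) x j)).eval (x i)) else 0

theorem linComb_newtonMatrix {Ω : Type*} (f : ℝ → Ω → ℝ) (y x : Fin k → ℝ) (i : Fin k) (ω : Ω) :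
    linComb (newtonMatrix y x) (fun j => f (x j)) i ω =
      dividedDifference (insert i (clusterBelow y i)) x fun t => f t ω := by
  simp only [linComb, newtonMatrix, Matrix.of_apply, ite_mul, zero_mul, Finset.sum_ite_mem,
    Finset.univ_inter, dividedDifference]

theorem linComb_hermiteMatrix {Ω : Type*} (f : ℝ → Ω → ℝ) (y x : Fin k → ℝ) (i : Fin k) (ω : Ω) :
    Lagrange.nodalWeight (cluster y i) x i * processDeriv f 1 (x i) ω +
        linComb (hermiteMatrix y x) (fun j => f (x j)) i ω =
      dividedDifferenceDouble (cluster y i) x i fun t => f t ω := by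
  simp only [linComb, hermiteMatrix, Matrix.of_apply, ite_mul, zero_mul, Finset.sum_ite_mem,
    Finset.univ_inter, dividedDifferenceDouble, processDeriv, iteratedDeriv_one, neg_mul,
    mul_assoc, Finset.sum_neg_distrib, ← Finset.mul_sum]
  ring

/-- The divided difference of index `i` involves only nodes of index at most `i`, so the matrix is
triangular. Its diagonal entry is the weight of the last node added. -/
theorem det_newtonMatrix (y x : Fin k → ℝ) :
    (newtonMatrix y x).det = ∏ i, ∏ j ∈ clusterBelow y i, (x i - x j)⁻¹ := by
  rw [Matrix.det_of_isLowerTriangular]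
  · refine Finset.prod_congr rfl fun i _ => ?_
    simp only [newtonMatrix, Matrix.of_apply, Finset.mem_insert_self, if_true]
    rw [Lagrange.nodalWeight, Finset.erase_insert (notMem_clusterBelow_self i)]
  · intro i j hij
    have hij' : i < j := hij
    rw [newtonMatrix, Matrix.of_apply, if_neg]
    simp only [Finset.mem_insert, mem_clusterBelow, not_or, not_and, not_lt]
    exact ⟨hij'.ne', fun _ => hij'.le⟩

/-- The product of the `|x i - x j|⁻¹`, where `{i, j}` runs over the pairs in a cluster of `y`. -/
def pairFactor (y x : Fin k → ℝ) : ℝ :=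
  ∏ i, ∏ j ∈ clusterBelow y i, |x i - x j|⁻¹

theorem abs_det_newtonMatrix (y x : Fin k → ℝ) : |(newtonMatrix y x).det| = pairFactor y x := by
  simp only [det_newtonMatrix, Finset.abs_prod, abs_inv, pairFactor]

theorem pairFactor_pos {x : Fin k → ℝ} (hx : Function.Injective x) : 0 < pairFactor y x := by
  refine Finset.prod_pos fun i _ => Finset.prod_pos fun j hj => inv_pos.mpr (abs_pos.mpr ?_)
  exact sub_ne_zero.mpr fun h => ((mem_clusterBelow.mp hj).2.ne) (hx h).symm

/-- A pair in a common cluster contributes to the weights at both of its elements, hence the square.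
-/
theorem prod_abs_nodalWeight_cluster (y x : Fin k → ℝ) :
    ∏ i, |Lagrange.nodalWeight (cluster y i) x i| = pairFactor y x ^ 2 := by
  have h : ∀ i, |Lagrange.nodalWeight (cluster y i) x i| =
      (∏ j, if y j = y i ∧ j < i then |x i - x j|⁻¹ else 1) *
        ∏ j, if y i = y j ∧ i < j then |x j - x i|⁻¹ else 1 := fun i => by
    have he : (cluster y i).erase i = Finset.univ.filter fun j => y j = y i ∧ j ≠ i := by
      ext j
      simp [mem_cluster, and_comm]
    rw [Lagrange.nodalWeight, Finset.abs_prod, he, Finset.prod_filter, ← Finset.prod_mul_distrib]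
    refine Finset.prod_congr rfl fun j _ => ?_
    rw [abs_inv, abs_sub_comm (x j)]
    simp only [eq_comm (a := y i)]
    rcases lt_trichotomy j i with hj | rfl | hj
    · simp [hj, hj.ne, hj.not_gt]
    · simp
    · simp [hj, hj.ne', hj.not_gt]
  have h' : ∀ i, ∏ j ∈ clusterBelow y i, |x i - x j|⁻¹ =
      ∏ j, if y j = y i ∧ j < i then |x i - x j|⁻¹ else 1 := fun i => by
    rw [clusterBelow, Finset.prod_filter]
  simp only [h, pairFactor, h', Finset.prod_mul_distrib]
  rw [Finset.prod_comm (f := fun i j => if y i = y j ∧ i < j then |x j - x i|⁻¹ else 1), sq]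

end NewtonCoordinates

/-! ### Comparison of the partition with the clusters of `y` -/

section Clusters

variable {k : ℕ} {y : Fin k → ℝ} {P : Finpartition (Finset.univ : Finset (Fin k))}
  {yv : Finset (Fin k) → ℝ}

theorem IsClusterPartition.eq_cluster (hP : IsClusterPartition y P yv) {I : Finset (Fin k)}
    (hI : I ∈ P.parts) {i : Fin k} (hi : i ∈ I) : I = cluster y i := by
  ext j
  rw [mem_cluster, hP.eq_iff]
  refine ⟨fun hj => ⟨I, hI, hj, hi⟩, fun ⟨J, hJ, hj, hi'⟩ => ?_⟩
  rwa [P.eq_of_mem_parts hI hJ hi hi']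

theorem IsClusterPartition.clusterFactor_eq (hP : IsClusterPartition y P yv) (x : Fin k → ℝ) :
    clusterFactor P x = pairFactor y x := by
  have h1 : (Finset.univ.filter fun p : Fin k × Fin k => y p.1 = y p.2 ∧ p.1 < p.2) =
      P.parts.biUnion fun I => (I ×ˢ I).filter fun p => p.1 < p.2 := by
    ext p
    simp only [Finset.mem_filter, Finset.mem_univ, true_and, Finset.mem_biUnion,
      Finset.mem_product, hP.eq_iff]
    constructor
    · rintro ⟨⟨I, hI, h⟩, h'⟩
      exact ⟨I, hI, h, h'⟩
    · rintro ⟨I, hI, h, h'⟩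
      exact ⟨⟨I, hI, h⟩, h'⟩
  rw [clusterFactor, ← Finset.prod_biUnion, ← h1, Finset.prod_filter, Fintype.prod_prod_type_right,
    pairFactor]
  · refine Finset.prod_congr rfl fun i _ => ?_
    rw [clusterBelow, Finset.prod_filter]
    refine Finset.prod_congr rfl fun j _ => ?_
    rw [abs_sub_comm, one_div]
  · intro I hI J hJ hIJ
    rw [Function.onFun, Finset.disjoint_left]
    intro p hp hp'
    exact hIJ (P.eq_of_mem_parts hI hJ (Finset.mem_product.mp (Finset.mem_filter.mp hp).1).1
      (Finset.mem_product.mp (Finset.mem_filter.mp hp').1).1)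

/-- The enumeration of the indices by the clusters. -/
theorem IsClusterPartition.exists_equiv (hP : IsClusterPartition y P yv) :
    ∃ e : (Σ I : P.parts, Fin I.1.card) ≃ Fin k, ∀ a, y (e a) = yv a.1 ∧
      cluster y (e a) = a.1 ∧ (clusterBelow y (e a)).card = a.2 := by
  -- Each block is enumerated increasingly, so the position of an index in its block is the number
  -- of smaller indices in the same cluster.
  set F : (Σ I : P.parts, Fin I.1.card) → Fin k := fun a => a.1.1.orderEmbOfFin rfl a.2 with hF
  have hmem : ∀ a, F a ∈ a.1.1 := fun a => Finset.orderEmbOfFin_mem _ _ _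
  have hinj : Function.Injective F := by
    rintro ⟨I, i⟩ ⟨J, j⟩ h
    have hIJ : I = J := Subtype.ext (P.eq_of_mem_parts I.2 J.2 (hmem ⟨I, i⟩) (h ▸ hmem ⟨J, j⟩))
    subst hIJ
    have hij : i = j := (I.1.orderEmbOfFin rfl).injective h
    rw [hij]
  have hsurj : Function.Surjective F := fun i => by
    obtain ⟨j, hj⟩ : i ∈ Set.range ((P.part i).orderEmbOfFin rfl) := by
      rw [Finset.range_orderEmbOfFin]
      exact P.mem_part (Finset.mem_univ i)
    exact ⟨⟨⟨P.part i, P.part_mem.mpr (Finset.mem_univ i)⟩, j⟩, hj⟩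
  refine ⟨Equiv.ofBijective F ⟨hinj, hsurj⟩, fun a => ?_⟩
  have hc := hP.eq_cluster a.1.2 (hmem a)
  refine ⟨hP.value _ a.1.2 _ (hmem a), hc.symm, ?_⟩
  have h : clusterBelow y (F a) = (Finset.Iio a.2).map (a.1.1.orderEmbOfFin rfl).toEmbedding := by
    ext j
    rw [mem_clusterBelow, ← mem_cluster, ← hc, Finset.mem_map]
    constructor
    · rintro ⟨hj, hlt⟩
      obtain ⟨l, rfl⟩ : j ∈ Set.range (a.1.1.orderEmbOfFin rfl) := by
        rwa [Finset.range_orderEmbOfFin]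
      exact ⟨l, Finset.mem_Iio.mpr ((a.1.1.orderEmbOfFin rfl).lt_iff_lt.mp hlt), rfl⟩
    · rintro ⟨l, hl, rfl⟩
      exact ⟨Finset.orderEmbOfFin_mem _ _ _,
        (a.1.1.orderEmbOfFin rfl).lt_iff_lt.mpr (Finset.mem_Iio.mp hl)⟩
  change (clusterBelow y (F a)).card = _
  rw [h, Finset.card_map, Fin.card_Iio]

end Clusters

/-! ### The limit of the Kac--Rice density on the diagonal -/

section NewtonLimit

variable {Ω : Type*} [MeasurableSpace Ω] {μ : Measure Ω}

theorem IsCenteredGaussianVector.elim_linComb {ι : Type*} [Fintype ι]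
    {A B : ι → Ω → ℝ} (h : IsCenteredGaussianVector (Sum.elim A B) μ) (M N : Matrix ι ι ℝ)
    (d : ι → ℝ) : IsCenteredGaussianVector
      (Sum.elim (linComb M A) fun i ω => d i * B i ω + linComb N A i ω) μ := by
  classical
  refine (h.mulMatrix (Matrix.fromBlocks M 0 N (Matrix.diagonal d))).congr fun s =>
    ae_of_all _ fun ω => ?_
  rcases s with a | b
  · simp [linComb]
  · simp [linComb, Matrix.diagonal_apply, add_comm]

theorem IsNormalizedStationaryGaussian.isCenteredGaussianVector_elim_processDeriv
    [IsProbabilityMeasure μ] {p : ℕ} {f : ℝ → Ω → ℝ} (hf : IsNormalizedStationaryGaussian μ p f)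
    {κ κ' : Type*} [Fintype κ] [Fintype κ'] (d : κ → ℕ) (d' : κ' → ℕ) (e : κ → ℝ) (e' : κ' → ℝ)
    (hd : ∀ c, d c ≤ p) (hd' : ∀ c, d' c ≤ p) :
    IsCenteredGaussianVector (Sum.elim (fun c => processDeriv f (d c) (e c))
      fun c => processDeriv f (d' c) (e' c)) μ := by
  have h := hf.isCenteredGaussianVector_processDeriv (Sum.elim d d') (Sum.elim e e')
    (by rintro (c | c); exacts [hd c, hd' c])
  exact h.congr (by rintro (c | c) <;> exact ae_of_all _ fun _ => rfl)

omit [MeasurableSpace Ω] in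
theorem processDeriv_zero (f : ℝ → Ω → ℝ) (t : ℝ) : processDeriv f 0 t = f t := by
  funext ω
  simp [processDeriv]

variable [IsProbabilityMeasure μ] {k : ℕ} {f : ℝ → Ω → ℝ} {y : Fin k → ℝ}

/-- The limits of the divided differences of `f` along the clusters of `y`. -/
def newtonLimit (f : ℝ → Ω → ℝ) (y : Fin k → ℝ) (i : Fin k) : Ω → ℝ :=
  fun ω => ((clusterBelow y i).card ! : ℝ)⁻¹ * processDeriv f (clusterBelow y i).card (y i) ω

/-- The limits of the divided differences of `f` along the clusters of `y` with a double node. -/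
def hermiteLimit (f : ℝ → Ω → ℝ) (y : Fin k → ℝ) (i : Fin k) : Ω → ℝ :=
  fun ω => ((cluster y i).card ! : ℝ)⁻¹ * processDeriv f (cluster y i).card (y i) ω

omit [MeasurableSpace Ω] in
theorem newtonLimit_eq_linComb (f : ℝ → Ω → ℝ) (y : Fin k → ℝ) :
    newtonLimit f y =
      linComb (Matrix.diagonal fun i => ((clusterBelow y i).card ! : ℝ)⁻¹)
        fun i => processDeriv f (clusterBelow y i).card (y i) := by
  funext i ω
  simp [newtonLimit, linComb, Matrix.diagonal_apply]

omit [MeasurableSpace Ω] in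
theorem hermiteLimit_eq_add_linComb (f : ℝ → Ω → ℝ) (y : Fin k → ℝ) :
    hermiteLimit f y = fun i ω =>
      ((cluster y i).card ! : ℝ)⁻¹ * processDeriv f (cluster y i).card (y i) ω +
        linComb 0 (fun i => processDeriv f (clusterBelow y i).card (y i)) i ω := by
  funext i ω
  simp [hermiteLimit, linComb]

theorem isCenteredGaussianVector_newtonLimit (hf : IsNormalizedStationaryGaussian μ k f)
    (y : Fin k → ℝ) :
    IsCenteredGaussianVector (Sum.elim (newtonLimit f y) (hermiteLimit f y)) μ := by
  rw [newtonLimit_eq_linComb, hermiteLimit_eq_add_linComb]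
  exact (hf.isCenteredGaussianVector_elim_processDeriv _ _ y y card_clusterBelow_le
    card_cluster_le).elim_linComb _ _ _

theorem isCenteredGaussianVector_newton (hf : IsNormalizedStationaryGaussian μ k f) (hk : 1 ≤ k)
    (y x : Fin k → ℝ) :
    IsCenteredGaussianVector (Sum.elim (linComb (newtonMatrix y x) fun i => f (x i))
      fun i ω => Lagrange.nodalWeight (cluster y i) x i * processDeriv f 1 (x i) ω +
        linComb (hermiteMatrix y x) (fun i => f (x i)) i ω) μ := by
  have h := hf.isCenteredGaussianVector_elim_processDeriv (fun _ : Fin k => 0)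
    (fun _ : Fin k => 1) x x (fun _ => k.zero_le) (fun _ => hk)
  simp only [processDeriv_zero] at h
  exact h.elim_linComb _ _ _

variable {T : Type*} {l : Filter T} {x : T → Fin k → ℝ}

omit [IsProbabilityMeasure μ] in
theorem ae_tendsto_newton (hf : IsNormalizedStationaryGaussian μ k f)
    (hx : Tendsto x l (𝓝 y)) (hinj : ∀ᶠ t in l, Function.Injective (x t)) (i : Fin k) :
    ∀ᵐ ω ∂μ, Tendsto (fun t => linComb (newtonMatrix y (x t)) (fun i => f (x t i)) i ω) l
      (𝓝 (newtonLimit f y i ω)) := by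
  filter_upwards [hf.contDiff] with ω hω
  simp only [linComb_newtonMatrix]
  refine tendsto_dividedDifference (card_insert_clusterBelow i) (fun j hj => ?_)
    (hinj.mono fun t ht => ht.injOn) (hω.of_le (by exact_mod_cast card_clusterBelow_le i))
  have hj' : y j = y i := by
    rcases Finset.mem_insert.mp hj with rfl | hj
    exacts [rfl, (mem_clusterBelow.mp hj).1]
  rw [← hj']
  exact hx.apply_nhds j

omit [IsProbabilityMeasure μ] in
theorem ae_tendsto_hermite (hf : IsNormalizedStationaryGaussian μ k f)
    (hx : Tendsto x l (𝓝 y)) (hinj : ∀ᶠ t in l, Function.Injective (x t)) (i : Fin k) :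
    ∀ᵐ ω ∂μ, Tendsto (fun t =>
      Lagrange.nodalWeight (cluster y i) (x t) i * processDeriv f 1 (x t i) ω +
        linComb (hermiteMatrix y (x t)) (fun i => f (x t i)) i ω) l (𝓝 (hermiteLimit f y i ω)) := by
  filter_upwards [hf.contDiff] with ω hω
  simp only [linComb_hermiteMatrix]
  refine tendsto_dividedDifferenceDouble (mem_cluster.mpr rfl) (fun j hj => ?_)
    (hinj.mono fun t ht => ht.injOn) (hω.of_le (by exact_mod_cast card_cluster_le i))
  rw [← mem_cluster.mp hj]
  exact hx.apply_nhds j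

/-- Near `y` and outside of the diagonal, the values of `f` form a non-degenerate vector. -/
theorem eventually_isNondegenerateVector [l.IsCountablyGenerated]
    (hf : IsNormalizedStationaryGaussian μ k f) (hk : 1 ≤ k)
    (hx : Tendsto x l (𝓝 y)) (hinj : ∀ᶠ t in l, Function.Injective (x t))
    (hnd : IsNondegenerateVector μ (newtonLimit f y)) :
    ∀ᶠ t in l, IsNondegenerateVector μ fun i => f (x t i) := by
  have hS := tendsto_varMatrix_of_ae
    (fun t => isCenteredGaussianVector_left (isCenteredGaussianVector_newton hf hk y (x t)))
    (isCenteredGaussianVector_left (isCenteredGaussianVector_newtonLimit hf y))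
    (ae_tendsto_newton hf hx hinj)
  have hdet := (continuous_id.matrix_det.tendsto _).comp hS
  -- Divided differences are linear in the values: a degenerate vector of values would give
  -- degenerate divided differences, contradicting the nonzero limit of their determinant.
  filter_upwards [hdet.eventually_ne hnd] with t ht h
  refine ht ?_
  simp only [Function.comp_apply, id_eq]
  rw [det_varMatrix_linComb fun i => (hf.isCenteredGaussianVector (x t)).memLp i (by simp), h,
    mul_zero]

/-- With `p` the pair factor, the change of variables contributes `|det M|⁻¹ ∏ |d i| = p⁻¹ p ^ 2 =
p`. -/
theorem pairFactor_mul_kacRiceDensity (hf : IsNormalizedStationaryGaussian μ k f) (hk : 1 ≤ k)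
    (y : Fin k → ℝ) {x : Fin k → ℝ} (hx : Function.Injective x)
    (hnd : IsNondegenerateVector μ fun i => f (x i)) :
    pairFactor y x * kacRiceDensity μ (fun i => f (x i)) (fun i => processDeriv f 1 (x i)) =
      kacRiceDensity μ (linComb (newtonMatrix y x) fun i => f (x i)) fun i ω =>
        Lagrange.nodalWeight (cluster y i) x i * processDeriv f 1 (x i) ω +
          linComb (hermiteMatrix y x) (fun i => f (x i)) i ω := by
  have hp := pairFactor_pos (y := y) hx
  have hdet := abs_det_newtonMatrix y x
  rw [kacRiceDensity_linComb (fun i => (hf.isCenteredGaussianVector x).memLp i (by simp))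
    (fun i => (hf.isCenteredGaussianVector_processDeriv (fun _ => 1) x fun _ => hk).memLp i
      (by simp)) hnd (abs_pos.mp (hdet ▸ hp)), hdet, prod_abs_nodalWeight_cluster]
  field_simp

/-- Absorbing the factor into divided differences replaces a degenerating vector by one with a
non-degenerate limit, to which continuity of the Kac–Rice density applies. -/
theorem tendsto_pairFactor_mul_kacRiceDensity [l.IsCountablyGenerated]
    (hf : IsNormalizedStationaryGaussian μ k f) (hk : 1 ≤ k)
    (hx : Tendsto x l (𝓝 y)) (hinj : ∀ᶠ t in l, Function.Injective (x t))
    (hnd : IsNondegenerateVector μ (newtonLimit f y)) :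
    Tendsto (fun t => pairFactor y (x t) *
      kacRiceDensity μ (fun i => f (x t i)) fun i => processDeriv f 1 (x t i)) l
      (𝓝 (kacRiceDensity μ (newtonLimit f y) (hermiteLimit f y))) := by
  refine (tendsto_kacRiceDensity (fun t => isCenteredGaussianVector_newton hf hk y (x t))
    (isCenteredGaussianVector_newtonLimit hf y) (ae_tendsto_newton hf hx hinj)
    (ae_tendsto_hermite hf hx hinj) hnd).congr' ?_
  filter_upwards [hinj, eventually_isNondegenerateVector hf hk hx hinj hnd] with t h1 h2
  exact (pairFactor_mul_kacRiceDensity hf hk y h1 h2).symm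

end NewtonLimit

/-! ### The constant `ℓ(y)` -/

section Constant

variable {Ω : Type*} [MeasurableSpace Ω] {μ : Measure Ω} [IsProbabilityMeasure μ] {k : ℕ}
  {f : ℝ → Ω → ℝ} {y : Fin k → ℝ} {P : Finpartition (Finset.univ : Finset (Fin k))}
  {yv : Finset (Fin k) → ℝ}

theorem isCenteredGaussianVector_clusterJet (hf : IsNormalizedStationaryGaussian μ k f)
    (P : Finpartition (Finset.univ : Finset (Fin k))) (yv : Finset (Fin k) → ℝ) :
    IsCenteredGaussianVector (Sum.elim (clusterJet f P yv) (clusterTop f P yv)) μ :=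
  hf.isCenteredGaussianVector_elim_processDeriv
    (fun a : Σ I : P.parts, Fin I.1.card => (a.2 : ℕ)) (fun I : P.parts => I.1.card)
    (fun a => yv a.1) (fun I => yv I) (fun a => a.2.2.le.trans (card_finset_fin_le _))
    fun _ => card_finset_fin_le _

theorem vanishingConstant_eq (hf : IsNormalizedStationaryGaussian μ k f)
    (P : Finpartition (Finset.univ : Finset (Fin k))) (yv : Finset (Fin k) → ℝ) :
    vanishingConstant μ f P yv =
      (∏ I ∈ P.parts, ∏ i ∈ Finset.range I.card, ((i ! : ℝ) / (I.card ! : ℝ))) *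
      (((2 * Real.pi) ^ ((k : ℝ) / 2) *
        (varMatrix μ (clusterJet f P yv)).det ^ ((1 : ℝ) / 2))⁻¹ *
        ∫ ω, ∏ I : P.parts,
          |regressionResidual μ (clusterJet f P yv) (clusterTop f P yv) I ω| ^ I.1.card ∂μ) := by
  have h := isCenteredGaussianVector_clusterJet hf P yv
  rw [vanishingConstant, gaussianCondExpZero_eq_integral_residual
    (fun a => (isCenteredGaussianVector_left h).aemeasurable a)
    (fun b => (isCenteredGaussianVector_right h).aemeasurable b) (by fun_prop), div_eq_inv_mul]

variable {e : (Σ I : P.parts, Fin I.1.card) ≃ Fin k}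
  (he : ∀ a, y (e a) = yv a.1 ∧ cluster y (e a) = a.1 ∧ (clusterBelow y (e a)).card = a.2)

include he

omit [MeasurableSpace Ω] in
theorem processDeriv_clusterBelow_eq (i : Fin k) :
    processDeriv f (clusterBelow y i).card (y i) = clusterJet f P yv (e.symm i) := by
  obtain ⟨h1, -, h3⟩ := he (e.symm i)
  rw [e.apply_symm_apply] at h1 h3
  rw [h1, h3]
  rfl

omit [MeasurableSpace Ω] in
theorem processDeriv_cluster_eq (i : Fin k) :
    processDeriv f (cluster y i).card (y i) = clusterTop f P yv (e.symm i).1 := by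
  obtain ⟨h1, h2, -⟩ := he (e.symm i)
  rw [e.apply_symm_apply] at h1 h2
  rw [h1, h2]
  rfl

omit [IsProbabilityMeasure μ] in
theorem det_varMatrix_processDeriv_clusterBelow :
    (varMatrix μ fun i => processDeriv f (clusterBelow y i).card (y i)).det =
      (varMatrix μ (clusterJet f P yv)).det := by
  simp only [processDeriv_clusterBelow_eq he]
  rw [varMatrix_comp, Matrix.det_submatrix_equiv_self]

omit [MeasurableSpace Ω] in
theorem prod_factorial_eq :
    ∏ I ∈ P.parts, ∏ i ∈ Finset.range I.card, ((i ! : ℝ) / (I.card ! : ℝ)) =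
      ∏ i, ((clusterBelow y i).card ! : ℝ) / ((cluster y i).card ! : ℝ) := by
  rw [← e.prod_comp, Fintype.prod_sigma, ← Finset.prod_coe_sort]
  refine Finset.prod_congr rfl fun I _ => ?_
  rw [← Fin.prod_univ_eq_prod_range fun i => (i ! : ℝ) / (I.1.card ! : ℝ)]
  refine Finset.prod_congr rfl fun j _ => ?_
  obtain ⟨-, h2, h3⟩ := he ⟨I, j⟩
  rw [h2, h3]

theorem isNondegenerateVector_newtonLimit (hf : IsNormalizedStationaryGaussian μ k f)
    (hnd : IsNondegenerateVector μ (clusterJet f P yv)) :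
    IsNondegenerateVector μ (newtonLimit f y) := by
  have hA := isCenteredGaussianVector_left (hf.isCenteredGaussianVector_elim_processDeriv _ _ y y
    (card_clusterBelow_le (y := y)) (card_cluster_le (y := y)))
  rw [IsNondegenerateVector, newtonLimit_eq_linComb,
    det_varMatrix_linComb fun i => hA.memLp i (by simp),
    det_varMatrix_processDeriv_clusterBelow he, Matrix.det_diagonal]
  refine mul_ne_zero (pow_ne_zero _ (Finset.prod_ne_zero_iff.mpr fun i _ => ?_)) hnd
  exact inv_ne_zero (by exact_mod_cast Nat.factorial_ne_zero _)

/-- The factorials are diagonal rescalings of the jets: those of the values enter through the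
inverse determinant and those of the top derivatives directly, giving the ratios `i ! / |I| !`. What
remains is a reindexing by clusters. -/
theorem kacRiceDensity_newtonLimit (hf : IsNormalizedStationaryGaussian μ k f)
    (hnd : IsNondegenerateVector μ (clusterJet f P yv)) :
    kacRiceDensity μ (newtonLimit f y) (hermiteLimit f y) = vanishingConstant μ f P yv := by
  have hAB := hf.isCenteredGaussianVector_elim_processDeriv _ _ y y
    (card_clusterBelow_le (y := y)) (card_cluster_le (y := y))
  have hA := isCenteredGaussianVector_left hAB
  have hB := isCenteredGaussianVector_right hAB
  have hpos : ∀ n : ℕ, (0 : ℝ) < n ! := fun n => by exact_mod_cast n.factorial_pos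
  have hM : (Matrix.diagonal fun i => ((clusterBelow y i).card ! : ℝ)⁻¹).det ≠ 0 := by
    rw [Matrix.det_diagonal]
    exact Finset.prod_ne_zero_iff.mpr fun i _ => (inv_pos.mpr (hpos _)).ne'
  -- The residual of the top derivative of a block appears once for each index in the block.
  have hint : ∀ ω, ∏ i, |regressionResidual μ
        (fun i => processDeriv f (clusterBelow y i).card (y i))
        (fun i => processDeriv f (cluster y i).card (y i)) i ω| =
      ∏ I : P.parts,
        |regressionResidual μ (clusterJet f P yv) (clusterTop f P yv) I ω| ^ I.1.card := fun ω => by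
    simp only [processDeriv_clusterBelow_eq he, processDeriv_cluster_eq he]
    simp only [regressionResidual_comp_equiv (clusterJet f P yv) (clusterTop f P yv) e.symm
      fun i => (e.symm i).1]
    rw [e.symm.prod_comp fun a =>
      |regressionResidual μ (clusterJet f P yv) (clusterTop f P yv) a.1 ω|, Fintype.prod_sigma]
    simp
  have hnd' : IsNondegenerateVector μ fun i => processDeriv f (clusterBelow y i).card (y i) := by
    rwa [IsNondegenerateVector, det_varMatrix_processDeriv_clusterBelow he]
  rw [newtonLimit_eq_linComb, hermiteLimit_eq_add_linComb, kacRiceDensity_linComb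
    (fun i => hA.memLp i (by simp)) (fun i => hB.memLp i (by simp)) hnd' hM, kacRiceDensity,
    gaussianDensity_zero, det_varMatrix_processDeriv_clusterBelow he, vanishingConstant_eq hf,
    prod_factorial_eq he, Fintype.card_fin]
  simp only [hint]
  congr 1
  rw [Matrix.det_diagonal, Finset.abs_prod, ← Finset.prod_inv_distrib, ← Finset.prod_mul_distrib]
  refine Finset.prod_congr rfl fun i _ => ?_
  rw [abs_of_pos (inv_pos.mpr (hpos _)), abs_of_pos (inv_pos.mpr (hpos _)), inv_inv,
    div_eq_mul_inv]

end Constant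

/-! ### Positivity of the constant -/

section Positivity

variable {Ω : Type*} [MeasurableSpace Ω] {μ : Measure Ω} [IsProbabilityMeasure μ]

omit [IsProbabilityMeasure μ] in
theorem IsCenteredGaussianVector.ae_ne_zero {ι : Type*} [Fintype ι] {X : ι → Ω → ℝ}
    (hX : IsCenteredGaussianVector X μ) {i : ι} (hv : Var[X i; μ] ≠ 0) :
    ∀ᵐ ω ∂μ, X i ω ≠ 0 := by
  have h0 : Var[X i; μ].toNNReal ≠ 0 := by
    rw [ne_eq, Real.toNNReal_eq_zero, not_le]
    exact lt_of_le_of_ne (variance_nonneg _ _) hv.symm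
  have := nullSingletonClass_gaussianReal (μ := μ[X i]) h0
  have h : μ.map (X i) {0} = 0 := by
    rw [(hX.eval i).map_eq_gaussianReal]
    exact measure_singleton 0
  rw [Measure.map_apply_of_aemeasurable (hX.aemeasurable i) (measurableSet_singleton 0)] at h
  exact measure_eq_zero_iff_ae_notMem.mp h

/-- A positive semidefinite matrix with nonzero determinant is positive definite, and the variance
is its quadratic form at the row `M j`. -/
theorem variance_linComb_pos {ι κ : Type*} [Fintype ι] [DecidableEq ι] [Fintype κ]
    {X : ι → Ω → ℝ} (hX : ∀ i, MemLp (X i) 2 μ) (hnd : IsNondegenerateVector μ X)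
    (M : Matrix κ ι ℝ) {j : κ} (hM : M j ≠ 0) : 0 < Var[linComb M X j; μ] := by
  have hMX : MemLp (linComb M X j) 2 μ := memLp_finsetSum _ fun i _ => (hX i).const_mul _
  have hpd : (varMatrix μ X).PosDef :=
    (posSemidef_varMatrix hX).posDef_iff_det_ne_zero.mpr hnd
  have h := congrFun (congrFun (varMatrix_linComb hX M) j) j
  rw [varMatrix, covMatrix, Matrix.of_apply, covariance_self hMX.aemeasurable] at h
  rw [h]
  have h2 := hpd.dotProduct_mulVec_pos hM
  rw [Matrix.mul_assoc]
  exact h2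

variable {k : ℕ} {f : ℝ → Ω → ℝ} {P : Finpartition (Finset.univ : Finset (Fin k))}
  {yv : Finset (Fin k) → ℝ}

/-- The coefficients of the residual of the top derivatives in terms of the extended jet. -/
def residualMatrix (μ : Measure Ω) (f : ℝ → Ω → ℝ)
    (P : Finpartition (Finset.univ : Finset (Fin k))) (yv : Finset (Fin k) → ℝ) :
    Matrix P.parts (Σ I : P.parts, Fin (I.1.card + 1)) ℝ :=
  Matrix.of fun I a => Fin.lastCases (motive := fun _ => ℝ) (if a.1 = I then 1 else 0)
    (fun j => -regressionMatrix μ (clusterJet f P yv) (clusterTop f P yv) I ⟨a.1, j⟩) a.2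

omit [IsProbabilityMeasure μ] in
theorem regressionResidual_clusterTop (I : P.parts) :
    regressionResidual μ (clusterJet f P yv) (clusterTop f P yv) I =
      linComb (residualMatrix μ f P yv) (clusterJetExt f P yv) I := by
  funext ω
  simp only [regressionResidual, linComb, residualMatrix, Matrix.of_apply, Fintype.sum_sigma,
    Fin.sum_univ_castSucc, Fin.lastCases_castSucc, Fin.lastCases_last, Finset.sum_add_distrib,
    Matrix.mulVec, dotProduct, ite_mul, one_mul, zero_mul, Finset.sum_ite_eq', Finset.mem_univ,
    if_true, neg_mul, Finset.sum_neg_distrib]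
  rw [sub_eq_neg_add]
  rfl

/-- The residual of a top derivative is a combination of the extended jet in which that derivative
has coefficient `1`. Its variance is therefore positive, it is almost surely nonzero, and so is the
product of the residuals. -/
theorem vanishingConstant_pos (hf : IsNormalizedStationaryGaussian μ k f)
    (hnd : IsNondegenerateVector μ (clusterJet f P yv))
    (hnd' : IsNondegenerateVector μ (clusterJetExt f P yv)) :
    0 < vanishingConstant μ f P yv := by
  have hJ := isCenteredGaussianVector_clusterJet hf P yv
  have hW := isCenteredGaussianVector_right (isCenteredGaussianVector_elim_residual hJ)
  have hext : IsCenteredGaussianVector (clusterJetExt f P yv) μ :=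
    hf.isCenteredGaussianVector_processDeriv
      (fun a : Σ I : P.parts, Fin (I.1.card + 1) => (a.2 : ℕ)) (fun a => yv a.1) fun a =>
        (Nat.lt_succ_iff.mp a.2.2).trans (card_finset_fin_le _)
  have hne : ∀ I, ∀ᵐ ω ∂μ,
      regressionResidual μ (clusterJet f P yv) (clusterTop f P yv) I ω ≠ 0 := fun I => by
    refine hW.ae_ne_zero ?_
    rw [regressionResidual_clusterTop]
    refine (variance_linComb_pos (fun a => hext.memLp a (by simp)) hnd' _ fun h => ?_).ne'
    have := congrFun h ⟨I, Fin.last _⟩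
    simp [residualMatrix] at this
  have hdet := varMatrix_det_pos (fun a => (isCenteredGaussianVector_left hJ).memLp a (by simp)) hnd
  rw [vanishingConstant_eq hf]
  refine mul_pos (Finset.prod_pos fun I _ => Finset.prod_pos fun i _ => by positivity)
    (mul_pos (by positivity) ?_)
  rw [integral_pos_iff_support_of_nonneg (fun ω => Finset.prod_nonneg fun I _ => by positivity)]
  · have hs : ∀ᵐ ω ∂μ, ω ∈ Function.support fun ω => ∏ I : P.parts,
        |regressionResidual μ (clusterJet f P yv) (clusterTop f P yv) I ω| ^ I.1.card := by
      filter_upwards [ae_all_iff.mpr hne] with ω hω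
      exact Finset.prod_ne_zero_iff.mpr fun I _ => pow_ne_zero _ (abs_ne_zero.mpr (hω I))
    refine pos_iff_ne_zero.mpr fun h => ?_
    obtain ⟨ω, h1, h2⟩ := (hs.and (measure_eq_zero_iff_ae_notMem.mp h)).exists
    exact h2 h1
  -- Integrability is essential for positivity, since the integral of a non-integrable function is
  -- `0` by convention.
  · set W := regressionResidual μ (clusterJet f P yv) (clusterTop f P yv) with hWdef
    have hprod : ∀ ω, ∏ I : P.parts, |W I ω| ^ I.1.card =
        ∏ a : (Σ I : P.parts, Fin I.1.card), |W a.1 ω| := fun ω => by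
      rw [Fintype.prod_sigma]
      simp
    have hint : ∀ (I : P.parts) (n : ℕ), Integrable (fun ω => |W I ω| ^ n) μ := fun I n =>
      (hW.memLp I (p := n) (by simp)).integrable_norm_pow'
    have hc : Continuous fun w : P.parts → ℝ => ∏ I : P.parts, |w I| ^ I.1.card := by fun_prop
    refine Integrable.mono' ((integrable_const (1 : ℝ)).add (integrable_finsetSum Finset.univ
      fun (a : Σ I : P.parts, Fin I.1.card) _ => hint a.1
        (Fintype.card (Σ I : P.parts, Fin I.1.card))))
      (hc.comp_aestronglyMeasurable hW.gaussian.aemeasurable.aestronglyMeasurable)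
      (ae_of_all _ fun ω => ?_)
    rw [Real.norm_of_nonneg (Finset.prod_nonneg fun I _ => by positivity), hprod]
    exact prod_abs_le_one_add_sum _

end Positivity

end

/-! ### Conclusion: the vanishing order of the `k`-point function -/

theorem theorem1p9 {Ω : Type*} [MeasurableSpace Ω] (μ : Measure Ω) [IsProbabilityMeasure μ]
    (k : ℕ) (hk : 1 ≤ k) (f : ℝ → Ω → ℝ) (hf : IsNormalizedStationaryGaussian μ k f)
    (y : Fin k → ℝ) (P : Finpartition (Finset.univ : Finset (Fin k)))
    (yv : Finset (Fin k) → ℝ) (hP : IsClusterPartition y P yv)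
    (hnd : IsNondegenerateVector μ (clusterJet f P yv)) :
    (∃ U ∈ 𝓝 y, ∃ ρ : (Fin k → ℝ) → ℝ,
      (∀ x ∈ U \ largeDiagonal k, HasKPointFunctionAt μ (zeroSet f) x (ρ x)) ∧
      Tendsto (fun x => clusterFactor P x * ρ x) (𝓝[U \ largeDiagonal k] y)
        (𝓝 (vanishingConstant μ f P yv))) ∧
    (IsNondegenerateVector μ (clusterJetExt f P yv) → 0 < vanishingConstant μ f P yv) := by
  obtain ⟨e, he⟩ := hP.exists_equiv
  refine ⟨?_, vanishingConstant_pos hf hnd⟩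
  have hinj : ∀ x ∈ (largeDiagonal k)ᶜ, Function.Injective x := fun x hx i j hij =>
    by_contra fun h => hx ⟨i, j, h, hij⟩
  have hnd' := isNondegenerateVector_newtonLimit he hf hnd
  have hx : Tendsto id (𝓝[(largeDiagonal k)ᶜ] y) (𝓝 y) := tendsto_id.mono_left nhdsWithin_le_nhds
  have hev : ∀ᶠ x in 𝓝[(largeDiagonal k)ᶜ] y, Function.Injective (id x) :=
    eventually_mem_nhdsWithin.mono hinj
  -- The neighbourhood of the theorem is the set of the `x` whose values `f (x i)` are
  -- non-degenerate unless `x` lies on the large diagonal.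
  have hU := eventually_nhdsWithin_iff.mp (eventually_isNondegenerateVector hf hk hx hev hnd')
  have hlim := tendsto_pairFactor_mul_kacRiceDensity hf hk hx hev hnd'
  rw [kacRiceDensity_newtonLimit he hf hnd] at hlim
  refine ⟨_, hU, fun x => kacRiceDensity μ (fun i => f (x i)) fun i => processDeriv f 1 (x i),
    fun x hx => hf.hasKPointFunctionAt hk x (hx.1 hx.2), ?_⟩
  simp only [hP.clusterFactor_eq]
  exact hlim.mono_left (nhdsWithin_mono _ fun x hx => hx.2)
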